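/- **Setting.** A Young function is a continuous, convex, increasing (i.e. nondecreasing) function $\theta:[0,\infty)\to\mathbb R$ with $\theta(0)=0$ and $\theta(x)/x\to\infty$ as $x\to\infty$. For a function $\theta$ on $[0,\infty)$ put $\theta^*(x)=\sup_{t\ge 0}(tx-\theta(t))$. For $i=1,2$ let $\theta_i$ be a Young function, $\varphi_i=(e^{\theta_i^*})^*$, and let $N_i$ be a complex nuclear Fréchet space whose topology is defined by an increasing sequence of Hilbertian norms $|\cdot|_{p}$, $p\in\mathbb N$; let $N_{i,-p}$ be the dual of $(N_i,|\cdot|_{p})$ with its dual norm $|\cdot|_{-p}$, so that the dual of $N_i$ is $N_i'=\bigcup_p N_{i,-p}$. For a nondecreasing function $\theta$ on $[0,\infty)$ with $\theta(x)/x\to\infty$ let $\mathcal F_\theta(N_i')$ be the space of all $f:N_i'\to\mathbb C$ whose restriction to each $N_{i,-p}$ is entire and for which $$\|f\|_{p,a}=\sup_{z\in N_{i,-p}}|f(z)|\,e^{-\theta(a|z|_{-p})}<\infty\qquad\text{for all }p\in\mathbb N,\ a>0,$$ with the topology of these norms. Let $\mathcal F^*_\theta(N_i')$ be its strong dual, and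 give the space of continuous linear operators $\mathcal L(\mathcal F_{\theta}(N_1'),\mathcal F^*_{\vartheta}(N_2'))$ the topology of bounded convergence. With $e_\xi(z)=e^{\langle z,\xi\rangle}$, the symbol of such an operator $\Xi$ is $\sigma(\Xi)(\xi,\eta)=\langle\!\langle \Xi e_\xi,e_\eta\rangle\!\rangle$, $\xi\in N_1$, $\eta\in N_2$. Write $\mathcal L=\mathcal L(\mathcal F_{\theta_1}(N_1'),\mathcal F^*_{\theta_2}(N_2'))$ and $\mathcal L_e=\mathcal L(\mathcal F_{\varphi_1}(N_1'),\mathcal F^*_{\varphi_2}(N_2'))$. Since $\varphi_i\le\theta_i$, we have $\mathcal F_{\varphi_i}(N_i')\subset\mathcal F_{\theta_i}(N_i')$ continuously, and operators in $\mathcal L$ are regarded as operators in $\mathcal L_e$ by restriction. The convolution product $A*B$ (in $\mathcal L_e$), the convolution exponential $e^{*A}$ (in $\mathcal L_e$, for $A\in\mathcal L$) and the integral of a family of operators are the operators defined by $$\sigma(A*B)=\sigma(A)\sigma(B),\qquad \sigma(e^{*A})=e^{\sigma(A)},\qquad \sigma\Big(\int_a^b X(s)\,ds\Big)=\int_a^b\sigma(X(s))\,ds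 .$$ **Theorem.** Let $I\subset\mathbb R$ be an interval containing $0$, let $Z,\Theta:I\to\mathcal L$ be continuous, and let $\Xi_0\in\mathcal L$. Then all operators in the equation and in the formula below are well defined (for each of them, the pointwise integrals of symbols exist, and there is exactly one operator with the required symbol: $A*B\in\mathcal L_e$ for all $A,B\in\mathcal L_e$, $e^{*A}\in\mathcal L_e$ for all $A\in\mathcal L$, $\int_s^tZ(u)\,du\in\mathcal L$ for all $s,t\in I$, and the last integral below is in $\mathcal L_e$), and the initial value problem $$\frac{d\Xi(t)}{dt}=Z(t)*\Xi(t)+\Theta(t)\quad(t\in I),\qquad \Xi(0)=\Xi_0,$$ where the derivative is taken in the topology of $\mathcal L_e$ (one-sided at end points of $I$), has exactly one solution $\Xi:I\to\mathcal L_e$. It is given by $$\Xi(t)=\Xi_0*e^{*\int_0^tZ(s)\,ds}+\int_0^te^{*\int_s^tZ(u)\,du}*\Theta(s)\,ds,\qquad t\in I.$$ -/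

import Mathlib

open Filter Topology Set

noncomputable section

namespace QWN

/-! ## Young functions and conjugates -/

/-- A function on `[0, ∞)` that is nondecreasing and grows faster than every linear function
(values at negative arguments are irrelevant throughout). -/
class IsGrowth (θ : ℝ → ℝ) : Prop where
  mono : MonotoneOn θ (Ici 0)
  superlinear : Tendsto (fun x => θ x / x) atTop atTop

/-- Young functions: continuous, convex, increasing on `[0, ∞)`, with `θ 0 = 0` and
`θ x / x → ∞`. -/
class IsYoung (θ : ℝ → ℝ) : Prop extends IsGrowth θ where
  cont : ContinuousOn θ (Ici 0)
  convex : ConvexOn ℝ (Ici 0) θ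
  zero : θ 0 = 0

/-- The conjugate function `θ* x = sup_{t ≥ 0} (t x - θ t)`. -/
def conj (θ : ℝ → ℝ) (x : ℝ) : ℝ := ⨆ t : Ici (0 : ℝ), ((t : ℝ) * x - θ t)

/-- The function `(e^{θ*})*`. -/
def expConj (θ : ℝ → ℝ) : ℝ → ℝ := conj (fun x => Real.exp (conj θ x))

theorem IsGrowth.bddAbove {θ : ℝ → ℝ} (h : IsGrowth θ) (c : ℝ) {a : ℝ} (ha : 0 < a) :
    ∃ C : ℝ, ∀ x, 0 ≤ x → c * x - θ (a * x) ≤ C := by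
  obtain ⟨R, hR⟩ := eventually_atTop.1 (h.superlinear.eventually_ge_atTop (c / a))
  refine ⟨max (|c| * (max R 1 / a) - θ 0) 0, fun x hx => ?_⟩
  rcases le_or_gt (max R 1) (a * x) with h1 | h1
  · refine le_max_of_le_right ?_
    have h2 := hR (a * x) (le_trans (le_max_left _ _) h1)
    have h3 : 0 < a * x := lt_of_lt_of_le one_pos (le_trans (le_max_right _ _) h1)
    rw [le_div_iff₀ h3] at h2
    have h4 : c / a * (a * x) = c * x := by field_simp
    linarith
  · refine le_max_of_le_left ?_
    have h2 : θ 0 ≤ θ (a * x) :=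
      h.mono (mem_Ici.2 le_rfl) (mem_Ici.2 (by positivity)) (by positivity)
    have h3 : x ≤ max R 1 / a := by
      rw [le_div_iff₀ ha]; linarith
    have h4 : c * x ≤ |c| * (max R 1 / a) :=
      le_trans (mul_le_mul_of_nonneg_right (le_abs_self c) hx)
        (mul_le_mul_of_nonneg_left h3 (abs_nonneg c))
    linarith

theorem IsGrowth.conj_bddAbove {θ : ℝ → ℝ} (h : IsGrowth θ) (x : ℝ) :
    BddAbove (range fun t : Ici (0 : ℝ) => ((t : ℝ) * x - θ t)) := by
  obtain ⟨C, hC⟩ := h.bddAbove x one_pos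
  refine ⟨C, ?_⟩
  rintro _ ⟨t, rfl⟩
  have := hC t t.2
  simp only [one_mul] at this
  simpa [mul_comm] using this

theorem IsGrowth.le_conj {θ : ℝ → ℝ} (h : IsGrowth θ) (x : ℝ) {t : ℝ} (ht : 0 ≤ t) :
    t * x - θ t ≤ conj θ x :=
  le_ciSup (h.conj_bddAbove x) (⟨t, ht⟩ : Ici (0 : ℝ))

instance IsGrowth.conj {θ : ℝ → ℝ} [h : IsGrowth θ] : IsGrowth (conj θ) where
  mono := by
    intro x _ y _ hxy
    have : Nonempty (Ici (0 : ℝ)) := ⟨⟨0, mem_Ici.2 le_rfl⟩⟩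
    refine ciSup_mono (h.conj_bddAbove y) fun t => ?_
    have := mul_le_mul_of_nonneg_left hxy t.2
    linarith
  superlinear := by
    refine tendsto_atTop.2 fun b => ?_
    have hb : 0 ≤ |b| + 1 := by positivity
    filter_upwards [eventually_ge_atTop (max 1 |θ (|b| + 1)|)] with x hx
    have hx1 : 1 ≤ x := le_trans (le_max_left _ _) hx
    have hx2 : |θ (|b| + 1)| ≤ x := le_trans (le_max_right _ _) hx
    rw [le_div_iff₀ (by linarith)]
    have h1 := h.le_conj x hb
    have h2 := le_abs_self (θ (|b| + 1))
    have h3 : b * x ≤ |b| * x := mul_le_mul_of_nonneg_right (le_abs_self b) (by linarith)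
    nlinarith

instance IsGrowth.exp {θ : ℝ → ℝ} [h : IsGrowth θ] : IsGrowth (fun x => Real.exp (θ x)) where
  mono := fun _ hx _ hy hxy => Real.exp_le_exp.2 (h.mono hx hy hxy)
  superlinear := by
    refine tendsto_atTop_mono' _ ?_ h.superlinear
    filter_upwards [eventually_gt_atTop 0] with x hx
    have := Real.add_one_le_exp (θ x)
    gcongr
    linarith

instance IsGrowth.expConj {θ : ℝ → ℝ} [IsGrowth θ] : IsGrowth (expConj θ) :=
  inferInstanceAs (IsGrowth (QWN.conj (fun x => Real.exp (QWN.conj θ x))))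

theorem expConj_le {θ : ℝ → ℝ} (h : IsGrowth θ) {x : ℝ} (hx : 0 ≤ x) : expConj θ x ≤ θ x := by
  have : Nonempty (Ici (0 : ℝ)) := ⟨⟨0, mem_Ici.2 le_rfl⟩⟩
  refine ciSup_le fun t => ?_
  have h1 := h.le_conj t hx
  have h2 := Real.add_one_le_exp (conj θ t)
  have h3 : x * (t : ℝ) = t * x := mul_comm _ _
  linarith

/-! ## Nuclear Fréchet spaces given by Hilbertian norms -/

/-- The norm `√⟨x, x⟩` of an inner product, as a seminorm. -/
def coreSeminorm {N : Type*} [AddCommGroup N] [Module ℂ N] (c : InnerProductSpace.Core ℂ N) :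
    Seminorm ℂ N :=
  letI := c.toNormedAddCommGroup
  letI : NormedSpace ℂ N := InnerProductSpace.Core.toNormedSpace
  normSeminorm ℂ N

/-- The topology of `N` is given by an increasing sequence of Hilbertian norms
`|·|_p = √⟨x, x⟩_p`, and it is nuclear: for every `p` there is `q > p` such that the canonical map
`N_q → N_p` between the completions is Hilbert-Schmidt.  As `N` is dense in `N_q`, the square of
the Hilbert-Schmidt norm is the supremum of `∑ |e i|_p²` over the finite `q`-orthonormal families
in `N`.  (Compositions of two Hilbert-Schmidt maps are trace class, so this is nuclearity.)
Completeness of `N` is a separate instance argument. -/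
class NuclearHilbertian (N : Type*) [AddCommGroup N] [Module ℂ N] [UniformSpace N] where
  /-- the inner product `⟨·, ·⟩_p` -/
  core : ℕ → InnerProductSpace.Core ℂ N
  mono : Monotone fun p => coreSeminorm (core p)
  withSeminorms : WithSeminorms fun p => coreSeminorm (core p)
  hilbertSchmidt : ∀ p, ∃ q > p, ∃ C : ℝ, ∀ (n : ℕ) (e : Fin n → N),
    (∀ i j, (core q).inner (e i) (e j) = if i = j then 1 else 0) →
      ∑ i, coreSeminorm (core p) (e i) ^ 2 ≤ C

section Spaces

variable (N : Type*) [AddCommGroup N] [Module ℂ N] [UniformSpace N] [NuclearHilbertian N]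

/-- `N` with the norm `|·|_p`; its completion is the Hilbert space `N_p`. -/
def Step (_p : ℕ) : Type _ := N

instance (p : ℕ) : NormedAddCommGroup (Step N p) :=
  (NuclearHilbertian.core (N := N) p).toNormedAddCommGroup

instance (p : ℕ) : InnerProductSpace ℂ (Step N p) :=
  InnerProductSpace.ofCore (F := N) (NuclearHilbertian.core (N := N) p).toCore

/-- The identity `N → N_p`, which is continuous. -/
def toStep (p : ℕ) : N →L[ℂ] Step N p where
  toFun := fun x => x
  map_add' := fun _ _ => rfl
  map_smul' := fun _ _ => rfl
  cont := by
    have h := NuclearHilbertian.withSeminorms (N := N)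
    have := h.topologicalAddGroup
    let f : N →ₗ[ℂ] Step N p :=
      { toFun := fun x => x, map_add' := fun _ _ => rfl, map_smul' := fun _ _ => rfl }
    refine WithSeminorms.continuous_normedSpace_rng (Step N p) h f ⟨{p}, 1, ?_⟩
    rw [Finset.sup_singleton, one_smul]
    exact fun _ => le_rfl

/-- The space `N_{-p}`: the dual of `N` with the norm `|·|_p`, which is also the dual of the
completion `N_p`, with the dual norm `|·|_{-p}`. -/
abbrev NegStep (p : ℕ) : Type _ := StrongDual ℂ (Step N p)

/-- The inclusion of `N_{-p}` into `N'` (restriction of functionals).  By the definition of the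
topology of `N`, the dual `N'` is the union of the images. -/
def negIncl (p : ℕ) (z : NegStep N p) : StrongDual ℂ N := z.comp (toStep N p)

variable {N} in
theorem negIncl_apply (p : ℕ) (z : NegStep N p) (ξ : N) : negIncl N p z ξ = z (toStep N p ξ) := rfl

/-! ## Test functions -/

/-- The functions on `N'` whose restriction to every `N_{-p}` is entire, with
`sup_z |f z| e^{-θ(a |z|_{-p})} < ∞` for all `p` and all `a > 0`. -/
def testSubmodule (θ : ℝ → ℝ) : Submodule ℂ (StrongDual ℂ N → ℂ) where
  carrier := {f | ∀ p, Differentiable ℂ (fun z : NegStep N p => f (negIncl N p z)) ∧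
    ∀ a > 0, BddAbove (range fun z : NegStep N p =>
      ‖f (negIncl N p z)‖ * Real.exp (-θ (a * ‖z‖)))}
  add_mem' := by
    intro f g hf hg p
    refine ⟨(hf p).1.add (hg p).1, fun a ha => ?_⟩
    obtain ⟨A, hA⟩ := (hf p).2 a ha
    obtain ⟨B, hB⟩ := (hg p).2 a ha
    refine ⟨A + B, ?_⟩
    rintro _ ⟨z, rfl⟩
    have h1 := hA ⟨z, rfl⟩
    have h2 := hB ⟨z, rfl⟩
    refine le_trans ?_ (add_le_add h1 h2)
    simp only [Pi.add_apply]
    rw [← add_mul]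
    exact mul_le_mul_of_nonneg_right (norm_add_le _ _) (Real.exp_pos _).le
  zero_mem' := by
    intro p
    refine ⟨differentiable_const _, fun a _ => ⟨0, ?_⟩⟩
    rintro _ ⟨z, rfl⟩
    simp
  smul_mem' := by
    intro c f hf p
    refine ⟨(hf p).1.const_smul c, fun a ha => ?_⟩
    obtain ⟨A, hA⟩ := (hf p).2 a ha
    refine ⟨‖c‖ * A, ?_⟩
    rintro _ ⟨z, rfl⟩
    have h1 := hA ⟨z, rfl⟩
    simp only [Pi.smul_apply, norm_smul, mul_assoc]
    exact mul_le_mul_of_nonneg_left h1 (norm_nonneg c)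

end Spaces

/-- The space `F_θ(N')` of entire functions on `N'` of `θ`-exponential growth of minimal type: the
projective limit of the spaces `Exp(N_{-p}, θ, a)` as `p → ∞` and `a ↓ 0`. -/
def TestSpace (θ : ℝ → ℝ) (N : Type*) [AddCommGroup N] [Module ℂ N] [UniformSpace N]
    [NuclearHilbertian N] : Type _ := ↥(testSubmodule N θ)

section TestSpace

variable (θ : ℝ → ℝ) (N : Type*) [AddCommGroup N] [Module ℂ N] [UniformSpace N]
  [NuclearHilbertian N]

instance : AddCommGroup (TestSpace θ N) := inferInstanceAs (AddCommGroup ↥(testSubmodule N θ))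

instance : Module ℂ (TestSpace θ N) := inferInstanceAs (Module ℂ ↥(testSubmodule N θ))

instance : CoeFun (TestSpace θ N) (fun _ => StrongDual ℂ N → ℂ) := ⟨fun f => f.1⟩

variable {θ N} in
theorem TestSpace.bddAbove (f : TestSpace θ N) (p : ℕ) {a : ℝ} (ha : 0 < a) :
    BddAbove (range fun z : NegStep N p => ‖f (negIncl N p z)‖ * Real.exp (-θ (a * ‖z‖))) :=
  (f.2 p).2 a ha

variable {θ N} in
theorem TestSpace.iSup_nonneg (f : TestSpace θ N) (p : ℕ) (a : ℝ) :
    0 ≤ ⨆ z : NegStep N p, ‖f (negIncl N p z)‖ * Real.exp (-θ (a * ‖z‖)) :=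
  Real.iSup_nonneg fun _ => mul_nonneg (norm_nonneg _) (Real.exp_pos _).le

/-- The norm `‖f‖_{p, a} = sup_z |f z| e^{-θ(a |z|_{-p})}` of `Exp(N_{-p}, θ, a)`. -/
def testSeminorm : SeminormFamily ℂ (TestSpace θ N) (ℕ × Ioi (0 : ℝ)) := fun i =>
  Seminorm.of (fun f => ⨆ z : NegStep N i.1,
      ‖f (negIncl N i.1 z)‖ * Real.exp (-θ ((i.2 : ℝ) * ‖z‖)))
    (by
      intro f g
      refine ciSup_le fun z => ?_
      refine le_trans ?_ (add_le_add (le_ciSup (f.bddAbove i.1 i.2.2) z)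
        (le_ciSup (g.bddAbove i.1 i.2.2) z))
      rw [← add_mul]
      exact mul_le_mul_of_nonneg_right (norm_add_le _ _) (Real.exp_pos _).le)
    (by
      intro c f
      rw [Real.mul_iSup_of_nonneg (norm_nonneg c)]
      refine iSup_congr fun z => ?_
      rw [← mul_assoc, ← norm_smul]
      rfl)

/-- The projective limit topology. -/
instance : TopologicalSpace (TestSpace θ N) := (testSeminorm θ N).moduleFilterBasis.topology

theorem testSpace_withSeminorms : WithSeminorms (testSeminorm θ N) := ⟨rfl⟩

instance : IsTopologicalAddGroup (TestSpace θ N) :=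
  (testSpace_withSeminorms θ N).topologicalAddGroup

instance : ContinuousSMul ℂ (TestSpace θ N) := (testSpace_withSeminorms θ N).continuousSMul

variable {N} in
/-- The exponential function `e_ξ(z) = exp ⟨z, ξ⟩`. -/
def expVec [h : IsGrowth θ] (ξ : N) : TestSpace θ N :=
  ⟨fun z => Complex.exp (z ξ), by
    intro p
    refine ⟨?_, fun a ha => ?_⟩
    · have : Differentiable ℂ fun z : NegStep N p => z (toStep N p ξ) :=
        (ContinuousLinearMap.apply ℂ ℂ (toStep N p ξ)).differentiable
      exact this.cexp
    · obtain ⟨C, hC⟩ := h.bddAbove ‖toStep N p ξ‖ ha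
      refine ⟨Real.exp C, ?_⟩
      rintro _ ⟨z, rfl⟩
      simp only [Complex.norm_exp]
      rw [← Real.exp_add, negIncl_apply]
      refine Real.exp_le_exp.2 (le_trans ?_ (hC ‖z‖ (norm_nonneg z)))
      have h1 := (Complex.re_le_norm _).trans (z.le_opNorm (toStep N p ξ))
      rw [mul_comm] at h1
      linarith⟩

variable {θ} in
/-- The continuous inclusion `F_φ(N') → F_θ(N')` for `φ ≤ θ`. -/
def testIncl {φ : ℝ → ℝ} (h : ∀ x, 0 ≤ x → φ x ≤ θ x) : TestSpace φ N →L[ℂ] TestSpace θ N where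
  toFun := fun f => ⟨f.1, fun p => ⟨(f.2 p).1, fun a ha => by
    obtain ⟨A, hA⟩ := (f.2 p).2 a ha
    refine ⟨A, ?_⟩
    rintro _ ⟨z, rfl⟩
    refine le_trans ?_ (hA ⟨z, rfl⟩)
    have := h (a * ‖z‖) (by positivity)
    dsimp only
    gcongr⟩⟩
  map_add' := fun _ _ => rfl
  map_smul' := fun _ _ => rfl
  cont := by
    let j : TestSpace φ N →ₗ[ℂ] TestSpace θ N :=
      { toFun := fun f => ⟨f.1, fun p => ⟨(f.2 p).1, fun a ha => by
          obtain ⟨A, hA⟩ := (f.2 p).2 a ha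
          refine ⟨A, ?_⟩
          rintro _ ⟨z, rfl⟩
          refine le_trans ?_ (hA ⟨z, rfl⟩)
          have := h (a * ‖z‖) (by positivity)
          dsimp only
          gcongr⟩⟩
        map_add' := fun _ _ => rfl
        map_smul' := fun _ _ => rfl }
    refine WithSeminorms.continuous_of_isBounded (testSpace_withSeminorms φ N)
      (testSpace_withSeminorms θ N) j fun i => ⟨{i}, 1, ?_⟩
    rw [Finset.sup_singleton, one_smul]
    intro f
    refine ciSup_mono (f.bddAbove i.1 i.2.2) fun z => ?_
    have := h ((i.2 : ℝ) * ‖z‖) (mul_nonneg (le_of_lt i.2.2) (norm_nonneg z))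
    have h2 := Real.exp_le_exp.2 (neg_le_neg this)
    exact mul_le_mul_of_nonneg_left h2 (norm_nonneg _)

end TestSpace

/-! ## Operators, symbols, convolution -/

section Operators

/-- `L(F_θ₁(N₁'), F*_θ₂(N₂'))`: continuous linear operators into the strong dual, with the topology
of bounded convergence. -/
abbrev Op (θ₁ θ₂ : ℝ → ℝ) (N₁ N₂ : Type*) [AddCommGroup N₁] [Module ℂ N₁] [UniformSpace N₁]
    [NuclearHilbertian N₁] [AddCommGroup N₂] [Module ℂ N₂] [UniformSpace N₂]
    [NuclearHilbertian N₂] : Type _ :=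
  TestSpace θ₁ N₁ →L[ℂ] StrongDual ℂ (TestSpace θ₂ N₂)

variable {θ₁ θ₂ : ℝ → ℝ} {N₁ N₂ : Type*} [AddCommGroup N₁] [Module ℂ N₁] [UniformSpace N₁]
  [NuclearHilbertian N₁] [AddCommGroup N₂] [Module ℂ N₂] [UniformSpace N₂] [NuclearHilbertian N₂]

/-- The symbol `σ(Ξ)(ξ, η) = ⟨⟨Ξ e_ξ, e_η⟩⟩`. -/
def symbol [IsGrowth θ₁] [IsGrowth θ₂] (Ξ : Op θ₁ θ₂ N₁ N₂) : N₁ → N₂ → ℂ :=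
  fun ξ η => Ξ (expVec θ₁ ξ) (expVec θ₂ η)

variable (θ₁ θ₂) in
/-- `f` is the symbol of exactly one operator in `L(F_θ₁(N₁'), F*_θ₂(N₂'))`. -/
def IsSymbol [IsGrowth θ₁] [IsGrowth θ₂] (f : N₁ → N₂ → ℂ) : Prop :=
  ∃! Ξ : Op θ₁ θ₂ N₁ N₂, symbol Ξ = f

open Classical in
variable (θ₁ θ₂) in
/-- The operator with symbol `f` (and `0` if there is none). -/
def ofSymbol [IsGrowth θ₁] [IsGrowth θ₂] (f : N₁ → N₂ → ℂ) : Op θ₁ θ₂ N₁ N₂ :=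
  if h : ∃ Ξ : Op θ₁ θ₂ N₁ N₂, symbol Ξ = f then h.choose else 0

/-- The convolution product of operators, `σ(A ∗ B) = σ(A) σ(B)`. -/
def conv [IsGrowth θ₁] [IsGrowth θ₂] (A B : Op θ₁ θ₂ N₁ N₂) : Op θ₁ θ₂ N₁ N₂ :=
  ofSymbol θ₁ θ₂ fun ξ η => symbol A ξ η * symbol B ξ η

/-- The convolution exponential `e^{∗A}`, with `σ(e^{∗A}) = e^{σ(A)}`, as an operator in
`L(F_{(e^{θ₁*})*}(N₁'), F*_{(e^{θ₂*})*}(N₂'))`. -/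
def convExp [IsGrowth θ₁] [IsGrowth θ₂] (A : Op θ₁ θ₂ N₁ N₂) :
    Op (expConj θ₁) (expConj θ₂) N₁ N₂ :=
  ofSymbol (expConj θ₁) (expConj θ₂) fun ξ η => Complex.exp (symbol A ξ η)

/-- The pointwise integral of the symbols of the family `X` over `[a, b]`. -/
def symbolIntegral [IsGrowth θ₁] [IsGrowth θ₂] (X : ℝ → Op θ₁ θ₂ N₁ N₂) (a b : ℝ) :
    N₁ → N₂ → ℂ :=
  fun ξ η => ∫ s in a..b, symbol (X s) ξ η

/-- The integral `∫ₐᵇ X(s) ds` of a family of operators, with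
`σ(∫ₐᵇ X(s) ds) = ∫ₐᵇ σ(X(s)) ds`. -/
def opIntegral [IsGrowth θ₁] [IsGrowth θ₂] (X : ℝ → Op θ₁ θ₂ N₁ N₂) (a b : ℝ) :
    Op θ₁ θ₂ N₁ N₂ :=
  ofSymbol θ₁ θ₂ (symbolIntegral X a b)

/-- The integral of `X` over `[a, b]` exists: the symbols are integrable, and their integral is the
symbol of exactly one operator. -/
def OpIntegrable [IsGrowth θ₁] [IsGrowth θ₂] (X : ℝ → Op θ₁ θ₂ N₁ N₂) (a b : ℝ) : Prop :=
  (∀ ξ η, IntervalIntegrable (fun s => symbol (X s) ξ η) MeasureTheory.volume a b) ∧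
    IsSymbol θ₁ θ₂ (symbolIntegral X a b)

/-- The inclusion of `L(F_θ₁(N₁'), F*_θ₂(N₂'))` into
`L(F_{(e^{θ₁*})*}(N₁'), F*_{(e^{θ₂*})*}(N₂'))` by restriction to the smaller test function
spaces. -/
def opIncl [h₁ : IsGrowth θ₁] [h₂ : IsGrowth θ₂] (A : Op θ₁ θ₂ N₁ N₂) :
    Op (expConj θ₁) (expConj θ₂) N₁ N₂ :=
  (ContinuousLinearMap.precomp ℂ (testIncl N₂ fun _ hx => expConj_le h₂ hx)).comp
    (A.comp (testIncl N₁ fun _ hx => expConj_le h₁ hx))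

instance : ContinuousSMul ℝ (Op θ₁ θ₂ N₁ N₂) := IsScalarTower.continuousSMul ℂ

/-- `Ξ` solves `dΞ/dt = Z(t) ∗ Ξ(t) + Θ(t)`, `Ξ(0) = Ξ₀` on the interval `I`, in
`L(F_{(e^{θ₁*})*}(N₁'), F*_{(e^{θ₂*})*}(N₂'))`; the derivative is taken in the topology of that
space (one-sided at end points of `I`). -/
structure IsSolution [IsGrowth θ₁] [IsGrowth θ₂] (I : Set ℝ) (Z Θ : ℝ → Op θ₁ θ₂ N₁ N₂)
    (Ξ₀ : Op θ₁ θ₂ N₁ N₂) (Ξ : ℝ → Op (expConj θ₁) (expConj θ₂) N₁ N₂) : Prop where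
  deriv : ∀ t ∈ I, HasDerivWithinAt Ξ (conv (opIncl (Z t)) (Ξ t) + opIncl (Θ t)) I t
  init : Ξ 0 = opIncl Ξ₀

end Operators

end QWN

end

/-!
An operator is determined by its symbol, and convolution, exponential and integral are defined by
the pointwise operations on symbols.  The initial value problem for operators is thus a family of
scalar linear initial value problems, one for every `(ξ, η)`, which the variation of constants
formula solves (`variation`).  What has to be shown is that the functions arising in this way are
symbols of operators, and that pointwise derivatives of symbols are derivatives in the topology of
bounded convergence.

Both rest on a characterization of symbols.  A function on `N₁ × N₂` is the symbol of an operator if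
and only if it is entire on complex lines in each variable (`SepEntire`) and bounded by
`C e^{θ₁*(a |ξ|_p) + θ₂*(a |η|_p)}` for some `p`, `a` and `C` (`SymBound`).

* Necessity, uniformly on compact sets of operators (`exists_symBound_of_isCompact`), is tested on
  exponentials, suitably normalized.
* Uniqueness (`op_ext`) is the totality of the exponentials (`functional_eq_zero`): for every
  `p`, nuclearity expands the vectors of `N` in a series `ξ = ∑ z_k(ξ) x_k` that is absolutely
  convergent in `N_p` (`NuclearExpansion`), and with it every test function in a series of monomials
  in the `x_k` that converges in the norms `‖·‖_{p, a}`; the monomials are derivatives of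
  exponentials.
* Sufficiency (`isSymbol_of_bound`) pairs the mixed derivatives at `0` of the given function along
  the `x_k` with the Taylor coefficients of test functions along the `z_k`.  Cauchy's estimates with
  radii that are dual with respect to `θ` and `θ*` (`exists_dual_radii`, `DualWeights`) make the
  pairing absolutely convergent.  The same domination shows that operators converge to `0` when
  their symbols converge to `0` pointwise and have a common bound (`tendsto_zero_of_symbol`).

The class of bounds is stable under products, as `2 θ*(x) ≤ θ*(2 x) - θ 0`, and the exponential
takes bounds for `θ` to bounds for `(e^{θ*})*`, as `e^{θ*(x)} ≤ ((e^{θ*})*)*(2 x) + 2`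
(`exp_conj_le`).  On a compact interval all the bounds are uniform in time, because continuous
families are compact there.  So the formula defines operators, and by the mean value inequality the
difference quotients of their symbols have a common bound; they converge pointwise, hence in the
topology of operators (`hasDerivWithinAt_solution`).  Conversely the symbols of a solution solve the
scalar equations, whose solutions are unique (`IsSolution.symbol_eq`).
-/

noncomputable section

namespace QWN

/-! ### Entire functions of bounded type -/

/-- Holomorphy of a parameter integral: it suffices that the integrand is entire in the parameter,
measurable in the variable of integration, and dominated locally uniformly in the parameter. -/
theorem differentiable_integral_of_dominated {α : Type*} [MeasurableSpace α]
    {μ : MeasureTheory.Measure α} {H : α → ℂ → ℂ}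
    (hd : ∀ᵐ s ∂μ, Differentiable ℂ (H s))
    (hm : ∀ u, MeasureTheory.AEStronglyMeasurable (fun s => H s u) μ)
    (hb : ∀ R : ℝ, ∃ g : α → ℝ, MeasureTheory.Integrable g μ ∧
      ∀ᵐ s ∂μ, ∀ u : ℂ, ‖u‖ ≤ R → ‖H s u‖ ≤ g s) :
    Differentiable ℂ fun u => ∫ s, H s u ∂μ := by
  intro u₀
  obtain ⟨g, hg, hgb⟩ := hb (‖u₀‖ + 2)
  have hlim : ∀ᵐ s ∂μ, Tendsto (fun n : ℕ => ((n : ℂ) + 1) *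
      (H s (u₀ + 1 / ((n : ℂ) + 1)) - H s u₀)) atTop (𝓝 (deriv (H s) u₀)) := by
    filter_upwards [hd] with s hs
    have h1 := hasDerivAt_iff_tendsto_slope_zero.1 (hs u₀).hasDerivAt
    have h2 : Tendsto (fun n : ℕ => 1 / ((n : ℂ) + 1)) atTop (𝓝[≠] 0) := by
      refine tendsto_nhdsWithin_iff.2 ⟨tendsto_one_div_add_atTop_nhds_zero_nat, ?_⟩
      exact Eventually.of_forall fun n => one_div_ne_zero (Nat.cast_add_one_ne_zero n)
    refine (h1.comp h2).congr fun n => ?_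
    simp
  have hmeas : MeasureTheory.AEStronglyMeasurable (fun s => deriv (H s) u₀) μ := by
    refine aestronglyMeasurable_of_tendsto_ae atTop (fun n => ?_) hlim
    exact ((hm _).sub (hm _)).const_mul _
  have hint : MeasureTheory.Integrable (fun s => H s u₀) μ := by
    refine hg.mono' (hm u₀) ?_
    filter_upwards [hgb] with s hs using hs u₀ (by linarith)
  have key := hasDerivAt_integral_of_dominated_loc_of_deriv_le (μ := μ) (𝕜 := ℂ)
    (F := fun u s => H s u) (F' := fun u s => deriv (H s) u) (x₀ := u₀) (bound := g)
    (Metric.ball_mem_nhds u₀ one_pos) (Eventually.of_forall hm) hint hmeas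
    (by
      filter_upwards [hgb, hd] with s hs hds x hx
      have := Complex.norm_deriv_le_of_forall_mem_sphere_norm_le (c := x) (C := g s) one_pos
        hds.diffContOnCl fun z hz => hs z (by
          have h1 : ‖z - x‖ = 1 := by simpa using hz
          have h2 : ‖x - u₀‖ < 1 := by simpa [dist_eq_norm] using hx
          have h3 : z = (z - x) + (x - u₀) + u₀ := by ring
          have h4 := norm_add₃_le (a := z - x) (b := x - u₀) (c := u₀)
          rw [← h3] at h4
          linarith)
      simpa using this)
    hg (by filter_upwards [hd] with s hds x _ using (hds x).hasDerivAt)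
  exact key.2.differentiableAt

theorem norm_le_of_norm_sub_le {E : Type*} [SeminormedAddCommGroup E] {x u : E} {δ R : ℝ}
    (h : ‖x - u‖ ≤ δ) (hu : ‖u‖ ≤ R) : ‖x‖ ≤ R + δ := by
  have := norm_add_le (x - u) u
  rw [sub_add_cancel] at this
  linarith

section BddEntire

variable {E : Type*} [NormedAddCommGroup E] [NormedSpace ℂ E]

/-- Entire functions of bounded type on a complex normed space: holomorphic on every complex line
and bounded on bounded sets.  The space need not be complete, and neither Fréchet
differentiability nor continuity is demanded (both follow). -/
structure BddEntire (G : E → ℂ) : Prop where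
  line : ∀ u v, Differentiable ℂ fun w : ℂ => G (u + w • v)
  bdd : ∀ R : ℝ, ∃ M, ∀ v, ‖v‖ ≤ R → ‖G v‖ ≤ M

/-- The directional derivative `∂_y G`. -/
def dirDeriv (y : E) (G : E → ℂ) (v : E) : ℂ := deriv (fun w : ℂ => G (v + w • y)) 0

/-- The iterated directional derivative along the members of a list. -/
def iterDeriv : List E → (E → ℂ) → E → ℂ
  | [], G => G
  | y :: l, G => iterDeriv l (dirDeriv y G)

theorem BddEntire.hasDerivAt {G : E → ℂ} (hG : BddEntire G) (u v : E) (a : ℂ) :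
    HasDerivAt (fun w : ℂ => G (u + w • v)) (dirDeriv v G (u + a • v)) a := by
  have h1 := (hG.line (u + a • v) v 0).hasDerivAt
  have h2 : HasDerivAt (fun w : ℂ => w - a) 1 a := (hasDerivAt_id a).sub_const a
  have h3 := HasDerivAt.comp_of_eq a h1 h2 (sub_self a).symm
  rw [mul_one] at h3
  convert! h3 using 1
  funext w
  simp only [Function.comp]
  congr 1
  rw [sub_smul]; abel

/-- Cauchy's estimate. -/
theorem BddEntire.norm_dirDeriv_le {G : E → ℂ} (hG : BddEntire G) {u : E} {δ M : ℝ} (hδ : 0 < δ)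
    (hM : ∀ v, ‖v - u‖ ≤ δ → ‖G v‖ ≤ M) (y : E) : ‖dirDeriv y G u‖ ≤ M * (‖y‖ / δ) := by
  rcases eq_or_ne y 0 with rfl | hy
  · simp [dirDeriv]
  have hy' : 0 < ‖y‖ := norm_pos_iff.2 hy
  have := Complex.norm_deriv_le_of_forall_mem_sphere_norm_le (c := 0) (C := M) (R := δ / ‖y‖)
    (by positivity) (hG.line u y).diffContOnCl fun z hz => hM _ (by
      have h1 : ‖z‖ = δ / ‖y‖ := by simpa using hz
      rw [add_sub_cancel_left, norm_smul, h1, div_mul_cancel₀ _ hy'.ne'])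
  refine this.trans (le_of_eq ?_)
  rw [div_div_eq_mul_div, mul_div_assoc]

/-- Cauchy's formula on the unit circle, with the circle integral written as an interval integral,
so that it can be differentiated and passed to the limit under the integral sign. -/
theorem dirDeriv_eq_integral {G : E → ℂ} (hG : BddEntire G) (y v : E) :
    dirDeriv y G v = (2 * Real.pi * Complex.I : ℂ)⁻¹ *
      ∫ t in (0 : ℝ)..2 * Real.pi, deriv (circleMap 0 1) t *
        ((1 / circleMap 0 1 t ^ 2) * G (v + circleMap 0 1 t • y)) := by
  have h := DifferentiableOn.deriv_eq_smul_circleIntegral (c := (0 : ℂ)) one_pos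
    (hG.line v y).differentiableOn
  rw [circleIntegral] at h
  simp only [sub_zero, smul_eq_mul] at h
  rw [h, dirDeriv, inv_mul_cancel_left₀]
  simp [Real.pi_ne_zero]

theorem norm_add_circleMap_smul_le (v y : E) (t : ℝ) :
    ‖v + circleMap 0 1 t • y‖ ≤ ‖v‖ + ‖y‖ := by
  refine (norm_add_le _ _).trans ?_
  simp [norm_smul]

theorem measurable_circle_integrand {G : E → ℂ} (hG : BddEntire G) (y v : E)
    (μ : MeasureTheory.Measure ℝ) :
    MeasureTheory.AEStronglyMeasurable (fun t => deriv (circleMap 0 1) t *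
      ((1 / circleMap 0 1 t ^ 2) * G (v + circleMap 0 1 t • y))) μ := by
  refine Continuous.aestronglyMeasurable ?_
  have h1 : Continuous fun t => G (v + circleMap 0 1 t • y) :=
    (hG.line v y).continuous.comp (continuous_circleMap 0 1)
  have h2 : ∀ t, circleMap 0 1 t ^ 2 ≠ 0 := fun t =>
    pow_ne_zero _ (circleMap_ne_center one_ne_zero)
  have h3 : Continuous (deriv (circleMap 0 1)) := by
    rw [show deriv (circleMap 0 1) = fun t => circleMap 0 1 t * Complex.I from
      funext fun t => deriv_circleMap 0 1 t]
    exact (continuous_circleMap 0 1).mul continuous_const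
  exact h3.mul ((continuous_const.div ((continuous_circleMap 0 1).pow 2) h2).mul h1)

theorem norm_circle_integrand_le {G : E → ℂ} (y v : E) (t : ℝ) :
    ‖deriv (circleMap 0 1) t * ((1 / circleMap 0 1 t ^ 2) * G (v + circleMap 0 1 t • y))‖ ≤
      ‖G (v + circleMap 0 1 t • y)‖ := by
  simp

/-- The directional derivative of a function that depends holomorphically on a parameter depends
holomorphically on it, as it is a Cauchy integral. -/
theorem differentiable_dirDeriv_param {G : ℂ → E → ℂ} (hG : ∀ u, BddEntire (G u))
    (hd : ∀ v, Differentiable ℂ fun u => G u v)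
    (hb : ∀ R : ℝ, ∃ M, ∀ u : ℂ, ‖u‖ ≤ R → ∀ v, ‖v‖ ≤ R → ‖G u v‖ ≤ M) (y v : E) :
    Differentiable ℂ fun u => dirDeriv y (G u) v := by
  simp_rw [fun u => dirDeriv_eq_integral (hG u) y v]
  refine Differentiable.const_mul ?_ _
  simp_rw [intervalIntegral.integral_of_le Real.two_pi_pos.le]
  refine differentiable_integral_of_dominated (Eventually.of_forall fun s => ?_)
    (fun u => measurable_circle_integrand (hG u) y v _) fun R => ?_
  · exact ((hd _).const_mul _).const_mul _
  · obtain ⟨M, hM⟩ := hb (max R (‖v‖ + ‖y‖))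
    refine ⟨fun _ => M, MeasureTheory.integrable_const _, Eventually.of_forall fun s u hu => ?_⟩
    exact (norm_circle_integrand_le y v s).trans
      (hM u (hu.trans (le_max_left _ _)) _
        ((norm_add_circleMap_smul_le v y s).trans (le_max_right _ _)))

theorem BddEntire.dirDeriv {G : E → ℂ} (hG : BddEntire G) (y : E) :
    BddEntire (dirDeriv y G) where
  line := by
    intro u v
    have hc : ∀ c : E, BddEntire fun x => G (x + c) := fun c =>
      ⟨fun u v => by simpa [add_right_comm] using hG.line (u + c) v, fun R => by
        obtain ⟨M, hM⟩ := hG.bdd (R + ‖c‖)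
        exact ⟨M, fun v hv => hM _ ((norm_add_le _ _).trans (by gcongr))⟩⟩
    have := differentiable_dirDeriv_param (G := fun w x => G (x + w • v)) (fun w => hc _)
      (fun x => hG.line x v) (fun R => by
        obtain ⟨M, hM⟩ := hG.bdd (R + R * ‖v‖)
        refine ⟨M, fun w hw x hx => hM _ ((norm_add_le _ _).trans ?_)⟩
        rw [norm_smul]
        gcongr) y u
    convert! this using 1
    funext w
    simp only [QWN.dirDeriv, add_right_comm]
  bdd := by
    intro R
    obtain ⟨M, hM⟩ := hG.bdd (R + 1)
    refine ⟨M * (‖y‖ / 1), fun v hv => hG.norm_dirDeriv_le one_pos (fun x hx => hM x ?_) y⟩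
    exact norm_le_of_norm_sub_le hx hv

/-- Cauchy's estimate makes `G` locally Lipschitz. -/
theorem BddEntire.continuous {G : E → ℂ} (hG : BddEntire G) : Continuous G := by
  rw [continuous_iff_continuousAt]
  intro v
  obtain ⟨M, hM⟩ := hG.bdd (‖v‖ + 2)
  have hM0 : 0 ≤ M := (norm_nonneg _).trans (hM v (by linarith))
  have hlip : ∀ᶠ x in 𝓝 v, ‖G x - G v‖ ≤ M * ‖x - v‖ := by
    filter_upwards [Metric.closedBall_mem_nhds v one_pos] with x hx
    have hx1 : ‖x - v‖ ≤ 1 := by simpa [dist_eq_norm] using hx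
    have h1 := (convex_closedBall (0 : ℂ) 1).norm_image_sub_le_of_norm_hasDerivWithin_le
      (f := fun w : ℂ => G (v + w • (x - v))) (C := M * (‖x - v‖ / 1))
      (fun a _ => (hG.hasDerivAt v (x - v) a).hasDerivWithinAt) (fun a ha => by
        refine hG.norm_dirDeriv_le one_pos (fun z hz => hM z ?_) _
        have ha1 : ‖a‖ ≤ 1 := by simpa using ha
        have h3 : z = (z - (v + a • (x - v))) + v + a • (x - v) := by abel
        rw [h3]
        refine (norm_add₃_le).trans ?_
        rw [norm_smul]
        have : ‖a‖ * ‖x - v‖ ≤ 1 := mul_le_one₀ ha1 (norm_nonneg _) hx1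
        linarith) (x := 0) (y := 1) (by simp) (by simp)
    simpa using h1
  refine tendsto_iff_norm_sub_tendsto_zero.2 ?_
  refine squeeze_zero' (Eventually.of_forall fun _ => norm_nonneg _) hlip ?_
  have h1 : Tendsto (fun x => M * ‖x - v‖) (𝓝 v) (𝓝 (M * ‖v - v‖)) :=
    (Continuous.tendsto (by fun_prop) v)
  simpa using h1

theorem BddEntire.dirDeriv_smul {G : E → ℂ} (hG : BddEntire G) (c : ℂ) (y v : E) :
    QWN.dirDeriv (c • y) G v = c * QWN.dirDeriv y G v := by
  have h1 := hG.hasDerivAt v y (c * 0)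
  have h2 : HasDerivAt (fun w : ℂ => c * w) c 0 := by
    simpa using (hasDerivAt_id (0 : ℂ)).const_mul c
  have h3 := HasDerivAt.comp (0 : ℂ) h1 h2
  have h4 : (fun w : ℂ => G (v + w • c • y)) = (fun w => G (v + w • y)) ∘ fun w => c * w := by
    funext w; simp [smul_smul, mul_comm]
  rw [QWN.dirDeriv, h4, h3.deriv]
  simp [mul_comm]

/-- The directional derivative is additive in the direction.  As holomorphy is only required on
single lines, this rests on the continuity of `∂_y G`. -/
theorem BddEntire.dirDeriv_add {G : E → ℂ} (hG : BddEntire G) (y y' v : E) :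
    QWN.dirDeriv (y + y') G v = QWN.dirDeriv y G v + QWN.dirDeriv y' G v := by
  have hB : HasDerivAt (fun t : ℂ => G (v + t • y')) (QWN.dirDeriv y' G v) 0 := by
    simpa using hG.hasDerivAt v y' 0
  have hA : HasDerivAt (fun t : ℂ => G (v + t • y' + t • y) - G (v + t • y'))
      (QWN.dirDeriv y G v) 0 := by
    rw [hasDerivAt_iff_isLittleO]
    rw [Asymptotics.isLittleO_iff]
    intro ε hε
    obtain ⟨δ, hδ, hδε⟩ := Metric.continuousAt_iff.1 (hG.dirDeriv y).continuous.continuousAt ε hε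
    have hT : ∀ᶠ t : ℂ in 𝓝 0, ‖t‖ * (‖y'‖ + ‖y‖) < δ := by
      refine (Continuous.tendsto (by fun_prop : Continuous fun t : ℂ => ‖t‖ * (‖y'‖ + ‖y‖))
        0).eventually_lt_const ?_
      simpa using hδ
    filter_upwards [hT] with t ht
    have h1 := (convex_closedBall (0 : ℂ) ‖t‖).norm_image_sub_le_of_norm_hasDerivWithin_le
      (f := fun s : ℂ => G (v + t • y' + s • y) - s * QWN.dirDeriv y G v) (C := ε)
      (fun a _ => ((hG.hasDerivAt (v + t • y') y a).sub
        ((hasDerivAt_id a).mul_const _)).hasDerivWithinAt) (fun a ha => by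
        have ha1 : ‖a‖ ≤ ‖t‖ := by simpa using ha
        rw [one_mul, ← dist_eq_norm]
        refine (hδε ?_).le
        rw [dist_eq_norm]
        have h3 : v + t • y' + a • y - v = t • y' + a • y := by abel
        rw [h3]
        refine lt_of_le_of_lt ((norm_add_le _ _).trans ?_) ht
        rw [norm_smul, norm_smul, mul_add]
        gcongr) (x := 0) (y := t) (by simp) (by simp)
    simp only [zero_smul, add_zero, zero_mul, sub_zero, sub_self, smul_eq_mul] at h1 ⊢
    refine le_trans (le_of_eq ?_) h1
    congr 1
    ring
  have h := hA.add hB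
  have h2 : (fun t : ℂ => G (v + t • (y + y'))) =
      (fun t : ℂ => G (v + t • y' + t • y) - G (v + t • y')) + fun t : ℂ => G (v + t • y') := by
    funext t
    simp only [Pi.add_apply, sub_add_cancel, smul_add]
    congr 1; abel
  rw [QWN.dirDeriv, h2, h.deriv]

/-- Directional derivatives pass to limits that are pointwise and bounded on bounded sets. -/
theorem tendsto_dirDeriv {ι : Type*} {l : Filter ι} [l.IsCountablyGenerated] {G : ι → E → ℂ}
    {G' : E → ℂ} (hG : ∀ᶠ i in l, BddEntire (G i)) (hG' : BddEntire G')
    (hb : ∀ R : ℝ, ∃ M, ∀ᶠ i in l, ∀ v, ‖v‖ ≤ R → ‖G i v‖ ≤ M)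
    (hlim : ∀ v, Tendsto (fun i => G i v) l (𝓝 (G' v))) (y v : E) :
    Tendsto (fun i => dirDeriv y (G i) v) l (𝓝 (dirDeriv y G' v)) := by
  rw [dirDeriv_eq_integral hG' y v]
  refine Tendsto.congr' (hG.mono fun i hi => (dirDeriv_eq_integral hi y v).symm)
    (Tendsto.const_mul _ ?_)
  obtain ⟨M, hM⟩ := hb (‖v‖ + ‖y‖)
  refine intervalIntegral.tendsto_integral_filter_of_dominated_convergence (fun _ => M)
    (hG.mono fun i hi => measurable_circle_integrand hi y v _) ?_
    intervalIntegrable_const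
    (Eventually.of_forall fun t _ => ((hlim _).const_mul _).const_mul _)
  filter_upwards [hM] with i hi
  exact Eventually.of_forall fun t _ => (norm_circle_integrand_le y v t).trans
    (hi _ (norm_add_circleMap_smul_le v y t))

theorem tendsto_iterDeriv {ι : Type*} {l : Filter ι} [l.IsCountablyGenerated] {G : ι → E → ℂ}
    {G' : E → ℂ} (hG : ∀ᶠ i in l, BddEntire (G i)) (hG' : BddEntire G')
    (hb : ∀ R : ℝ, ∃ M, ∀ᶠ i in l, ∀ v, ‖v‖ ≤ R → ‖G i v‖ ≤ M)
    (hlim : ∀ v, Tendsto (fun i => G i v) l (𝓝 (G' v))) (L : List E) (v : E) :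
    Tendsto (fun i => iterDeriv L (G i) v) l (𝓝 (iterDeriv L G' v)) := by
  induction L generalizing G G' with
  | nil => exact hlim v
  | cons y L ih =>
    refine ih (hG.mono fun i hi => hi.dirDeriv y) (hG'.dirDeriv y) (fun R => ?_)
      fun v => tendsto_dirDeriv hG hG' hb hlim y v
    obtain ⟨M, hM⟩ := hb (R + 1)
    refine ⟨M * (‖y‖ / 1), ?_⟩
    filter_upwards [hM, hG] with i hi hGi v hv
    exact hGi.norm_dirDeriv_le one_pos (fun x hx => hi x (norm_le_of_norm_sub_le hx hv)) y

/-- Iterated directional derivatives of a function that depends holomorphically on a parameter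
depend holomorphically on it. -/
theorem differentiable_iterDeriv_param {G : ℂ → E → ℂ} (hG : ∀ u, BddEntire (G u))
    (hd : ∀ v, Differentiable ℂ fun u => G u v)
    (hb : ∀ R : ℝ, ∃ M, ∀ u : ℂ, ‖u‖ ≤ R → ∀ v, ‖v‖ ≤ R → ‖G u v‖ ≤ M) (L : List E) (v : E) :
    Differentiable ℂ fun u => iterDeriv L (G u) v := by
  induction L generalizing G with
  | nil => exact hd v
  | cons y L ih =>
    refine ih (fun u => (hG u).dirDeriv y) (fun v => differentiable_dirDeriv_param hG hd hb y v)
      fun R => ?_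
    obtain ⟨M, hM⟩ := hb (R + 1)
    refine ⟨M * (‖y‖ / 1), fun u hu v hv => ?_⟩
    exact (hG u).norm_dirDeriv_le one_pos
      (fun x hx => hM u (by linarith) x (norm_le_of_norm_sub_le hx hv)) y

/-- Iterated Cauchy estimate: each derivative costs `δ` in the radius. -/
theorem BddEntire.norm_iterDeriv_le {G : E → ℂ} (hG : BddEntire G) {u : E} {δ M : ℝ} (hδ : 0 < δ)
    (l : List E) (hM : ∀ v, ‖v - u‖ ≤ l.length * δ → ‖G v‖ ≤ M) :
    ‖QWN.iterDeriv l G u‖ ≤ M * (l.map fun y => ‖y‖ / δ).prod := by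
  induction l generalizing G M with
  | nil => simpa [QWN.iterDeriv] using hM u (by simp)
  | cons y l ih =>
    refine (ih (hG.dirDeriv y) (M := M * (‖y‖ / δ)) fun v hv =>
      hG.norm_dirDeriv_le hδ (fun x hx => hM x ?_) y).trans (le_of_eq ?_)
    · have := norm_add_le (x - v) (v - u)
      rw [sub_add_sub_cancel] at this
      simp only [List.length_cons, Nat.cast_add, Nat.cast_one]
      linarith
    · simp [mul_assoc]

theorem dirDeriv_add_fun {G H : E → ℂ} (hG : BddEntire G) (hH : BddEntire H) (y : E) :
    dirDeriv y (fun v => G v + H v) = fun v => dirDeriv y G v + dirDeriv y H v := by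
  funext v
  exact deriv_fun_add (hG.line v y 0) (hH.line v y 0)

theorem dirDeriv_const_mul {G : E → ℂ} (hG : BddEntire G) (c : ℂ) (y : E) :
    dirDeriv y (fun v => c * G v) = fun v => c * dirDeriv y G v := by
  funext v
  exact deriv_const_mul c (hG.line v y 0)

theorem BddEntire.add {G H : E → ℂ} (hG : BddEntire G) (hH : BddEntire H) :
    BddEntire fun v => G v + H v where
  line u v := (hG.line u v).add (hH.line u v)
  bdd R := by
    obtain ⟨A, hA⟩ := hG.bdd R
    obtain ⟨B, hB⟩ := hH.bdd R
    exact ⟨A + B, fun v hv => (norm_add_le _ _).trans (add_le_add (hA v hv) (hB v hv))⟩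

theorem BddEntire.const_mul {G : E → ℂ} (hG : BddEntire G) (c : ℂ) :
    BddEntire fun v => c * G v where
  line u v := (hG.line u v).const_mul c
  bdd R := by
    obtain ⟨A, hA⟩ := hG.bdd R
    refine ⟨‖c‖ * A, fun v hv => ?_⟩
    rw [norm_mul]
    exact mul_le_mul_of_nonneg_left (hA v hv) (norm_nonneg c)

theorem bddEntire_const (c : ℂ) : BddEntire fun _ : E => c where
  line _ _ := differentiable_const c
  bdd _ := ⟨‖c‖, fun _ _ => le_rfl⟩

theorem iterDeriv_add_fun {G H : E → ℂ} (hG : BddEntire G) (hH : BddEntire H) (l : List E) :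
    iterDeriv l (fun v => G v + H v) = fun v => iterDeriv l G v + iterDeriv l H v := by
  induction l generalizing G H with
  | nil => rfl
  | cons y l ih =>
    rw [iterDeriv, dirDeriv_add_fun hG hH, ih (hG.dirDeriv y) (hH.dirDeriv y)]; rfl

theorem iterDeriv_const_mul {G : E → ℂ} (hG : BddEntire G) (c : ℂ) (l : List E) :
    iterDeriv l (fun v => c * G v) = fun v => c * iterDeriv l G v := by
  induction l generalizing G with
  | nil => rfl
  | cons y l ih =>
    rw [iterDeriv, dirDeriv_const_mul hG, ih (hG.dirDeriv y)]; rfl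

theorem iterDeriv_zero (l : List E) : iterDeriv l (fun _ => 0) = fun _ => 0 := by
  have := iterDeriv_const_mul (bddEntire_const (E := E) 0) 0 l
  simpa using this

theorem BddEntire.sum {ι : Type*} {G : ι → E → ℂ} (hG : ∀ i, BddEntire (G i)) (s : Finset ι) :
    BddEntire fun v => ∑ i ∈ s, G i v := by
  classical
  induction s using Finset.induction_on with
  | empty => simpa using bddEntire_const 0
  | insert a s ha ih => simpa [Finset.sum_insert ha] using (hG a).add ih

theorem iterDeriv_sum {ι : Type*} {G : ι → E → ℂ} (hG : ∀ i, BddEntire (G i)) (s : Finset ι)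
    (l : List E) :
    iterDeriv l (fun v => ∑ i ∈ s, G i v) = fun v => ∑ i ∈ s, iterDeriv l (G i) v := by
  classical
  induction s using Finset.induction_on with
  | empty => simpa using iterDeriv_zero l
  | insert a s ha ih =>
    simp_rw [Finset.sum_insert ha]
    rw [iterDeriv_add_fun (hG a) (BddEntire.sum hG s), ih]

end BddEntire

/-! ### Taylor expansion along a series of vectors -/

/-- Finite words in the alphabet `ℕ`, which index the terms of the Taylor expansion. -/
abbrev Word : Type := Σ n : ℕ, Fin n → ℕ

theorem hasSum_prod_pow {τ : ℕ → ℝ} {T : ℝ} (h0 : ∀ k, 0 ≤ τ k) (hT : HasSum τ T) (n : ℕ) :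
    HasSum (fun j : Fin n → ℕ => ∏ i, τ (j i)) (T ^ n) := by
  induction n with
  | zero => simp
  | succ n ih =>
    have hs : Summable fun p : ℕ × (Fin n → ℕ) => τ p.1 * ∏ i, τ (p.2 i) :=
      hT.summable.mul_of_nonneg (g := fun j : Fin n → ℕ => ∏ i, τ (j i)) ih.summable h0
        fun j => Finset.prod_nonneg fun i _ => h0 (j i)
    have h := hT.mul ih hs
    rw [← (Fin.consEquiv fun _ => ℕ).hasSum_iff, pow_succ']
    refine h.congr_fun ?_
    rintro ⟨k, j⟩
    simp [Fin.prod_univ_succ, Fin.consEquiv]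

theorem summable_word {τ : ℕ → ℝ} {T q : ℝ} (h0 : ∀ k, 0 ≤ τ k) (hT : HasSum τ T) (hq : 0 ≤ q)
    (hqT : q * T < 1) : Summable fun w : Word => q ^ w.1 * ∏ i, τ (w.2 i) := by
  have hT0 : 0 ≤ T := hT.nonneg h0
  rw [summable_sigma_of_nonneg fun w =>
    mul_nonneg (pow_nonneg hq _) (Finset.prod_nonneg fun i _ => h0 _)]
  have h : ∀ n : ℕ, HasSum (fun j : Fin n → ℕ => q ^ n * ∏ i, τ (j i)) ((q * T) ^ n) := fun n => by
    rw [mul_pow]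
    exact (hasSum_prod_pow h0 hT n).mul_left _
  refine ⟨fun n => (h n).summable, ?_⟩
  simp_rw [fun n => (h n).tsum_eq]
  exact summable_geometric_of_lt_one (by positivity) hqT

theorem prod_map_ofFn_div {E : Type*} [NormedAddCommGroup E] (y : ℕ → E) (δ : ℝ) {n : ℕ}
    (j : Fin n → ℕ) :
    ((List.ofFn fun i => y (j i)).map fun y => ‖y‖ / δ).prod = (∏ i, ‖y (j i)‖) / δ ^ n := by
  rw [List.map_ofFn, List.prod_ofFn]
  simp [Function.comp, Finset.prod_div_distrib]

section Taylor

variable {E : Type*} [NormedAddCommGroup E] [NormedSpace ℂ E]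

/-- Cauchy's estimate for the mixed derivatives at `0`, in terms of a bound on the ball of
radius `ρ`: each of the `n` derivatives is taken with radius `ρ / (n + 1)`. -/
theorem BddEntire.norm_iterDeriv_zero_le {G : E → ℂ} (hG : BddEntire G) {ρ M : ℝ} (hρ : 0 < ρ)
    (hM : ∀ v, ‖v‖ ≤ ρ → ‖G v‖ ≤ M) (y : ℕ → E) {n : ℕ} (j : Fin n → ℕ) :
    ‖QWN.iterDeriv (List.ofFn fun i => y (j i)) G 0‖ ≤
      M * ((n + 1 : ℝ) ^ n / ρ ^ n * ∏ i, ‖y (j i)‖) := by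
  have hδ : 0 < ρ / (n + 1) := by positivity
  refine (hG.norm_iterDeriv_le hδ _ fun v hv => hM v ?_).trans (le_of_eq ?_)
  · rw [sub_zero, List.length_ofFn] at hv
    refine hv.trans ?_
    rw [mul_div_assoc', div_le_iff₀ (by positivity)]
    nlinarith
  · rw [prod_map_ofFn_div, div_pow]
    field_simp

theorem succ_pow_div_factorial_le (n : ℕ) : (n + 1 : ℝ) ^ n / n.factorial ≤ Real.exp (n + 1) :=
  Real.pow_div_factorial_le_exp _ (by positivity) n

/-- The Taylor coefficients of an entire function along words of vectors `y`. -/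
def taylorCoeff (y : ℕ → E) (w : Word) (G : E → ℂ) : ℂ :=
  ((w.1.factorial : ℝ) : ℂ)⁻¹ * iterDeriv (List.ofFn fun i => y (w.2 i)) G 0

theorem BddEntire.norm_taylorCoeff_le {G : E → ℂ} (hG : BddEntire G) {ρ M : ℝ} (hρ : 0 < ρ)
    (hM : ∀ v, ‖v‖ ≤ ρ → ‖G v‖ ≤ M) (y : ℕ → E) (w : Word) :
    ‖taylorCoeff y w G‖ ≤
      M * (Real.exp (w.1 + 1) / ρ ^ w.1 * ∏ i, ‖y (w.2 i)‖) := by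
  have hM0 : 0 ≤ M := (norm_nonneg _).trans (hM 0 (by simpa using hρ.le))
  have h := hG.norm_iterDeriv_zero_le hρ hM y w.2
  rw [taylorCoeff, norm_mul, norm_inv, Complex.norm_real, Real.norm_natCast]
  refine (mul_le_mul_of_nonneg_left h (by positivity)).trans ?_
  have h2 := succ_pow_div_factorial_le w.1
  have hp : 0 ≤ ∏ i, ‖y (w.2 i)‖ := Finset.prod_nonneg fun i _ => norm_nonneg _
  calc _ = M * (((w.1 + 1 : ℝ) ^ w.1 / w.1.factorial) / ρ ^ w.1 * ∏ i, ‖y (w.2 i)‖) := by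
        field_simp
    _ ≤ _ := by gcongr

/-- The derivative along a convergent series is the series of the derivatives. -/
theorem BddEntire.hasSum_dirDeriv {G : E → ℂ} (hG : BddEntire G) {c : ℕ → ℂ} {y : ℕ → E} {v : E}
    (hv : HasSum (fun k => c k • y k) v) (hs : Summable fun k => ‖c k‖ * ‖y k‖) (L : List E)
    (u : E) :
    HasSum (fun k => c k * QWN.iterDeriv L (QWN.dirDeriv (y k) G) u)
      (QWN.iterDeriv L (QWN.dirDeriv v G) u) := by
  let A : E → E →ₗ[ℂ] ℂ := fun u =>
    { toFun := fun y => QWN.dirDeriv y G u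
      map_add' := fun y y' => hG.dirDeriv_add y y' u
      map_smul' := fun c y => hG.dirDeriv_smul c y u }
  have hA : ∀ u, Continuous (A u) := fun u => by
    obtain ⟨M, hM⟩ := hG.bdd (‖u‖ + 1)
    refine AddMonoidHomClass.continuous_of_bound (A u) M fun y => ?_
    rw [← div_one ‖y‖]
    exact hG.norm_dirDeriv_le one_pos (fun x hx => hM x (norm_le_of_norm_sub_le hx le_rfl)) y
  have h1 : ∀ k, BddEntire fun u => c k * QWN.dirDeriv (y k) G u := fun k =>
    (hG.dirDeriv (y k)).const_mul (c k)
  have key := tendsto_iterDeriv (l := (atTop : Filter (Finset ℕ)))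
    (G := fun s u => ∑ k ∈ s, c k * QWN.dirDeriv (y k) G u) (G' := QWN.dirDeriv v G)
    (Eventually.of_forall fun s => BddEntire.sum h1 s) (hG.dirDeriv v) (fun R => by
      obtain ⟨M, hM⟩ := hG.bdd (R + 1)
      refine ⟨|M| * ∑' k, ‖c k‖ * ‖y k‖, Eventually.of_forall fun s u hu => ?_⟩
      refine (norm_sum_le _ _).trans ?_
      refine (Finset.sum_le_sum fun k _ => ?_).trans
        ((Finset.mul_sum s (fun k => ‖c k‖ * ‖y k‖) |M|).symm.le.trans
        (mul_le_mul_of_nonneg_left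
          (hs.sum_le_tsum s fun k _ => by positivity) (abs_nonneg M)))
      rw [norm_mul, mul_left_comm]
      refine mul_le_mul_of_nonneg_left ?_ (norm_nonneg _)
      have := hG.norm_dirDeriv_le (u := u) one_pos (M := |M|)
        (fun x hx => (hM x (norm_le_of_norm_sub_le hx hu)).trans (le_abs_self M)) (y k)
      simpa using this)
    (fun u => by
      have h2 := (hv.mapL (⟨A u, hA u⟩ : E →L[ℂ] ℂ))
      have h3 : HasSum (fun k => c k * QWN.dirDeriv (y k) G u) (QWN.dirDeriv v G u) := by
        refine h2.congr_fun fun k => ?_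
        exact (hG.dirDeriv_smul (c k) (y k) u).symm
      exact h3) L u
  refine key.congr fun s => ?_
  rw [iterDeriv_sum h1 s L]
  exact Finset.sum_congr rfl fun k _ => by rw [iterDeriv_const_mul (hG.dirDeriv (y k))]

/-- Multilinear expansion of the `n`-th derivative along a series. -/
theorem BddEntire.hasSum_iterDeriv {G : E → ℂ} (hG : BddEntire G) {c : ℕ → ℂ} {y : ℕ → E} {v : E}
    (hv : HasSum (fun k => c k • y k) v) (hs : Summable fun k => ‖c k‖ * ‖y k‖) (n : ℕ) (u : E) :
    HasSum (fun j : Fin n → ℕ =>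
        (∏ i, c (j i)) * QWN.iterDeriv (List.ofFn fun i => y (j i)) G u)
      (QWN.iterDeriv (List.replicate n v) G u) := by
  induction n generalizing G with
  | zero =>
    simp [QWN.iterDeriv]
  | succ n ih =>
    have h0 : ∀ k, 0 ≤ ‖c k‖ * ‖y k‖ := fun k => by positivity
    set f : ℕ × (Fin n → ℕ) → ℂ := fun p =>
      c p.1 * ((∏ i, c (p.2 i)) *
        QWN.iterDeriv (List.ofFn fun i => y (p.2 i)) (QWN.dirDeriv (y p.1) G) u) with hf
    have hsum : Summable f := by
      obtain ⟨M, hM⟩ := hG.bdd (‖u‖ + (n + 1))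
      have hT := (hs.mul_of_nonneg (g := fun j : Fin n → ℕ => ∏ i, (‖c (j i)‖ * ‖y (j i)‖))
        (hasSum_prod_pow h0 hs.hasSum n).summable h0
        fun j => Finset.prod_nonneg fun i _ => h0 (j i)).mul_left M
      refine Summable.of_norm_bounded hT ?_
      rintro ⟨k, j⟩
      have := hG.norm_iterDeriv_le (u := u) one_pos (y k :: List.ofFn fun i => y (j i))
        (M := M) fun x hx => hM x (norm_le_of_norm_sub_le (by simpa using hx) le_rfl)
      rw [List.map_cons, List.prod_cons, prod_map_ofFn_div, div_one, one_pow, div_one] at this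
      rw [hf]
      simp only [norm_mul, norm_prod]
      refine (mul_le_mul_of_nonneg_left (mul_le_mul_of_nonneg_left this
        (Finset.prod_nonneg fun i _ => norm_nonneg _)) (norm_nonneg _)).trans (le_of_eq ?_)
      rw [Finset.prod_mul_distrib]
      ring
    have h1 := hsum.hasSum.prod_fiberwise fun k => (ih (hG.dirDeriv (y k))).mul_left (c k)
    have h2 := hG.hasSum_dirDeriv hv hs (List.replicate n v) u
    have h3 := hsum.hasSum
    rw [h1.unique h2] at h3
    rw [← (Fin.consEquiv fun _ => ℕ).hasSum_iff]
    refine h3.congr_fun ?_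
    rintro ⟨k, j⟩
    simp [Fin.prod_univ_succ, Fin.consEquiv, hf, List.ofFn_succ, QWN.iterDeriv, mul_assoc]

theorem BddEntire.iteratedDeriv_line {G : E → ℂ} (hG : BddEntire G) (n : ℕ) (u v : E) :
    iteratedDeriv n (fun w : ℂ => G (u + w • v)) 0 =
      QWN.iterDeriv (List.replicate n v) G u := by
  induction n generalizing G with
  | zero => simp [QWN.iterDeriv]
  | succ n ih =>
    rw [iteratedDeriv_succ', List.replicate_succ, QWN.iterDeriv, ← ih (hG.dirDeriv v)]
    congr 1
    funext w
    exact (hG.hasDerivAt u v w).deriv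

/-- Absolutely convergent Taylor expansion at `0` along a series `v = ∑ c_k y_k`. -/
theorem BddEntire.hasSum_taylor {G : E → ℂ} (hG : BddEntire G) {c : ℕ → ℂ} {y : ℕ → E} {v : E}
    (hv : HasSum (fun k => c k • y k) v) (hs : Summable fun k => ‖c k‖ * ‖y k‖) :
    HasSum (fun w : Word => (∏ i, c (w.2 i)) * taylorCoeff y w G) (G v) := by
  have h0 : ∀ k, 0 ≤ ‖c k‖ * ‖y k‖ := fun k => by positivity
  set T := ∑' k, ‖c k‖ * ‖y k‖ with hT
  have hT0 : 0 ≤ T := tsum_nonneg h0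
  have hρ : 0 < 2 * Real.exp 1 * T + 1 := by positivity
  set ρ := 2 * Real.exp 1 * T + 1
  obtain ⟨M, hM⟩ := hG.bdd ρ
  have hsum : Summable fun w : Word => (∏ i, c (w.2 i)) * taylorCoeff y w G := by
    refine Summable.of_norm_bounded ((summable_word h0 hs.hasSum (q := Real.exp 1 / ρ)
      (by positivity) ?_).mul_left (M * Real.exp 1)) fun w => ?_
    · rw [div_mul_eq_mul_div, div_lt_one hρ]
      have : 0 ≤ Real.exp 1 * T := by positivity
      change Real.exp 1 * T < 2 * Real.exp 1 * T + 1
      linarith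
    · have := hG.norm_taylorCoeff_le hρ hM y w
      rw [norm_mul, norm_prod]
      refine (mul_le_mul_of_nonneg_left this
        (Finset.prod_nonneg fun i _ => norm_nonneg _)).trans (le_of_eq ?_)
      rw [Finset.prod_mul_distrib, div_pow, Real.exp_add, ← Real.exp_nat_mul, mul_one]
      ring
  have h1 := Complex.hasSum_taylorSeries_of_entire (hG.line 0 v) 0 1
  simp only [sub_zero, one_pow, one_smul, zero_add] at h1
  refine HasSum.sigma_of_hasSum h1 (fun n => ?_) hsum
  have h2 := (hG.hasSum_iterDeriv hv hs n 0).mul_left ((n.factorial : ℂ)⁻¹)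
  rw [← hG.iteratedDeriv_line n 0 v] at h2
  simp only [zero_add] at h2
  refine h2.congr_fun fun j => ?_
  simp only [taylorCoeff, Complex.ofReal_natCast]
  ring

end Taylor

/-! ### Hilbert-Schmidt maps between pre-Hilbert spaces -/

section HilbertSchmidt

variable {E F : Type*} [NormedAddCommGroup E] [InnerProductSpace ℂ E]
  [NormedAddCommGroup F] [InnerProductSpace ℂ F]

/-- `T` is Hilbert-Schmidt with squared Hilbert-Schmidt norm at most `C`; the domain need not be
complete, so only finite orthonormal families are used. -/
def HSBound (T : E →L[ℂ] F) (C : ℝ) : Prop :=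
  ∀ (n : ℕ) (e : Fin n → E), Orthonormal ℂ e → ∑ i, ‖T (e i)‖ ^ 2 ≤ C

theorem HSBound.sum_le {T : E →L[ℂ] F} {C : ℝ} (h : HSBound T C) {ι : Type*} [Fintype ι]
    {e : ι → E} (he : Orthonormal ℂ e) : ∑ i, ‖T (e i)‖ ^ 2 ≤ C := by
  have := h _ (e ∘ (Fintype.equivFin ι).symm) (he.comp _ (Equiv.injective _))
  rwa [← Equiv.sum_comp (Fintype.equivFin ι).symm]

/-- Orthonormal sequences in which some members may be replaced by `0`, as they are produced by the
Gram-Schmidt process. -/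
def OrthoSeq (e : ℕ → E) : Prop := Orthonormal ℂ fun k : {k | e k ≠ 0} => e k

theorem sum_eq_sum_subtype_ne_zero {E : Type*} [Zero E] (e : ℕ → E) (f : E → ℝ) (hf : f 0 = 0)
    (s : Finset ℕ) :
    ∃ t : Finset {k | e k ≠ 0}, ∑ k ∈ s, f (e k) = ∑ k ∈ t, f (e k) := by
  classical
  refine ⟨s.subtype _, ?_⟩
  rw [Finset.sum_subtype_eq_sum_filter (s := s) (p := fun k => k ∈ {k | e k ≠ 0})
    (fun k => f (e k)), Finset.sum_filter_of_ne]
  intro k _ hk h0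
  exact hk (by rw [h0, hf])

theorem OrthoSeq.bessel {e : ℕ → E} (he : OrthoSeq e) (x : E) (s : Finset ℕ) :
    ∑ k ∈ s, ‖inner ℂ (e k) x‖ ^ 2 ≤ ‖x‖ ^ 2 := by
  obtain ⟨t, ht⟩ := sum_eq_sum_subtype_ne_zero e (fun y => ‖inner ℂ y x‖ ^ 2) (by simp) s
  rw [ht]
  exact Orthonormal.sum_inner_products_le x he

theorem HSBound.sum_orthoSeq_le {T : E →L[ℂ] F} {C : ℝ} (h : HSBound T C) {e : ℕ → E}
    (he : OrthoSeq e) (s : Finset ℕ) : ∑ k ∈ s, ‖T (e k)‖ ^ 2 ≤ C := by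
  obtain ⟨t, ht⟩ := sum_eq_sum_subtype_ne_zero e (fun y => ‖T y‖ ^ 2) (by simp) s
  rw [ht, ← Finset.sum_coe_sort]
  exact h.sum_le (he.comp (fun k : t => (k : {k | e k ≠ 0})) Subtype.val_injective)

/-- A Hilbert-Schmidt map is small on the orthogonal complement of a finite orthonormal family that
almost exhausts its Hilbert-Schmidt norm. -/
theorem HSBound.exists_finite_approx {T : E →L[ℂ] F} {C : ℝ} (h : HSBound T C) {ε : ℝ}
    (hε : 0 < ε) : ∃ (n : ℕ) (e : Fin n → E), ∀ ξ, ∃ w ∈ Submodule.span ℂ (range e),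
      ‖T (ξ - w)‖ ≤ ε * ‖ξ‖ := by
  let S : Set ℝ := {r | ∃ (n : ℕ) (e : Fin n → E), Orthonormal ℂ e ∧ r = ∑ i, ‖T (e i)‖ ^ 2}
  have hS : BddAbove S := ⟨C, by rintro _ ⟨n, e, he, rfl⟩; exact h n e he⟩
  have hS0 : S.Nonempty := ⟨0, 0, Fin.elim0, ⟨fun i => i.elim0, fun i => i.elim0⟩, by simp⟩
  obtain ⟨_, ⟨n, e, he, rfl⟩, hr⟩ := exists_lt_of_lt_csSup hS0
    (show sSup S - ε ^ 2 < sSup S by linarith [pow_pos hε 2])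
  refine ⟨n, e, fun ξ => ⟨∑ i, inner ℂ (e i) ξ • e i, ?_, ?_⟩⟩
  · exact Submodule.sum_mem _ fun i _ => Submodule.smul_mem _ _
      (Submodule.subset_span (mem_range_self i))
  set w := ∑ i, inner ℂ (e i) ξ • e i with hw
  set r := ξ - w with hrdef
  have horth : ∀ i, inner ℂ (e i) r = 0 := fun i => by
    rw [hrdef, inner_sub_right, hw, he.inner_right_fintype, sub_self]
  have hwr : inner ℂ w r = 0 := by
    rw [hw, sum_inner]
    exact Finset.sum_eq_zero fun i _ => by rw [inner_smul_left, horth, mul_zero]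
  have hrξ : ‖r‖ ≤ ‖ξ‖ := by
    have h1 := norm_add_sq_eq_norm_sq_add_norm_sq_of_inner_eq_zero w r hwr
    have h2 : w + r = ξ := by rw [hrdef]; abel
    rw [h2] at h1
    nlinarith [norm_nonneg r, norm_nonneg ξ, norm_nonneg w]
  rcases eq_or_ne r 0 with h0 | h0
  · rw [h0, map_zero, norm_zero]; positivity
  have hr0 : ‖r‖ ≠ 0 := norm_ne_zero_iff.2 h0
  let u : E := ((‖r‖ : ℂ)⁻¹) • r
  have hu : ‖u‖ = 1 := by
    simp [u, norm_smul, hr0]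
  have hon : Orthonormal ℂ (Fin.cons u e : Fin (n + 1) → E) := by
    refine ⟨fun i => ?_, fun i j hij => ?_⟩
    · refine Fin.cases ?_ (fun i => ?_) i
      · simpa using hu
      · simpa using he.1 i
    · have hue : ∀ i, inner ℂ (e i) u = 0 := fun i => by
        rw [inner_smul_right, horth, mul_zero]
      revert hij
      refine Fin.cases ?_ (fun i => ?_) i <;> refine Fin.cases ?_ (fun j => ?_) j
      · simp
      · intro _
        simpa using inner_eq_zero_symm.1 (hue j)
      · intro _
        simpa using hue i
      · intro hij
        simpa using he.2 fun h => hij (by rw [h])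
  have hle := le_csSup hS ⟨n + 1, _, hon, rfl⟩
  rw [Fin.sum_univ_succ] at hle
  simp only [Fin.cons_zero, Fin.cons_succ] at hle
  have h1 : ‖T u‖ ^ 2 ≤ ε ^ 2 := by linarith
  have h2 : ‖T u‖ ≤ ε := le_of_sq_le_sq h1 hε.le
  have h3 : ‖T u‖ = ‖r‖⁻¹ * ‖T r‖ := by
    simp [u, norm_smul]
  rw [h3, inv_mul_le_iff₀ (lt_of_le_of_ne (norm_nonneg r) hr0.symm)] at h2
  nlinarith

/-- The image of a Hilbert-Schmidt map is separable: it lies in the closure of the span of the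
images of a sequence. -/
theorem HSBound.exists_seq_dense {T : E →L[ℂ] F} {C : ℝ} (h : HSBound T C) :
    ∃ u : ℕ → E, ∀ ξ, ∀ ε > 0, ∃ w ∈ Submodule.span ℂ (range u), ‖T (ξ - w)‖ < ε := by
  choose n e he using fun m : ℕ => h.exists_finite_approx (Nat.one_div_pos_of_nat (α := ℝ) (n := m))
  obtain ⟨u, hu⟩ := ((countable_iUnion fun m => (finite_range (e m)).countable).insert
    (0 : E)).exists_eq_range (insert_nonempty _ _)
  have hsub : ∀ m, range (e m) ⊆ range u := fun m =>
    hu ▸ (subset_iUnion (fun m => range (e m)) m).trans (subset_insert _ _)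
  refine ⟨u, fun ξ ε hε => ?_⟩
  obtain ⟨m, hm⟩ := exists_nat_one_div_lt (K := ℝ) (div_pos hε (by positivity : 0 < ‖ξ‖ + 1))
  obtain ⟨w, hw, hwle⟩ := he m ξ
  refine ⟨w, Submodule.span_mono (hsub m) hw, hwle.trans_lt ?_⟩
  rw [lt_div_iff₀ (by positivity)] at hm
  have : (0 : ℝ) < 1 / ((m : ℝ) + 1) := Nat.one_div_pos_of_nat
  nlinarith

theorem OrthoSeq.inner_sum {e : ℕ → E} (he : OrthoSeq e) (x : E) (s : Finset ℕ) {k : ℕ}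
    (hk : k ∈ s) : inner ℂ (e k) (∑ i ∈ s, inner ℂ (e i) x • e i) = inner ℂ (e k) x := by
  rw [_root_.inner_sum, Finset.sum_eq_single k]
  · rw [inner_smul_right]
    rcases eq_or_ne (e k) 0 with h0 | h0
    · simp [h0]
    · rw [inner_self_eq_norm_sq_to_K, show ‖e k‖ = 1 from he.1 ⟨k, h0⟩]; simp
  · intro i _ hik
    rw [inner_smul_right]
    by_cases h : e k ≠ 0 ∧ e i ≠ 0
    · rw [show inner ℂ (e k) (e i) = 0 from he.2 (i := ⟨k, h.1⟩) (j := ⟨i, h.2⟩)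
        fun h => hik (congrArg Subtype.val h).symm, mul_zero]
    · rw [not_and_or, not_not, not_not] at h
      rcases h with h | h <;> simp [h]
  · exact fun h => absurd hk h

/-- Orthogonal expansion with respect to a total orthonormal sequence, in a space that need not be
complete. -/
theorem OrthoSeq.tendsto_sum {e : ℕ → E} (he : OrthoSeq e)
    (hd : ∀ ξ, ∀ ε > 0, ∃ w ∈ Submodule.span ℂ (range e), ‖ξ - w‖ < ε) (ξ : E) :
    Tendsto (fun M => ∑ k ∈ Finset.range M, inner ℂ (e k) ξ • e k) atTop (𝓝 ξ) := by
  rw [Metric.tendsto_atTop]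
  intro ε hε
  obtain ⟨w, hw, hwε⟩ := hd ξ ε hε
  obtain ⟨c, rfl⟩ := Finsupp.mem_span_range_iff_exists_finsupp.1 hw
  refine ⟨c.support.sup id + 1, fun M hM => ?_⟩
  set P := ∑ k ∈ Finset.range M, inner ℂ (e k) ξ • e k with hP
  have hmem : ∀ k ∈ c.support, k ∈ Finset.range M := fun k hk => by
    have : k ≤ c.support.sup id := Finset.le_sup (f := id) hk
    exact Finset.mem_range.2 (by omega)
  have horth : ∀ k ∈ Finset.range M, inner ℂ (ξ - P) (e k) = 0 := fun k hk => by
    rw [inner_eq_zero_symm, inner_sub_right, hP, he.inner_sum ξ _ hk, sub_self]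
  set w := c.sum fun i a => a • e i with hwdef
  have h0 : inner ℂ (ξ - P) (P - w) = 0 := by
    rw [inner_sub_right, hP, _root_.inner_sum, ← hP, hwdef, Finsupp.sum, _root_.inner_sum,
      Finset.sum_eq_zero, Finset.sum_eq_zero, sub_zero]
    · exact fun k hk => by rw [inner_smul_right, horth k (hmem k hk), mul_zero]
    · exact fun k hk => by rw [inner_smul_right, horth k hk, mul_zero]
  have h1 := norm_add_sq_eq_norm_sq_add_norm_sq_of_inner_eq_zero _ _ h0
  rw [sub_add_sub_cancel] at h1
  rw [dist_comm, dist_eq_norm]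
  refine lt_of_le_of_lt ?_ hwε
  nlinarith [norm_nonneg (ξ - P), norm_nonneg (P - w), norm_nonneg (ξ - w)]

/-- The adjoint of a Hilbert-Schmidt map is Hilbert-Schmidt.  In a space that need not be complete
the norm of a functional need not be attained; a vector at which half of it is attained costs the
factor `4`. -/
theorem HSBound.sum_dual_le {T : E →L[ℂ] F} {C : ℝ} (h : HSBound T C) {e : ℕ → F}
    (he : OrthoSeq e) (s : Finset ℕ) : ∑ k ∈ s, ‖(innerSL ℂ (e k)).comp T‖ ^ 2 ≤ 4 * C := by
  have hex : ∀ k, ∃ ξ : E, ‖ξ‖ ≤ 1 ∧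
      ‖(innerSL ℂ (e k)).comp T‖ ≤ 2 * ‖(innerSL ℂ (e k)).comp T ξ‖ := fun k => by
    rcases eq_or_ne ((innerSL ℂ (e k)).comp T) 0 with h0 | h0
    · exact ⟨0, by simp, by simp [h0]⟩
    · have hpos := norm_pos_iff.2 h0
      obtain ⟨ξ, h1, h2⟩ := ContinuousLinearMap.exists_lt_apply_of_lt_opNorm _
        (half_lt_self hpos)
      exact ⟨ξ, h1.le, by linarith⟩
  choose ξ hξ1 hξ2 using hex
  let W := Submodule.span ℂ (ξ '' s)
  have : FiniteDimensional ℂ W := FiniteDimensional.span_of_finite ℂ (s.finite_toSet.image ξ)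
  let b := stdOrthonormalBasis ℂ W
  have hb : Orthonormal ℂ fun i => (b i : E) := b.orthonormal.comp_linearIsometry W.subtypeₗᵢ
  have hk : ∀ k ∈ s, ‖(innerSL ℂ (e k)).comp T‖ ^ 2 ≤
      4 * ∑ i, ‖inner ℂ (e k) (T (b i))‖ ^ 2 := fun k hk => by
    have hmem : ξ k ∈ W := Submodule.subset_span (mem_image_of_mem ξ hk)
    have hrep : ξ k = ∑ i, b.repr ⟨ξ k, hmem⟩ i • (b i : E) := by
      have := congrArg (Subtype.val) (b.sum_repr ⟨ξ k, hmem⟩)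
      simpa using this.symm
    have hval : (innerSL ℂ (e k)).comp T (ξ k) =
        ∑ i, b.repr ⟨ξ k, hmem⟩ i * inner ℂ (e k) (T (b i)) := by
      conv_lhs => rw [hrep]
      simp
    have hnorm : ∑ i, ‖b.repr ⟨ξ k, hmem⟩ i‖ ^ 2 ≤ 1 := by
      rw [← EuclideanSpace.norm_sq_eq, LinearIsometryEquiv.norm_map]
      exact pow_le_one₀ (norm_nonneg _) (hξ1 k)
    have h1 : ‖(innerSL ℂ (e k)).comp T (ξ k)‖ ^ 2 ≤ ∑ i, ‖inner ℂ (e k) (T (b i))‖ ^ 2 := by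
      rw [hval]
      calc _ ≤ (∑ i, ‖b.repr ⟨ξ k, hmem⟩ i‖ * ‖inner ℂ (e k) (T (b i))‖) ^ 2 := by
            refine pow_le_pow_left₀ (norm_nonneg _) ((norm_sum_le _ _).trans_eq ?_) 2
            simp_rw [norm_mul]
        _ ≤ (∑ i, ‖b.repr ⟨ξ k, hmem⟩ i‖ ^ 2) * ∑ i, ‖inner ℂ (e k) (T (b i))‖ ^ 2 :=
            Finset.sum_mul_sq_le_sq_mul_sq _ _ _
        _ ≤ _ := mul_le_of_le_one_left (Finset.sum_nonneg fun i _ => by positivity) hnorm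
    calc _ ≤ (2 * ‖(innerSL ℂ (e k)).comp T (ξ k)‖) ^ 2 :=
          pow_le_pow_left₀ (norm_nonneg _) (hξ2 k) 2
      _ = 4 * ‖(innerSL ℂ (e k)).comp T (ξ k)‖ ^ 2 := by ring
      _ ≤ _ := by linarith
  refine (Finset.sum_le_sum hk).trans ?_
  rw [← Finset.mul_sum, Finset.sum_comm]
  refine mul_le_mul_of_nonneg_left ?_ (by norm_num)
  exact (Finset.sum_le_sum fun i _ => he.bessel (T (b i)) s).trans (h.sum_le hb)

end HilbertSchmidt

/-! ### Nuclear expansions -/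

section Nuclear

variable (N : Type*) [AddCommGroup N] [Module ℂ N] [UniformSpace N] [NuclearHilbertian N]

theorem norm_toStep (p : ℕ) (ξ : N) :
    ‖toStep N p ξ‖ = coreSeminorm (NuclearHilbertian.core (N := N) p) ξ := rfl

theorem inner_step (p : ℕ) (x y : Step N p) :
    inner ℂ x y = (NuclearHilbertian.core (N := N) p).inner x y := rfl

theorem norm_toStep_mono {p q : ℕ} (h : p ≤ q) (ξ : N) : ‖toStep N p ξ‖ ≤ ‖toStep N q ξ‖ :=
  NuclearHilbertian.mono (N := N) h ξ

/-- The identity of `N` as a map from `N_q` to `N_p`, for `p ≤ q`. -/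
def stepMap {p q : ℕ} (h : p ≤ q) : Step N q →L[ℂ] Step N p :=
  LinearMap.mkContinuous
    { toFun := fun x => x
      map_add' := fun _ _ => rfl
      map_smul' := fun _ _ => rfl } 1 fun x => by
    rw [one_mul]; exact norm_toStep_mono N h x

theorem stepMap_toStep {p q : ℕ} (h : p ≤ q) (ξ : N) :
    stepMap N h (toStep N q ξ) = toStep N p ξ := rfl

theorem norm_stepMap_le {p q : ℕ} (h : p ≤ q) (x : Step N q) : ‖stepMap N h x‖ ≤ ‖x‖ :=
  norm_toStep_mono N h x

theorem exists_hsBound (p : ℕ) : ∃ q, ∃ h : p ≤ q, ∃ C, HSBound (stepMap N h) C := by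
  obtain ⟨q, hq, C, hC⟩ := NuclearHilbertian.hilbertSchmidt (N := N) p
  refine ⟨q, hq.le, C, fun n e he => ?_⟩
  have h := hC n e fun i j => by rw [← inner_step]; exact orthonormal_iff_ite.1 he i j
  refine le_trans (Finset.sum_le_sum fun i _ => ?_) h
  exact (congrArg (· ^ 2) (norm_toStep N p (e i))).le

/-- `N_{-p} ⊂ N_{-q}` for `p ≤ q`. -/
def negMap {p q : ℕ} (h : p ≤ q) (z : NegStep N p) : NegStep N q := z.comp (stepMap N h)

theorem negMap_apply {p q : ℕ} (h : p ≤ q) (z : NegStep N p) (x : Step N q) :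
    negMap N h z x = z (stepMap N h x) := rfl

theorem negIncl_negMap {p q : ℕ} (h : p ≤ q) (z : NegStep N p) :
    negIncl N q (negMap N h z) = negIncl N p z :=
  ContinuousLinearMap.ext fun ξ => by
    rw [negIncl_apply, negIncl_apply, negMap_apply, stepMap_toStep]

theorem norm_negMap_le {p q : ℕ} (h : p ≤ q) (z : NegStep N p) : ‖negMap N h z‖ ≤ ‖z‖ := by
  refine ContinuousLinearMap.opNorm_le_bound _ (norm_nonneg z) fun x => ?_
  rw [negMap_apply]
  exact (z.le_opNorm _).trans
    (mul_le_mul_of_nonneg_left (norm_stepMap_le N h x) (norm_nonneg z))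

/-- Nuclearity: the canonical map `N_{p'} → N_p` has an absolutely convergent expansion in
one-dimensional maps `ξ ↦ z_k(ξ) x_k`, with vectors `x_k` in `N` itself.  It is the composition of
two Hilbert-Schmidt maps `N_r → N_q → N_p`, expanded along an orthonormal sequence of `N_q`; the
Gram-Schmidt process keeps that sequence in `N`. -/
theorem exists_nuclear_expansion (p : ℕ) : ∃ p', ∃ _ : p ≤ p', ∃ (x : ℕ → N)
    (z : ℕ → NegStep N p'),
    (Summable fun k => ‖z k‖ * ‖toStep N p (x k)‖) ∧
    ∀ ξ, HasSum (fun k => z k (toStep N p' ξ) • toStep N p (x k)) (toStep N p ξ) := by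
  obtain ⟨q, hpq, C, hC⟩ := exists_hsBound N p
  obtain ⟨r, hqr, D, hD⟩ := exists_hsBound N q
  obtain ⟨u, hu⟩ := hD.exists_seq_dense
  let v : ℕ → Step N q := fun k => stepMap N hqr (u k)
  let e := InnerProductSpace.gramSchmidtNormed ℂ v
  have he : OrthoSeq e := InnerProductSpace.gramSchmidtNormed_orthonormal' v
  have hspan : Submodule.span ℂ (range e) = Submodule.span ℂ (range v) := by
    rw [InnerProductSpace.span_gramSchmidtNormed_range, InnerProductSpace.span_gramSchmidt]
  have hd : ∀ ξ : Step N q, ∀ ε > 0, ∃ w ∈ Submodule.span ℂ (range e), ‖ξ - w‖ < ε := by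
    intro ξ ε hε
    obtain ⟨w, hw, hwε⟩ := hu ξ ε hε
    refine ⟨stepMap N hqr w, ?_, hwε⟩
    have hv : range v = stepMap N hqr '' range u := by rw [← range_comp]; rfl
    rw [hspan, hv, ← ContinuousLinearMap.coe_coe, ← Submodule.map_span]
    exact Submodule.mem_map_of_mem hw
  let z : ℕ → NegStep N r := fun k => (innerSL ℂ (e k)).comp (stepMap N hqr)
  have hsum : Summable fun k => ‖z k‖ * ‖stepMap N hpq (e k)‖ := by
    have h1 : Summable fun k => ‖z k‖ ^ 2 :=
      summable_of_sum_le (fun k => by positivity) fun s => hD.sum_dual_le he s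
    have h2 : Summable fun k => ‖stepMap N hpq (e k)‖ ^ 2 :=
      summable_of_sum_le (fun k => by positivity) fun s => hC.sum_orthoSeq_le he s
    refine Summable.of_nonneg_of_le (fun k => by positivity) (fun k => ?_) (h1.add h2)
    nlinarith [sq_nonneg (‖z k‖ - ‖stepMap N hpq (e k)‖), sq_nonneg ‖z k‖,
      sq_nonneg ‖stepMap N hpq (e k)‖]
  refine ⟨r, hpq.trans hqr, e, z, hsum, fun ξ => ?_⟩
  have hlim := ((stepMap N hpq).continuous.tendsto _).comp (he.tendsto_sum hd (toStep N q ξ))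
  refine hasSum_of_subseq_of_summable ?_ tendsto_finset_range (hlim.congr fun M => ?_)
  · refine Summable.of_nonneg_of_le (fun k => norm_nonneg _) (fun k => ?_)
      (hsum.mul_right ‖toStep N r ξ‖)
    rw [norm_smul]
    calc _ ≤ ‖z k‖ * ‖toStep N r ξ‖ * ‖toStep N p (e k)‖ := by
          gcongr
          exact (z k).le_opNorm _
      _ = ‖z k‖ * ‖toStep N p (e k)‖ * ‖toStep N r ξ‖ := by ring
  · simp only [Function.comp, map_sum, map_smul]
    rfl

end Nuclear

/-! ### Growth functions -/

/-- Functions on `[0, ∞)` that are convex along rays from `0` with `θ 0 ≤ 0`: this is all the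
convexity that is used, and both Young functions and the functions `(e^{θ*})*` have it. -/
class StarShaped (θ : ℝ → ℝ) : Prop where
  star : ∀ l x : ℝ, 0 ≤ l → l ≤ 1 → 0 ≤ x → θ (l * x) ≤ l * θ x

theorem conj_le {θ : ℝ → ℝ} {x B : ℝ} (h : ∀ t, 0 ≤ t → t * x - θ t ≤ B) : conj θ x ≤ B := by
  have : Nonempty (Ici (0 : ℝ)) := ⟨⟨0, mem_Ici.2 le_rfl⟩⟩
  exact ciSup_le fun t => h t t.2

theorem conj_star {θ : ℝ → ℝ} [hg : IsGrowth θ] (h : ∀ t, 0 ≤ t → 0 ≤ θ t) {l : ℝ} (h0 : 0 ≤ l)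
    (h1 : l ≤ 1) (x : ℝ) : conj θ (l * x) ≤ l * conj θ x := by
  refine conj_le fun t ht => ?_
  have h2 := mul_le_mul_of_nonneg_left (hg.le_conj x ht) h0
  nlinarith [h t ht]

theorem IsYoung.nonneg {θ : ℝ → ℝ} [h : IsYoung θ] {t : ℝ} (ht : 0 ≤ t) : 0 ≤ θ t := by
  rw [← h.zero]
  exact h.mono (mem_Ici.2 le_rfl) (mem_Ici.2 ht) ht

instance {θ : ℝ → ℝ} [h : IsYoung θ] : StarShaped θ where
  star l x h0 h1 hx := by
    have := h.convex.2 (mem_Ici.2 le_rfl) (mem_Ici.2 hx) (sub_nonneg.2 h1) h0 (by ring)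
    simpa [h.zero] using this

instance {θ : ℝ → ℝ} [IsGrowth θ] : StarShaped (expConj θ) where
  star _ x h0 h1 _ := conj_star (fun _ _ => (Real.exp_pos _).le) h0 h1 x

theorem StarShaped.zero_le {θ : ℝ → ℝ} [h : StarShaped θ] : θ 0 ≤ 0 := by
  simpa using h.star 0 0 le_rfl zero_le_one le_rfl

theorem IsGrowth.zero_le {θ : ℝ → ℝ} [h : IsGrowth θ] {t : ℝ} (ht : 0 ≤ t) : θ 0 ≤ θ t :=
  h.mono (mem_Ici.2 le_rfl) (mem_Ici.2 ht) ht

theorem conj_nonneg {θ : ℝ → ℝ} [h : IsGrowth θ] [StarShaped θ] (x : ℝ) : 0 ≤ conj θ x := by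
  have := h.le_conj x le_rfl
  have := StarShaped.zero_le (θ := θ)
  linarith

theorem conj_mono {θ : ℝ → ℝ} [IsGrowth θ] {x y : ℝ} (hx : 0 ≤ x) (hxy : x ≤ y) :
    conj θ x ≤ conj θ y :=
  (IsGrowth.conj (θ := θ)).mono (mem_Ici.2 hx) (mem_Ici.2 (hx.trans hxy)) hxy

/-- Products of symbols stay within the growth of symbols, at the price of a dilation by `2`. -/
theorem two_mul_conj_le {θ : ℝ → ℝ} [h : IsGrowth θ] (x : ℝ) :
    2 * conj θ x ≤ conj θ (2 * x) - θ 0 := by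
  have : conj θ x ≤ (conj θ (2 * x) - θ 0) / 2 := conj_le fun t ht => by
    have := h.le_conj (2 * x) ht
    have := IsGrowth.zero_le (θ := θ) ht
    linarith
  linarith

/-- The substitute for Legendre duality that is needed: radii `t` and `s` at which `θ` and `θ*`
are both at most of order `n`, while `s t` is of order `n`. -/
theorem exists_dual_radii {θ : ℝ → ℝ} [h : IsGrowth θ] [hs : StarShaped θ] (n : ℕ) :
    ∃ t s : ℝ, 0 < t ∧ 0 < s ∧ θ t ≤ n + 1 ∧ conj θ s ≤ n + 1 - θ 0 ∧ s * t = (n + 1) / 2 := by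
  have hn : (0 : ℝ) < n + 1 := by positivity
  let S : Set ℝ := {t | 0 < t ∧ θ t ≤ n + 1}
  have hne : S.Nonempty := by
    have hl : 0 < 1 / (1 + |θ 1|) := by positivity
    refine ⟨1 / (1 + |θ 1|) * 1, by simpa using hl, ?_⟩
    refine (hs.star _ 1 hl.le ?_ zero_le_one).trans ?_
    · rw [div_le_one (by positivity)]; linarith [abs_nonneg (θ 1)]
    · rw [one_div, inv_mul_le_iff₀ (by positivity)]
      nlinarith [abs_nonneg (θ 1), le_abs_self (θ 1), Nat.cast_nonneg (α := ℝ) n]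
  have hbdd : BddAbove S := by
    obtain ⟨R, hR⟩ := eventually_atTop.1 (h.superlinear.eventually_ge_atTop ((n : ℝ) + 1))
    refine ⟨max R 1, fun t ht => ?_⟩
    by_contra! hlt
    have h1 := hR t ((le_max_left _ _).trans hlt.le)
    have h2 : 1 < t := (le_max_right _ _).trans_lt hlt
    rw [le_div_iff₀ ht.1] at h1
    nlinarith [ht.2]
  have hpos : 0 < sSup S := hne.some_mem.1.trans_le (le_csSup hbdd hne.some_mem)
  -- `t` with `θ t ≤ n + 1 < θ (2 t)`
  obtain ⟨t, ht, hlt⟩ := exists_lt_of_lt_csSup hne (half_lt_self hpos)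
  have ht0 : 0 < t := ht.1
  have h2t : (n : ℝ) + 1 < θ (2 * t) := by
    by_contra! hle
    have := le_csSup hbdd (show 2 * t ∈ S from ⟨by linarith, hle⟩)
    linarith
  refine ⟨t, (n + 1) / (2 * t), ht0, by positivity, ht.2, ?_, by field_simp⟩
  have h00 := StarShaped.zero_le (θ := θ)
  refine conj_le fun r hr => ?_
  rcases le_total r (2 * t) with hrt | hrt
  · have h1 : r * ((n + 1) / (2 * t)) ≤ n + 1 := by
      rw [mul_div_assoc', div_le_iff₀ (by positivity)]
      nlinarith
    have := IsGrowth.zero_le (θ := θ) hr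
    linarith
  · have hr0 : 0 < r := by linarith
    have h1 := hs.star (2 * t / r) r (by positivity) (by rwa [div_le_one hr0]) hr
    rw [div_mul_cancel₀ _ hr0.ne', div_mul_eq_mul_div, le_div_iff₀ hr0] at h1
    have h2 : r * ((n + 1) / (2 * t)) ≤ θ r := by
      rw [mul_div_assoc', div_le_iff₀ (by positivity)]
      nlinarith
    linarith

/-- Up to a dilation, `e^{θ*}` is dominated by its own biconjugate. -/
theorem exp_conj_le {θ : ℝ → ℝ} [h : IsYoung θ] {x : ℝ} (hx : 0 ≤ x) :
    Real.exp (conj θ x) ≤ conj (expConj θ) (2 * x) + 2 := by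
  set ψ : ℝ → ℝ := fun x => Real.exp (conj θ x) with hψ
  have hψ1 : ∀ y, 1 ≤ ψ y := fun y => Real.one_le_exp (conj_nonneg y)
  rcases hx.eq_or_lt with rfl | hx
  · have h1 : conj θ 0 ≤ 0 := conj_le fun t ht => by linarith [IsYoung.nonneg (θ := θ) ht]
    have h2 : Real.exp (conj θ 0) ≤ 1 := Real.exp_le_one_iff.2 h1
    have h3 := conj_nonneg (θ := expConj θ) (2 * 0)
    linarith
  -- the slope of the chord of `ψ` between `0` and `x` nearly attains the outer supremum at `2 x`
  have ht0 : 0 ≤ (ψ x - 1) / x := div_nonneg (by linarith [hψ1 x]) hx.le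
  have h1 : expConj θ ((ψ x - 1) / x) ≤ ψ x := by
    refine conj_le fun y hy => ?_
    change y * ((ψ x - 1) / x) - ψ y ≤ ψ x
    rcases le_total y x with hyx | hyx
    · have : y * ((ψ x - 1) / x) ≤ ψ x - 1 := by
        rw [mul_div_assoc', div_le_iff₀ hx]
        nlinarith [hψ1 x]
      linarith [hψ1 y]
    · have hy0 : 0 < y := hx.trans_le hyx
      have hl0 : 0 ≤ x / y := by positivity
      have hl1 : x / y ≤ 1 := by rwa [div_le_one hy0]
      have h2 : conj θ x ≤ x / y * conj θ y := by
        have := conj_star (θ := θ) (fun t ht => IsYoung.nonneg ht) hl0 hl1 y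
        rwa [div_mul_cancel₀ _ hy0.ne'] at this
      have h3 : ψ x ≤ x / y * ψ y + (1 - x / y) := by
        refine (Real.exp_le_exp.2 h2).trans ?_
        have := convexOn_exp.2 (mem_univ (conj θ y)) (mem_univ 0) hl0 (sub_nonneg.2 hl1) (by ring)
        simpa using this
      have h4 : y * ((ψ x - 1) / x) ≤ ψ y - 1 := by
        rw [mul_div_assoc', div_le_iff₀ hx]
        have h5 := mul_le_mul_of_nonneg_left h3 hy
        have h6 : y * (x / y * ψ y + (1 - x / y)) = x * ψ y + y - x := by
          field_simp; ring
        linarith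
      linarith [hψ1 x]
  have h2 := (IsGrowth.expConj (θ := θ)).le_conj (2 * x) ht0
  have h3 : (ψ x - 1) / x * (2 * x) = 2 * (ψ x - 1) := by field_simp
  change ψ x ≤ _
  linarith

/-! ### Test functions -/

section TestSpace

variable {θ : ℝ → ℝ} {N : Type*} [AddCommGroup N] [Module ℂ N] [UniformSpace N]
  [NuclearHilbertian N]

variable (θ N) in
/-- The norm `‖f‖_{p, a}`. -/
abbrev tnorm (p : ℕ) {a : ℝ} (ha : 0 < a) : Seminorm ℂ (TestSpace θ N) :=
  testSeminorm θ N (p, ⟨a, ha⟩)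

theorem norm_le_tnorm (f : TestSpace θ N) (p : ℕ) {a : ℝ} (ha : 0 < a) (z : NegStep N p) :
    ‖f (negIncl N p z)‖ ≤ tnorm θ N p ha f * Real.exp (θ (a * ‖z‖)) := by
  have h : ‖f (negIncl N p z)‖ * Real.exp (-θ (a * ‖z‖)) ≤ tnorm θ N p ha f :=
    le_ciSup (f.bddAbove p ha) z
  rwa [Real.exp_neg, ← div_eq_mul_inv, div_le_iff₀ (Real.exp_pos _)] at h

theorem tnorm_le (f : TestSpace θ N) (p : ℕ) {a B : ℝ} (ha : 0 < a)
    (h : ∀ z : NegStep N p, ‖f (negIncl N p z)‖ ≤ B * Real.exp (θ (a * ‖z‖))) :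
    tnorm θ N p ha f ≤ B := by
  refine ciSup_le fun z => ?_
  rw [Real.exp_neg, ← div_eq_mul_inv, div_le_iff₀ (Real.exp_pos _)]
  exact h z

theorem tnorm_mono [h : IsGrowth θ] (f : TestSpace θ N) {p q : ℕ} (hpq : p ≤ q) {a b : ℝ}
    (ha : 0 < a) (hb : 0 < b) (hba : b ≤ a) : tnorm θ N p ha f ≤ tnorm θ N q hb f := by
  refine tnorm_le f p ha fun z => ?_
  rw [← negIncl_negMap N hpq z]
  refine (norm_le_tnorm f q hb _).trans ?_
  refine mul_le_mul_of_nonneg_left (Real.exp_le_exp.2 ?_) (apply_nonneg _ _)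
  have := norm_negMap_le N hpq z
  exact h.mono (mem_Ici.2 (by positivity)) (mem_Ici.2 (by positivity))
    (mul_le_mul hba this (norm_nonneg _) ha.le)

theorem exists_sup_le_tnorm [IsGrowth θ] (s : Finset (ℕ × Ioi (0 : ℝ))) :
    ∃ (p : ℕ) (a : ℝ) (ha : 0 < a),
      ∀ f : TestSpace θ N, s.sup (testSeminorm θ N) f ≤ tnorm θ N p ha f := by
  classical
  induction s using Finset.induction_on with
  | empty => exact ⟨0, 1, one_pos, fun f => by simp⟩
  | insert i s _ ih =>
    obtain ⟨p, a, ha, h⟩ := ih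
    refine ⟨max i.1 p, min i.2 a, lt_min i.2.2 ha, fun f => ?_⟩
    rw [Finset.sup_insert, Seminorm.sup_apply]
    exact max_le (tnorm_mono f (le_max_left _ _) i.2.2 _ (min_le_left _ _))
      ((h f).trans (tnorm_mono f (le_max_right _ _) ha _ (min_le_right _ _)))

/-- A continuous functional is dominated by a single norm `‖·‖_{p, a}`. -/
theorem exists_tnorm_bound [IsGrowth θ] (L : StrongDual ℂ (TestSpace θ N)) :
    ∃ (p : ℕ) (a : ℝ) (ha : 0 < a) (C : ℝ), 0 ≤ C ∧ ∀ f, ‖L f‖ ≤ C * tnorm θ N p ha f := by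
  obtain ⟨s, C, -, hC⟩ := Seminorm.bound_of_continuous (testSpace_withSeminorms θ N)
    ((normSeminorm ℂ ℂ).comp (L : TestSpace θ N →ₗ[ℂ] ℂ)) (by
      change Continuous fun f => ‖L f‖
      exact L.continuous.norm)
  obtain ⟨p, a, ha, h⟩ := exists_sup_le_tnorm (θ := θ) (N := N) s
  refine ⟨p, a, ha, C, C.2, fun f => (hC f).trans ?_⟩
  exact mul_le_mul_of_nonneg_left (h f) C.2

theorem tnorm_expVec_le [h : IsGrowth θ] (ξ : N) (p : ℕ) {a : ℝ} (ha : 0 < a) :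
    tnorm θ N p ha (expVec θ ξ) ≤ Real.exp (conj θ (‖toStep N p ξ‖ / a)) := by
  refine tnorm_le _ p ha fun z => ?_
  change ‖Complex.exp (z (toStep N p ξ))‖ ≤ _
  rw [Complex.norm_exp, ← Real.exp_add, Real.exp_le_exp]
  have h1 := (Complex.re_le_norm _).trans (z.le_opNorm (toStep N p ξ))
  have h2 := h.le_conj (‖toStep N p ξ‖ / a) (t := a * ‖z‖) (by positivity)
  have h3 : a * ‖z‖ * (‖toStep N p ξ‖ / a) = ‖z‖ * ‖toStep N p ξ‖ := by field_simp
  linarith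

theorem bddEntire_test [h : IsGrowth θ] (f : TestSpace θ N) (p : ℕ) :
    BddEntire fun z : NegStep N p => f (negIncl N p z) where
  line u v := by
    have h1 : Differentiable ℂ fun w : ℂ => u + w • v := by fun_prop
    exact (f.2 p).1.comp h1
  bdd R := by
    refine ⟨tnorm θ N p one_pos f * Real.exp (θ (1 * |R|)), fun z hz => ?_⟩
    refine (norm_le_tnorm f p one_pos z).trans ?_
    refine mul_le_mul_of_nonneg_left (Real.exp_le_exp.2 ?_) (apply_nonneg _ _)
    exact h.mono (mem_Ici.2 (by positivity)) (mem_Ici.2 (by positivity))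
      (mul_le_mul_of_nonneg_left (hz.trans (le_abs_self R)) zero_le_one)

theorem iterDeriv_exp_apply {p : ℕ} (x : Step N p) (l : List (NegStep N p)) (z : NegStep N p) :
    iterDeriv l (fun z : NegStep N p => Complex.exp (z x)) z =
      (l.map fun y => y x).prod * Complex.exp (z x) := by
  have hG : BddEntire fun z : NegStep N p => Complex.exp (z x) := by
    refine ⟨fun u v => ?_, fun R => ⟨Real.exp (R * ‖x‖), fun z hz => ?_⟩⟩
    · simp only [add_apply, smul_apply, smul_eq_mul]
      fun_prop
    · rw [Complex.norm_exp]
      refine Real.exp_le_exp.2 ((Complex.re_le_norm _).trans ((z.le_opNorm x).trans ?_))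
      gcongr
  have hD : ∀ y : NegStep N p, dirDeriv y (fun z : NegStep N p => Complex.exp (z x)) =
      fun z => y x * Complex.exp (z x) := fun y => by
    funext z
    have h1 : HasDerivAt (fun w : ℂ => z x + w * y x) (y x) 0 := by
      simpa using ((hasDerivAt_id (0 : ℂ)).mul_const (y x)).const_add (z x)
    have h2 := h1.cexp
    simp only [zero_mul, add_zero] at h2
    rw [dirDeriv]
    simp only [add_apply, smul_apply, smul_eq_mul]
    rw [h2.deriv, mul_comm]
  induction l generalizing z with
  | nil => simp [iterDeriv]
  | cons y l ih =>
    rw [iterDeriv, hD, iterDeriv_const_mul hG]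
    simp only [ih, List.map_cons, List.prod_cons, mul_assoc]

end TestSpace

/-! ### Exponential monomials -/

section Monomials

variable {θ : ℝ → ℝ} {N : Type*} [AddCommGroup N] [Module ℂ N] [UniformSpace N]
  [NuclearHilbertian N]

theorem exists_pow_mul_exp_le [h : IsGrowth θ] (n : ℕ) (c : ℝ) {a : ℝ} (ha : 0 < a) :
    ∃ B, 0 ≤ B ∧ ∀ r, 0 ≤ r → r ^ n * Real.exp (c * r) ≤ B * Real.exp (θ (a * r)) := by
  obtain ⟨C, hC⟩ := h.bddAbove (c + 1) ha
  refine ⟨n.factorial * Real.exp C, by positivity, fun r hr => ?_⟩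
  have h1 : r ^ n ≤ n.factorial * Real.exp r := by
    have := Real.pow_div_factorial_le_exp r hr n
    rwa [div_le_iff₀' (by positivity)] at this
  calc _ ≤ n.factorial * Real.exp r * Real.exp (c * r) := by gcongr
    _ = n.factorial * Real.exp (r + c * r) := by rw [Real.exp_add, mul_assoc]
    _ ≤ n.factorial * Real.exp (C + θ (a * r)) := by
        refine mul_le_mul_of_nonneg_left (Real.exp_le_exp.2 ?_) (by positivity)
        have := hC r hr
        linarith
    _ = _ := by rw [Real.exp_add, mul_assoc]

theorem norm_prod_map_apply_le (p : ℕ) (l : List N) (z : NegStep N p) :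
    ‖(l.map fun ξ => z (toStep N p ξ)).prod‖ ≤
      (l.map fun ξ => ‖toStep N p ξ‖).prod * ‖z‖ ^ l.length := by
  induction l with
  | nil => simp
  | cons ξ l ih =>
    rw [List.map_cons, List.prod_cons, List.map_cons, List.prod_cons, List.length_cons, norm_mul,
      pow_succ]
    calc _ ≤ (‖z‖ * ‖toStep N p ξ‖) * ((l.map fun ξ => ‖toStep N p ξ‖).prod * ‖z‖ ^ l.length) :=
          mul_le_mul (z.le_opNorm _) ih (norm_nonneg _) (by positivity)
      _ = _ := by ring

theorem prod_map_norm_nonneg (p : ℕ) (l : List N) :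
    0 ≤ (l.map fun ξ => ‖toStep N p ξ‖).prod :=
  List.prod_nonneg fun x hx => by
    obtain ⟨ξ, -, rfl⟩ := List.mem_map.1 hx
    exact norm_nonneg _

theorem norm_exp_apply_le (p : ℕ) (u : N) (z : NegStep N p) :
    ‖Complex.exp (z (toStep N p u))‖ ≤ Real.exp (‖toStep N p u‖ * ‖z‖) := by
  rw [Complex.norm_exp, Real.exp_le_exp, mul_comm]
  exact (Complex.re_le_norm _).trans (z.le_opNorm _)

theorem differentiable_prod_map (p : ℕ) (l : List N) :
    Differentiable ℂ fun z : NegStep N p => (l.map fun ξ => z (toStep N p ξ)).prod := by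
  induction l with
  | nil => simp
  | cons ξ l ih =>
    simp only [List.map_cons, List.prod_cons]
    exact (ContinuousLinearMap.apply ℂ ℂ (toStep N p ξ)).differentiable.mul ih

variable (θ) in
/-- The exponential monomial `z ↦ ∏ ⟨z, ξ⟩ · e^{⟨z, u⟩}`, the product over the members `ξ` of a
list. -/
def monoExp [IsGrowth θ] (l : List N) (u : N) : TestSpace θ N :=
  ⟨fun z => (l.map fun ξ => z ξ).prod * Complex.exp (z u), by
    intro p
    refine ⟨?_, fun a ha => ?_⟩
    · exact (differentiable_prod_map p l).mul
        (ContinuousLinearMap.apply ℂ ℂ (toStep N p u)).differentiable.cexp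
    · obtain ⟨B, hB0, hB⟩ := exists_pow_mul_exp_le (θ := θ) l.length ‖toStep N p u‖ ha
      refine ⟨(l.map fun ξ => ‖toStep N p ξ‖).prod * B, ?_⟩
      rintro _ ⟨z, rfl⟩
      dsimp only
      rw [Real.exp_neg, ← div_eq_mul_inv, div_le_iff₀ (Real.exp_pos _), norm_mul]
      calc _ ≤ (l.map fun ξ => ‖toStep N p ξ‖).prod * ‖z‖ ^ l.length *
            Real.exp (‖toStep N p u‖ * ‖z‖) :=
            mul_le_mul (norm_prod_map_apply_le p l z) (norm_exp_apply_le p u z) (norm_nonneg _)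
              (mul_nonneg (prod_map_norm_nonneg p l) (by positivity))
        _ ≤ (l.map fun ξ => ‖toStep N p ξ‖).prod * (B * Real.exp (θ (a * ‖z‖))) := by
            rw [mul_assoc]
            exact mul_le_mul_of_nonneg_left (hB _ (norm_nonneg z)) (prod_map_norm_nonneg p l)
        _ = _ := by ring⟩

theorem monoExp_apply [IsGrowth θ] (l : List N) (u : N) (p : ℕ) (z : NegStep N p) :
    monoExp θ l u (negIncl N p z) =
      (l.map fun ξ => z (toStep N p ξ)).prod * Complex.exp (z (toStep N p u)) := rfl

theorem monoExp_nil [IsGrowth θ] (u : N) : monoExp θ [] u = expVec θ u :=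
  Subtype.ext (funext fun z => by simp [monoExp, expVec])

theorem test_sub_apply (f g : TestSpace θ N) (z : StrongDual ℂ N) : (f - g) z = f z - g z := rfl

theorem test_smul_apply (c : ℂ) (f : TestSpace θ N) (z : StrongDual ℂ N) : (c • f) z = c * f z :=
  rfl

theorem test_sum_apply {ι : Type*} (s : Finset ι) (f : ι → TestSpace θ N) (z : StrongDual ℂ N) :
    (∑ i ∈ s, f i) z = ∑ i ∈ s, f i z := by
  classical
  induction s using Finset.induction_on with
  | empty => rfl
  | insert a s ha ih =>
    rw [Finset.sum_insert ha, Finset.sum_insert ha, ← ih]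
    rfl

/-- Under a continuous functional, differentiating an exponential monomial in the exponent inserts
a factor. -/
theorem hasDerivAt_monoExp [IsGrowth θ] (L : StrongDual ℂ (TestSpace θ N)) (l : List N) (u v : N) :
    HasDerivAt (fun w : ℂ => L (monoExp θ l (u + w • v))) (L (monoExp θ (v :: l) u)) 0 := by
  obtain ⟨p, a, ha, C, hC0, hC⟩ := exists_tnorm_bound L
  set P := (l.map fun ξ => ‖toStep N p ξ‖).prod with hP
  have hP0 : 0 ≤ P := prod_map_norm_nonneg p l
  obtain ⟨B, hB0, hB⟩ := exists_pow_mul_exp_le (θ := θ) (l.length + 2)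
    (‖toStep N p u‖ + ‖toStep N p v‖) ha
  have hrem : ∀ w : ℂ, ‖w‖ ≤ 1 → tnorm θ N p ha (monoExp θ l (u + w • v) - monoExp θ l u -
      w • monoExp θ (v :: l) u) ≤ ‖w‖ ^ 2 * (‖toStep N p v‖ ^ 2 * P * B) := fun w hw => by
    refine tnorm_le _ p ha fun z => ?_
    simp only [test_sub_apply, test_smul_apply, monoExp_apply, map_add, map_smul, smul_eq_mul,
      Complex.exp_add, List.map_cons, List.prod_cons]
    set Q := (l.map fun ξ => z (toStep N p ξ)).prod
    set e := Complex.exp (z (toStep N p u))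
    set x := z (toStep N p v)
    have hfac : Q * (e * Complex.exp (w * x)) - Q * e - w * (x * Q * e) =
        Q * e * (Complex.exp (w * x) - ∑ m ∈ Finset.range 2, (w * x) ^ m / m.factorial) := by
      simp [Finset.sum_range_succ]; ring
    have hx : ‖x‖ ≤ ‖toStep N p v‖ * ‖z‖ := by
      rw [mul_comm]; exact z.le_opNorm _
    have h1 : ‖Complex.exp (w * x) - ∑ m ∈ Finset.range 2, (w * x) ^ m / m.factorial‖ ≤
        ‖w‖ ^ 2 * (‖toStep N p v‖ * ‖z‖) ^ 2 * Real.exp (‖toStep N p v‖ * ‖z‖) := by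
      refine (Complex.norm_exp_sub_sum_le_norm_mul_exp _ 2).trans ?_
      rw [norm_mul, mul_pow]
      have h4 : ‖w‖ * ‖x‖ ≤ ‖toStep N p v‖ * ‖z‖ :=
        (mul_le_mul hw hx (norm_nonneg _) zero_le_one).trans_eq (one_mul _)
      have h5 := Real.exp_le_exp.2 h4
      have h6 := pow_le_pow_left₀ (norm_nonneg x) hx 2
      exact mul_le_mul (mul_le_mul_of_nonneg_left h6 (by positivity)) h5 (Real.exp_pos _).le
        (by positivity)
    have h2 : ‖Q‖ ≤ P * ‖z‖ ^ l.length := norm_prod_map_apply_le p l z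
    have h3 : ‖e‖ ≤ Real.exp (‖toStep N p u‖ * ‖z‖) := norm_exp_apply_le p u z
    rw [hfac, norm_mul, norm_mul]
    calc _ ≤ P * ‖z‖ ^ l.length * Real.exp (‖toStep N p u‖ * ‖z‖) *
          (‖w‖ ^ 2 * (‖toStep N p v‖ * ‖z‖) ^ 2 * Real.exp (‖toStep N p v‖ * ‖z‖)) := by
          gcongr
      _ = ‖w‖ ^ 2 * (‖toStep N p v‖ ^ 2 * P) * (‖z‖ ^ (l.length + 2) *
          Real.exp ((‖toStep N p u‖ + ‖toStep N p v‖) * ‖z‖)) := by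
          rw [add_mul, Real.exp_add, pow_add]; ring
      _ ≤ ‖w‖ ^ 2 * (‖toStep N p v‖ ^ 2 * P) * (B * Real.exp (θ (a * ‖z‖))) := by
          exact mul_le_mul_of_nonneg_left (hB _ (norm_nonneg z)) (by positivity)
      _ = _ := by ring
  rw [hasDerivAt_iff_isLittleO_nhds_zero]
  have hO : (fun w : ℂ => L (monoExp θ l (u + (0 + w) • v)) - L (monoExp θ l (u + (0 : ℂ) • v)) -
      w • L (monoExp θ (v :: l) u)) =O[𝓝 0] fun w : ℂ => w ^ 2 := by
    refine Asymptotics.IsBigO.of_bound (C * (‖toStep N p v‖ ^ 2 * P * B)) ?_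
    filter_upwards [Metric.closedBall_mem_nhds (0 : ℂ) one_pos] with w hw
    have hw1 : ‖w‖ ≤ 1 := by simpa using hw
    rw [zero_add, zero_smul, add_zero, ← map_sub, ← map_smul, ← map_sub, norm_pow]
    refine (hC _).trans ((mul_le_mul_of_nonneg_left (hrem w hw1) hC0).trans (le_of_eq ?_))
    ring
  refine hO.trans_isLittleO ?_
  exact Asymptotics.isLittleO_pow_id one_lt_two

theorem differentiable_expVec [IsGrowth θ] (L : StrongDual ℂ (TestSpace θ N)) (u v : N) :
    Differentiable ℂ fun w : ℂ => L (expVec θ (u + w • v)) := by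
  intro w₀
  have h1 := hasDerivAt_monoExp L [] (u + w₀ • v) v
  have h2 : HasDerivAt (fun w : ℂ => w - w₀) 1 w₀ := (hasDerivAt_id w₀).sub_const w₀
  have h3 := HasDerivAt.comp_of_eq w₀ h1 h2 (sub_self w₀).symm
  refine (h3.differentiableAt).congr_of_eventuallyEq (Eventually.of_forall fun w => ?_)
  simp only [Function.comp, monoExp_nil, sub_smul]
  congr 2
  abel

/-- A continuous functional that annihilates the exponential vectors annihilates the exponential
monomials. -/
theorem monoExp_eq_zero [IsGrowth θ] {L : StrongDual ℂ (TestSpace θ N)}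
    (hL : ∀ ξ, L (expVec θ ξ) = 0) (l : List N) (u : N) : L (monoExp θ l u) = 0 := by
  induction l generalizing u with
  | nil => rw [monoExp_nil]; exact hL u
  | cons v l ih =>
    have h := hasDerivAt_monoExp L l u v
    simp_rw [ih] at h
    exact h.unique (hasDerivAt_const 0 0)

end Monomials

/-! ### Nuclear expansion of test functions -/

section Expansion

variable (θ : ℝ → ℝ) (N : Type*) [AddCommGroup N] [Module ℂ N] [UniformSpace N]
  [NuclearHilbertian N]

/-- An absolutely convergent expansion `ξ = ∑ z_k(ξ) x_k` of the canonical map `N_{p'} → N_p`, with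
`x_k ∈ N` and `z_k ∈ N_{-p'}`; here `p'` is `idx`, `x_k` is `vec k` and `z_k` is `dual k`. -/
structure NuclearExpansion (p : ℕ) where
  idx : ℕ
  le : p ≤ idx
  vec : ℕ → N
  dual : ℕ → NegStep N idx
  summable : Summable fun k => ‖dual k‖ * ‖toStep N p (vec k)‖
  hasSum : ∀ ξ, HasSum (fun k => dual k (toStep N idx ξ) • toStep N p (vec k)) (toStep N p ξ)

theorem nonempty_nuclearExpansion (p : ℕ) : Nonempty (NuclearExpansion N p) := by
  obtain ⟨q, h, x, z, h1, h2⟩ := exists_nuclear_expansion N p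
  exact ⟨⟨q, h, x, z, h1, h2⟩⟩

variable {θ N}

namespace NuclearExpansion

variable {p : ℕ} (X : NuclearExpansion N p)

/-- The factors `|z_k|_{-p'} |x_k|_p` of the nuclear norm of the expansion. -/
def size (k : ℕ) : ℝ := ‖X.dual k‖ * ‖toStep N p (X.vec k)‖

theorem size_nonneg (k : ℕ) : 0 ≤ X.size k := by unfold size; positivity

/-- The nuclear norm of the expansion. -/
def total : ℝ := ∑' k, X.size k

theorem hasSum_size : HasSum X.size X.total := X.summable.hasSum

theorem total_nonneg : 0 ≤ X.total := tsum_nonneg X.size_nonneg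

theorem summable_transpose (z : NegStep N p) :
    Summable fun k => ‖z (toStep N p (X.vec k))‖ * ‖X.dual k‖ := by
  refine Summable.of_nonneg_of_le (fun k => by positivity) (fun k => ?_)
    (X.summable.mul_left ‖z‖)
  calc _ ≤ ‖z‖ * ‖toStep N p (X.vec k)‖ * ‖X.dual k‖ := by
        gcongr
        exact z.le_opNorm _
    _ = _ := by ring

/-- The transposed expansion: `z = ∑ z(x_k) z_k` in `N_{-p'}`, for `z ∈ N_{-p}`. -/
theorem hasSum_transpose (z : NegStep N p) :
    HasSum (fun k => z (toStep N p (X.vec k)) • X.dual k) (negMap N X.le z) := by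
  have hs : Summable fun k => z (toStep N p (X.vec k)) • X.dual k := by
    refine Summable.of_norm ?_
    simp_rw [norm_smul]
    exact X.summable_transpose z
  have h := hs.hasSum
  have heq : ∑' k, z (toStep N p (X.vec k)) • X.dual k = negMap N X.le z := by
    refine ContinuousLinearMap.ext fun ξ => ?_
    have h1 := h.mapL (ContinuousLinearMap.apply ℂ ℂ ξ)
    have h2 := (X.hasSum ξ).mapL z
    rw [negMap_apply]
    refine h1.unique (h2.congr_fun fun k => ?_)
    simp only [ContinuousLinearMap.apply_apply, map_smul, smul_eq_mul]
    exact mul_comm _ _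
  rwa [heq] at h

/-- The coefficient of a test function along a word: its Taylor coefficient in the directions of
the functionals `z_k`. -/
def coeff (w : Word) (f : TestSpace θ N) : ℂ :=
  taylorCoeff X.dual w fun z : NegStep N X.idx => f (negIncl N X.idx z)

theorem coeff_add [IsGrowth θ] (w : Word) (f g : TestSpace θ N) :
    X.coeff w (f + g) = X.coeff w f + X.coeff w g := by
  have := iterDeriv_add_fun (bddEntire_test f X.idx) (bddEntire_test g X.idx)
    (List.ofFn fun i => X.dual (w.2 i))
  rw [coeff, coeff, coeff, taylorCoeff, taylorCoeff, taylorCoeff, ← mul_add]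
  exact congrArg _ (congrFun this 0)

theorem coeff_smul [IsGrowth θ] (w : Word) (c : ℂ) (f : TestSpace θ N) :
    X.coeff w (c • f) = c * X.coeff w f := by
  have := iterDeriv_const_mul (bddEntire_test f X.idx) c (List.ofFn fun i => X.dual (w.2 i))
  rw [coeff, coeff, taylorCoeff, taylorCoeff, mul_left_comm]
  exact congrArg _ (congrFun this 0)

theorem coeff_expVec [IsGrowth θ] (w : Word) (ξ : N) :
    X.coeff w (expVec θ ξ) =
      ((w.1.factorial : ℝ) : ℂ)⁻¹ * ∏ i, X.dual (w.2 i) (toStep N X.idx ξ) := by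
  have := iterDeriv_exp_apply (toStep N X.idx ξ) (List.ofFn fun i => X.dual (w.2 i)) 0
  rw [List.map_ofFn, List.prod_ofFn, zero_apply, Complex.exp_zero, mul_one] at this
  rw [coeff, taylorCoeff]
  exact congrArg _ this

theorem norm_coeff_le [h : IsGrowth θ] (w : Word) (f : TestSpace θ N) {b ρ : ℝ} (hb : 0 < b)
    (hρ : 0 < ρ) :
    ‖X.coeff w f‖ ≤ tnorm θ N X.idx hb f * Real.exp (θ (b * ρ)) *
      (Real.exp (w.1 + 1) / ρ ^ w.1 * ∏ i, ‖X.dual (w.2 i)‖) := by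
  refine (bddEntire_test f X.idx).norm_taylorCoeff_le hρ (fun z hz => ?_) X.dual w
  refine (norm_le_tnorm f X.idx hb z).trans ?_
  refine mul_le_mul_of_nonneg_left (Real.exp_le_exp.2 ?_) (apply_nonneg _ _)
  exact h.mono (mem_Ici.2 (by positivity)) (mem_Ici.2 (by positivity)) (by gcongr)

/-- The monomial `z ↦ ∏ ⟨z, x_{w_i}⟩`. -/
def mono [IsGrowth θ] (w : Word) : TestSpace θ N := monoExp θ (List.ofFn fun i => X.vec (w.2 i)) 0

theorem mono_apply [IsGrowth θ] (w : Word) (z : NegStep N p) :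
    X.mono (θ := θ) w (negIncl N p z) = ∏ i, z (toStep N p (X.vec (w.2 i))) := by
  rw [mono, monoExp_apply, List.map_ofFn, List.prod_ofFn, map_zero, map_zero, Complex.exp_zero,
    mul_one]
  rfl

/-- The expansion of a test function into monomials, pointwise. -/
theorem hasSum_test [IsGrowth θ] (f : TestSpace θ N) (z : NegStep N p) :
    HasSum (fun w => (X.coeff w f • X.mono w : TestSpace θ N) (negIncl N p z))
      (f (negIncl N p z)) := by
  have h := (bddEntire_test f X.idx).hasSum_taylor (X.hasSum_transpose z) (X.summable_transpose z)
  rw [negIncl_negMap] at h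
  refine h.congr_fun fun w => ?_
  rw [test_smul_apply, mono_apply, mul_comm]
  rfl

/-- The terms of the expansion of `f`, measured by `‖·‖_{p, a}`, decay geometrically if `f` is
measured by `‖·‖_{p', b}` with `b` small.  The radius in Cauchy's estimate is adapted to the point
`z`, so that the growth factors of coefficient and monomial cancel. -/
theorem norm_term_le [IsGrowth θ] (f : TestSpace θ N) {a b : ℝ} (ha : 0 < a) (hb : 0 < b)
    (w : Word) (z : NegStep N p) :
    ‖(X.coeff w f • X.mono w : TestSpace θ N) (negIncl N p z)‖ ≤
      Real.exp 1 * tnorm θ N X.idx hb f *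
        ((Real.exp 1 * b / a) ^ w.1 * ∏ i, X.size (w.2 i)) * Real.exp (θ (a * ‖z‖)) := by
  have hnn : 0 ≤ tnorm θ N X.idx hb f := apply_nonneg _ _
  rw [test_smul_apply, mono_apply, norm_mul, norm_prod]
  have hprod : ∏ i, ‖z (toStep N p (X.vec (w.2 i)))‖ ≤
      ‖z‖ ^ w.1 * ∏ i, ‖toStep N p (X.vec (w.2 i))‖ := by
    refine (Finset.prod_le_prod (fun i _ => norm_nonneg _) fun i _ => z.le_opNorm _).trans_eq ?_
    rw [Finset.prod_mul_distrib, Finset.prod_const, Finset.card_univ, Fintype.card_fin]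
  have hsz : ∏ i, X.size (w.2 i) =
      (∏ i, ‖X.dual (w.2 i)‖) * ∏ i, ‖toStep N p (X.vec (w.2 i))‖ := by
    simp [size, Finset.prod_mul_distrib]
  have hexp : Real.exp ((w.1 : ℝ) + 1) = Real.exp 1 ^ w.1 * Real.exp 1 := by
    rw [Real.exp_add, ← Real.exp_nat_mul, mul_one]
  rcases eq_or_ne z 0 with rfl | hz
  · rcases w with ⟨n, j⟩
    cases n with
    | zero =>
      have h1 : X.coeff ⟨0, j⟩ f = f (negIncl N X.idx 0) := by
        simp [coeff, taylorCoeff, iterDeriv]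
      have h2 := norm_le_tnorm f X.idx hb 0
      have h3 : (1 : ℝ) ≤ Real.exp 1 := Real.one_le_exp zero_le_one
      simp only [h1, norm_zero, mul_zero] at h2 ⊢
      simp only [Finset.univ_eq_empty, Finset.prod_empty, mul_one, pow_zero]
      refine h2.trans ?_
      gcongr
      exact le_mul_of_one_le_left hnn h3
    | succ n =>
      have : ∏ i, ‖(0 : NegStep N p) (toStep N p (X.vec (j i)))‖ = 0 :=
        Finset.prod_eq_zero (Finset.mem_univ 0) (by simp)
      rw [this, mul_zero]
      have := Finset.prod_nonneg fun (i : Fin (n + 1)) (_ : i ∈ Finset.univ) => X.size_nonneg (j i)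
      positivity
  · have hz0 : 0 < ‖z‖ := norm_pos_iff.2 hz
    have h1 := X.norm_coeff_le w f hb (ρ := a * ‖z‖ / b) (by positivity)
    rw [mul_div_cancel₀ _ hb.ne'] at h1
    rw [hexp] at h1
    rw [hsz]
    have hA : 0 ≤ ∏ i, ‖X.dual (w.2 i)‖ := Finset.prod_nonneg fun i _ => norm_nonneg _
    have hB : 0 ≤ ∏ i, ‖z (toStep N p (X.vec (w.2 i)))‖ :=
      Finset.prod_nonneg fun i _ => norm_nonneg _
    generalize ∏ i, ‖X.dual (w.2 i)‖ = A at *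
    generalize ∏ i, ‖toStep N p (X.vec (w.2 i))‖ = B at *
    generalize ∏ i, ‖z (toStep N p (X.vec (w.2 i)))‖ = D at *
    generalize tnorm θ N X.idx hb f = T at *
    clear hexp hsz
    generalize ‖X.coeff w f‖ = c at *
    generalize w.1 = n at *
    generalize ‖z‖ = r at *
    calc c * D ≤ (T * Real.exp (θ (a * r)) *
          (Real.exp 1 ^ n * Real.exp 1 / (a * r / b) ^ n * A)) * (r ^ n * B) :=
          mul_le_mul h1 hprod hB (by positivity)
      _ = _ := by
          rw [div_pow, mul_pow, div_pow, mul_pow]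
          field_simp

/-- The expansion `f = ∑ K_w(f) m_w` into monomials may be evaluated termwise under a continuous
functional. -/
theorem hasSum_apply [IsGrowth θ] {L : StrongDual ℂ (TestSpace θ N)} {a : ℝ} (ha : 0 < a) {C : ℝ}
    (hC0 : 0 ≤ C) (hC : ∀ f, ‖L f‖ ≤ C * tnorm θ N p ha f) (f : TestSpace θ N) :
    HasSum (fun w => X.coeff w f * L (X.mono w)) (L f) := by
  have hT := X.total_nonneg
  set b := a / (2 * Real.exp 1 * (X.total + 1)) with hbdef
  have hb : 0 < b := by positivity
  set bound : Word → ℝ := fun w => (Real.exp 1 * b / a) ^ w.1 * ∏ i, X.size (w.2 i) with hbound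
  have hsum : Summable bound := by
    refine summable_word X.size_nonneg X.hasSum_size (by positivity) ?_
    have : Real.exp 1 * b / a * X.total = X.total / (2 * (X.total + 1)) := by
      rw [hbdef]; field_simp
    rw [this, div_lt_one (by positivity)]
    linarith
  have hbound0 : ∀ w, 0 ≤ bound w := fun w =>
    mul_nonneg (by positivity) (Finset.prod_nonneg fun i _ => X.size_nonneg _)
  set K := Real.exp 1 * tnorm θ N X.idx hb f
  have hdiff : ∀ s : Finset Word, tnorm θ N p ha (f - ∑ w ∈ s, X.coeff w f • X.mono w) ≤
      K * ∑' w : {w // w ∉ s}, bound w := fun s => by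
    refine tnorm_le _ p ha fun z => ?_
    set g : Word → ℂ := fun w => (X.coeff w f • X.mono w : TestSpace θ N) (negIncl N p z)
    have h1 : HasSum g (f (negIncl N p z)) := X.hasSum_test f z
    have h2 : HasSum (fun w : {w // w ∉ s} => g w) (f (negIncl N p z) - ∑ w ∈ s, g w) :=
      (Finset.hasSum_compl_iff s).2 (by rwa [sub_add_cancel])
    rw [test_sub_apply, test_sum_apply, ← h2.tsum_eq]
    have h3 : HasSum (fun w : {w // w ∉ s} => K * bound w * Real.exp (θ (a * ‖z‖)))
        (K * (∑' w : {w // w ∉ s}, bound w) * Real.exp (θ (a * ‖z‖))) :=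
      ((hsum.subtype {w | w ∉ s}).hasSum.mul_left K).mul_right _
    exact tsum_of_norm_bounded h3 fun w => X.norm_term_le f ha hb w z
  have htail := ((tendsto_tsum_compl_atTop_zero bound).const_mul K).const_mul C
  rw [mul_zero, mul_zero] at htail
  have h1 : Tendsto (fun s : Finset Word => L f - ∑ w ∈ s, X.coeff w f * L (X.mono w)) atTop
      (𝓝 0) := by
    refine squeeze_zero_norm (fun s => ?_) htail
    have h2 : L f - ∑ w ∈ s, X.coeff w f * L (X.mono w) =
        L (f - ∑ w ∈ s, X.coeff w f • X.mono w) := by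
      simp [map_sub, map_sum]
    rw [h2]
    exact (hC _).trans (mul_le_mul_of_nonneg_left (hdiff s) hC0)
  have h3 := h1.const_sub (L f)
  simp only [sub_sub_cancel, sub_zero] at h3
  exact h3

end NuclearExpansion

/-- The exponential vectors are total in the space of test functions: monomials are derivatives of
exponentials, and test functions are limits of linear combinations of monomials. -/
theorem functional_eq_zero [IsGrowth θ] {L : StrongDual ℂ (TestSpace θ N)}
    (hL : ∀ ξ, L (expVec θ ξ) = 0) (f : TestSpace θ N) : L f = 0 := by
  obtain ⟨p, a, ha, C, hC0, hC⟩ := exists_tnorm_bound L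
  obtain ⟨X⟩ := nonempty_nuclearExpansion N p
  have h := X.hasSum_apply ha hC0 hC f
  simp_rw [fun w => show L (X.mono w) = 0 from monoExp_eq_zero hL _ _, mul_zero] at h
  exact h.unique hasSum_zero

end Expansion

/-! ### The kernel theorem: operators from symbols -/

section Weights

variable {θ : ℝ → ℝ} {N : Type*} [AddCommGroup N] [Module ℂ N] [UniformSpace N]
  [NuclearHilbertian N]

/-- The vectors `x_{w_1}, …, x_{w_n}` of a nuclear expansion along a word, in `N_p`. -/
def NuclearExpansion.vecs {p : ℕ} (X : NuclearExpansion N p) (w : Word) : List (Step N p) :=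
  List.ofFn fun i => toStep N p (X.vec (w.2 i))

/-- Weights `ω` dominating the mixed derivatives at `0` of every entire function on `N_p` of growth
`e^{θ*(a |·|_p)}`, whose products with the coefficients of a test function are dominated by a
summable family `σ` times a norm `‖·‖_{p', b}` of the test function. -/
structure DualWeights (θ : ℝ → ℝ) {p : ℕ} (X : NuclearExpansion N p) (a : ℝ) where
  ω : Word → ℝ
  σ : Word → ℝ
  b : ℝ
  b_pos : 0 < b
  ω_nonneg : ∀ w, 0 ≤ ω w
  σ_nonneg : ∀ w, 0 ≤ σ w
  summable : Summable σ
  coeff_le : ∀ w (f : TestSpace θ N), ω w * ‖X.coeff w f‖ ≤ σ w * tnorm θ N X.idx b_pos f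
  deriv_le : ∀ {G : Step N p → ℂ} {M : ℝ}, BddEntire G → 0 ≤ M →
    (∀ x, ‖G x‖ ≤ M * Real.exp (conj θ (a * ‖x‖))) → ∀ w, ‖iterDeriv (X.vecs w) G 0‖ ≤ M * ω w

/-- For derivatives of order `n`, the radii in the Cauchy estimates for functions on `N_p` and for
test functions are multiples of the dual radii `s` and `t` of order `n`.  As `s t` is of order `n`,
the factor `(n + 1) ^ n` is compensated, and what is left over is geometric with a ratio
proportional to `b`. -/
theorem NuclearExpansion.nonempty_dualWeights [IsGrowth θ] [StarShaped θ] {p : ℕ}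
    (X : NuclearExpansion N p) {a : ℝ} (ha : 0 < a) : Nonempty (DualWeights θ X a) := by
  choose t s ht hs hθ hconj hst using fun n : ℕ => exists_dual_radii (θ := θ) n
  have hT := X.total_nonneg
  set b := 1 / (4 * a * Real.exp 3 * (X.total + 1)) with hbdef
  have hb : 0 < b := by positivity
  set q := 2 * a * b * Real.exp 3 with hq
  have hq0 : 0 ≤ q := by positivity
  refine ⟨⟨fun w => ((w.1 : ℝ) + 1) ^ w.1 * (a / s w.1) ^ w.1 * Real.exp (w.1 + 1 - θ 0) *
      ∏ i, ‖toStep N p (X.vec (w.2 i))‖,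
    fun w => Real.exp (3 - θ 0) * (q ^ w.1 * ∏ i, X.size (w.2 i)), b, hb, fun w => ?_, fun w => ?_,
    ?_, fun w f => ?_, fun {G M} hG hM0 hM w => ?_⟩⟩
  · have := hs w.1
    have := Finset.prod_nonneg fun (i : Fin w.1) (_ : i ∈ Finset.univ) =>
      norm_nonneg (toStep N p (X.vec (w.2 i)))
    positivity
  · have := Finset.prod_nonneg fun (i : Fin w.1) (_ : i ∈ Finset.univ) => X.size_nonneg (w.2 i)
    positivity
  · refine (summable_word X.size_nonneg X.hasSum_size hq0 ?_).mul_left _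
    have : q * X.total = X.total / (2 * (X.total + 1)) := by
      rw [hq, hbdef]; field_simp; norm_num
    rw [this, div_lt_one (by positivity)]
    linarith
  · have h1 := X.norm_coeff_le w f hb (ρ := t w.1 / b) (div_pos (ht _) hb)
    rw [mul_div_cancel₀ _ hb.ne'] at h1
    have hsz : ∏ i, X.size (w.2 i) =
        (∏ i, ‖X.dual (w.2 i)‖) * ∏ i, ‖toStep N p (X.vec (w.2 i))‖ := by
      simp [NuclearExpansion.size, Finset.prod_mul_distrib]
    rw [hsz]
    have hA : 0 ≤ ∏ i, ‖X.dual (w.2 i)‖ := Finset.prod_nonneg fun i _ => norm_nonneg _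
    have hB : 0 ≤ ∏ i, ‖toStep N p (X.vec (w.2 i))‖ :=
      Finset.prod_nonneg fun i _ => norm_nonneg _
    have hnn : 0 ≤ tnorm θ N X.idx hb f := apply_nonneg _ _
    clear hsz
    generalize ∏ i, ‖X.dual (w.2 i)‖ = A at *
    generalize ∏ i, ‖toStep N p (X.vec (w.2 i))‖ = B at *
    generalize tnorm θ N X.idx hb f = T at *
    generalize ‖X.coeff w f‖ = c at *
    generalize w.1 = n at *
    have h2 := Real.exp_le_exp.2 (hθ n)
    have hs0 := hs n
    have ht0 := ht n
    have hst' : s n = (n + 1) / 2 / t n := by rw [eq_div_iff ht0.ne']; exact hst n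
    have he : Real.exp ((n : ℝ) + 1 - θ 0) * (Real.exp (n + 1) * Real.exp (n + 1)) =
        Real.exp (3 - θ 0) * Real.exp 3 ^ n := by
      rw [← Real.exp_add, ← Real.exp_add, ← Real.exp_nat_mul, ← Real.exp_add]
      congr 1; ring
    have hpow : ((n : ℝ) + 1) ^ n * (a / s n) ^ n * ((t n / b) ^ n)⁻¹ = (2 * a * b) ^ n := by
      rw [hst', ← mul_pow, ← inv_pow, ← mul_pow]
      congr 1
      field_simp
    calc _ ≤ ((n : ℝ) + 1) ^ n * (a / s n) ^ n * Real.exp (n + 1 - θ 0) * B *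
          (T * Real.exp (n + 1) * (Real.exp (n + 1) / (t n / b) ^ n * A)) := by
          refine mul_le_mul_of_nonneg_left (h1.trans ?_) (by positivity)
          gcongr
      _ = (((n : ℝ) + 1) ^ n * (a / s n) ^ n * ((t n / b) ^ n)⁻¹) *
          (Real.exp (n + 1 - θ 0) * (Real.exp (n + 1) * Real.exp (n + 1))) * (A * B) * T := by
          ring
      _ = _ := by rw [he, hpow, hq, mul_pow _ (Real.exp 3)]; ring
  · have hs0 := hs w.1
    have h1 := hG.norm_iterDeriv_zero_le (ρ := s w.1 / a) (M := M * Real.exp (w.1 + 1 - θ 0))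
      (by positivity) (fun x hx => (hM x).trans (by
        refine mul_le_mul_of_nonneg_left (Real.exp_le_exp.2 (le_trans ?_ (hconj w.1))) hM0
        refine conj_mono (by positivity) ?_
        rwa [le_div_iff₀' ha] at hx)) (fun k => toStep N p (X.vec k)) w.2
    refine h1.trans (le_of_eq ?_)
    rw [div_pow, div_pow]
    field_simp

end Weights

section Operators

variable {θ₁ θ₂ : ℝ → ℝ} {N₁ N₂ : Type*} [AddCommGroup N₁] [Module ℂ N₁] [UniformSpace N₁]
  [NuclearHilbertian N₁] [AddCommGroup N₂] [Module ℂ N₂] [UniformSpace N₂] [NuclearHilbertian N₂]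

/-- A bilinear form on test functions that is bounded by a product of norms is an operator into
the strong dual. -/
theorem exists_op_of_form (B : TestSpace θ₁ N₁ →ₗ[ℂ] TestSpace θ₂ N₂ →ₗ[ℂ] ℂ) {p q : ℕ} {a b C : ℝ}
    (ha : 0 < a) (hb : 0 < b)
    (hB : ∀ f g, ‖B f g‖ ≤ C * tnorm θ₁ N₁ p ha f * tnorm θ₂ N₂ q hb g) :
    ∃ Ξ : Op θ₁ θ₂ N₁ N₂, ∀ f g, Ξ f g = B f g := by
  have hcont : ∀ f, Continuous (B f) := fun f => by
    refine WithSeminorms.continuous_normedSpace_rng ℂ (testSpace_withSeminorms θ₂ N₂) (B f)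
      ⟨{(q, ⟨b, hb⟩)}, (C * tnorm θ₁ N₁ p ha f).toNNReal, fun g => ?_⟩
    rw [Finset.sup_singleton]
    refine (hB f g).trans ?_
    exact mul_le_mul_of_nonneg_right (Real.le_coe_toNNReal _) (apply_nonneg _ _)
  let T : TestSpace θ₁ N₁ →ₗ[ℂ] StrongDual ℂ (TestSpace θ₂ N₂) :=
    { toFun := fun f => ⟨B f, hcont f⟩
      map_add' := fun f f' => ContinuousLinearMap.ext fun g => by simp
      map_smul' := fun c f => ContinuousLinearMap.ext fun g => by simp }
  refine ⟨⟨T, ?_⟩, fun f g => rfl⟩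
  refine continuous_of_continuousAt_zero T ?_
  rw [ContinuousAt, map_zero,
    (ContinuousLinearMap.hasBasis_nhds_zero_of_basis
      Metric.nhds_basis_closedBall).tendsto_right_iff]
  rintro ⟨S, ε⟩ ⟨hS, hε⟩
  obtain ⟨r, hr, hSr⟩ := (testSpace_withSeminorms θ₂ N₂).isVonNBounded_iff_seminorm_bounded.1 hS
    (q, ⟨b, hb⟩)
  have hc : Continuous fun f => |C| * r * tnorm θ₁ N₁ p ha f :=
    continuous_const.mul ((testSpace_withSeminorms θ₁ N₁).continuous_seminorm (p, ⟨a, ha⟩))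
  have hlim := hc.tendsto 0
  rw [map_zero, mul_zero] at hlim
  filter_upwards [hlim.eventually_le_const hε] with f hf g hg
  rw [mem_closedBall_zero_iff]
  refine (hB f g).trans (le_trans ?_ hf)
  have h1 : C * tnorm θ₁ N₁ p ha f ≤ |C| * tnorm θ₁ N₁ p ha f :=
    mul_le_mul_of_nonneg_right (le_abs_self C) (apply_nonneg _ _)
  have h2 : tnorm θ₂ N₂ q hb g ≤ r := (hSr g hg).le
  calc _ ≤ |C| * tnorm θ₁ N₁ p ha f * r :=
        mul_le_mul h1 h2 (apply_nonneg _ _) (mul_nonneg (abs_nonneg _) (apply_nonneg _ _))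
    _ = _ := by ring

/-- Evaluation at `x` of continuous linear maps between topological vector spaces, as a
continuous linear map for the topology of bounded convergence. -/
def evalAt {E F : Type*} [AddCommGroup E] [Module ℂ E] [TopologicalSpace E] [ContinuousSMul ℂ E]
    [AddCommGroup F] [Module ℂ F] [TopologicalSpace F] [IsTopologicalAddGroup F]
    [ContinuousSMul ℂ F] (x : E) : (E →L[ℂ] F) →L[ℂ] F where
  toFun := fun A => A x
  map_add' := fun _ _ => rfl
  map_smul' := fun _ _ => rfl
  cont := continuous_eval_const x

/-- Convergence to `0` in the topology of bounded convergence. -/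
theorem tendsto_op_zero {ι : Type*} {l : Filter ι} {Ξ : ι → Op θ₁ θ₂ N₁ N₂}
    (h : ∀ S₁ : Set (TestSpace θ₁ N₁), Bornology.IsVonNBounded ℂ S₁ →
      ∀ S₂ : Set (TestSpace θ₂ N₂), Bornology.IsVonNBounded ℂ S₂ →
      ∀ ε > 0, ∀ᶠ i in l, ∀ f ∈ S₁, ∀ g ∈ S₂, ‖Ξ i f g‖ ≤ ε) :
    Tendsto Ξ l (𝓝 0) := by
  rw [(ContinuousLinearMap.hasBasis_nhds_zero_of_basis
    (ContinuousLinearMap.hasBasis_nhds_zero_of_basis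
      Metric.nhds_basis_closedBall)).tendsto_right_iff]
  rintro ⟨S₁, S₂, ε⟩ ⟨h₁, h₂, hε⟩
  filter_upwards [h S₁ h₁ S₂ h₂ ε hε] with i hi f hf g hg
  exact mem_closedBall_zero_iff.2 (hi f hf g hg)

/-- A compact set of operators is bounded on bounded sets of test functions. -/
theorem exists_bound_of_isCompact {K : Set (Op θ₁ θ₂ N₁ N₂)} (hK : IsCompact K)
    {S₁ : Set (TestSpace θ₁ N₁)} (h₁ : Bornology.IsVonNBounded ℂ S₁)
    {S₂ : Set (TestSpace θ₂ N₂)} (h₂ : Bornology.IsVonNBounded ℂ S₂) :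
    ∃ R, ∀ Ξ ∈ K, ∀ f ∈ S₁, ∀ g ∈ S₂, ‖Ξ f g‖ ≤ R := by
  have h3 := ContinuousLinearMap.isVonNBounded_iff.1 (hK.isVonNBounded ℂ) S₁ h₁
  have h4 := ContinuousLinearMap.isVonNBounded_iff.1 h3 S₂ h₂
  rw [NormedSpace.isVonNBounded_iff, isBounded_iff_forall_norm_le] at h4
  obtain ⟨R, hR⟩ := h4
  exact ⟨R, fun Ξ hΞ f hf g hg => hR _ ⟨Ξ f, ⟨Ξ, hΞ, f, hf, rfl⟩, g, hg, rfl⟩⟩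

end Operators

section Kernel

variable {θ₁ θ₂ : ℝ → ℝ} {N₁ N₂ : Type*} [AddCommGroup N₁] [Module ℂ N₁] [UniformSpace N₁]
  [NuclearHilbertian N₁] [AddCommGroup N₂] [Module ℂ N₂] [UniformSpace N₂] [NuclearHilbertian N₂]

/-- The inverse of `toStep N p`, which is linear but not continuous. -/
def ofStep (N : Type*) [AddCommGroup N] [Module ℂ N] [UniformSpace N] [NuclearHilbertian N]
    (p : ℕ) : Step N p →ₗ[ℂ] N where
  toFun := fun x => x
  map_add' := fun _ _ => rfl
  map_smul' := fun _ _ => rfl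

theorem toStep_ofStep (p : ℕ) (x : Step N₁ p) : toStep N₁ p (ofStep N₁ p x) = x := rfl

/-- Separate holomorphy, along complex lines, of a function of two variables. -/
structure SepEntire {N₁ N₂ : Type*} [AddCommGroup N₁] [Module ℂ N₁] [AddCommGroup N₂] [Module ℂ N₂]
    (F : N₁ → N₂ → ℂ) : Prop where
  left : ∀ η u v, Differentiable ℂ fun w : ℂ => F (u + w • v) η
  right : ∀ ξ u v, Differentiable ℂ fun w : ℂ => F ξ (u + w • v)

/-- The growth of the symbols of operators: `|F(ξ, η)| ≤ C e^{θ₁*(a |ξ|_p) + θ₂*(a |η|_p)}`. -/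
def SymBound (θ₁ θ₂ : ℝ → ℝ) (p : ℕ) (a C : ℝ) (F : N₁ → N₂ → ℂ) : Prop :=
  ∀ ξ η, ‖F ξ η‖ ≤
    C * Real.exp (conj θ₁ (a * ‖toStep N₁ p ξ‖) + conj θ₂ (a * ‖toStep N₂ p η‖))

section Coefficients

theorem SymBound.norm_left_le {p : ℕ} {a C : ℝ} {F : N₁ → N₂ → ℂ}
    (hF : SymBound θ₁ θ₂ p a C F) (x : Step N₁ p) (y : Step N₂ p) :
    ‖F (ofStep N₁ p x) (ofStep N₂ p y)‖ ≤
      C * Real.exp (conj θ₂ (a * ‖y‖)) * Real.exp (conj θ₁ (a * ‖x‖)) := by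
  refine (hF _ _).trans (le_of_eq ?_)
  rw [toStep_ofStep, toStep_ofStep, Real.exp_add]
  ring

variable [IsGrowth θ₁] [IsGrowth θ₂] {p : ℕ} {a C : ℝ} {F : N₁ → N₂ → ℂ}

theorem SymBound.norm_le_of_le (ha : 0 ≤ a) (hC : 0 ≤ C) (hF : SymBound θ₁ θ₂ p a C F) {R S : ℝ}
    {x : Step N₁ p} (hx : ‖x‖ ≤ R) {y : Step N₂ p} (hy : ‖y‖ ≤ S) :
    ‖F (ofStep N₁ p x) (ofStep N₂ p y)‖ ≤
      C * Real.exp (conj θ₂ (a * S)) * Real.exp (conj θ₁ (a * R)) := by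
  refine (hF.norm_left_le x y).trans ?_
  have h1 : conj θ₂ (a * ‖y‖) ≤ conj θ₂ (a * S) := conj_mono (by positivity) (by gcongr)
  have h2 : conj θ₁ (a * ‖x‖) ≤ conj θ₁ (a * R) := conj_mono (by positivity) (by gcongr)
  gcongr

theorem SepEntire.bddEntire_left (hs : SepEntire F) (ha : 0 ≤ a) (hC : 0 ≤ C)
    (hF : SymBound θ₁ θ₂ p a C F) (y : Step N₂ p) :
    BddEntire fun x => F (ofStep N₁ p x) (ofStep N₂ p y) where
  line u v := by
    simp_rw [map_add, map_smul]
    exact hs.left _ _ _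
  bdd R := ⟨_, fun _ hx => hF.norm_le_of_le ha hC hx le_rfl⟩

/-- The mixed derivative at `0` of `F` in the first variable along the word `w`, as a function of
the second variable. -/
def partialCoef (X : NuclearExpansion N₁ p) (F : N₁ → N₂ → ℂ) (w : Word) (y : Step N₂ p) : ℂ :=
  iterDeriv (X.vecs w) (fun x => F (ofStep N₁ p x) (ofStep N₂ p y)) 0

/-- The mixed derivative at `0` of `F` along a pair of words. -/
def mixedCoef (X : NuclearExpansion N₁ p) (Y : NuclearExpansion N₂ p) (F : N₁ → N₂ → ℂ)
    (w : Word × Word) : ℂ :=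
  iterDeriv (Y.vecs w.2) (partialCoef X F w.1) 0

variable {X : NuclearExpansion N₁ p} {Y : NuclearExpansion N₂ p}

theorem norm_partialCoef_le (V : DualWeights θ₁ X a) (hs : SepEntire F) (ha : 0 ≤ a) (hC : 0 ≤ C)
    (hF : SymBound θ₁ θ₂ p a C F) (w : Word) (y : Step N₂ p) :
    ‖partialCoef X F w y‖ ≤ C * V.ω w * Real.exp (conj θ₂ (a * ‖y‖)) := by
  refine (V.deriv_le (hs.bddEntire_left ha hC hF y) (M := C * Real.exp (conj θ₂ (a * ‖y‖)))
    (by positivity) (fun x => hF.norm_left_le x y) w).trans (le_of_eq ?_)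
  ring

theorem norm_partialCoef_le_of_le (V : DualWeights θ₁ X a) (hs : SepEntire F) (ha : 0 ≤ a)
    (hC : 0 ≤ C) (hF : SymBound θ₁ θ₂ p a C F) (w : Word) {R : ℝ} {y : Step N₂ p} (hy : ‖y‖ ≤ R) :
    ‖partialCoef X F w y‖ ≤ C * V.ω w * Real.exp (conj θ₂ (a * R)) := by
  refine (norm_partialCoef_le V hs ha hC hF w y).trans ?_
  have := V.ω_nonneg w
  have : conj θ₂ (a * ‖y‖) ≤ conj θ₂ (a * R) := conj_mono (by positivity) (by gcongr)
  gcongr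

theorem bddEntire_partialCoef (V : DualWeights θ₁ X a) (hs : SepEntire F) (ha : 0 ≤ a)
    (hC : 0 ≤ C) (hF : SymBound θ₁ θ₂ p a C F) (w : Word) : BddEntire (partialCoef X F w) where
  line u v := by
    refine differentiable_iterDeriv_param
      (G := fun (t : ℂ) x => F (ofStep N₁ p x) (ofStep N₂ p (u + t • v)))
      (fun t => hs.bddEntire_left ha hC hF _) (fun x => ?_) (fun R => ?_) (X.vecs w) 0
    · simp_rw [map_add, map_smul]
      exact hs.right _ _ _
    · refine ⟨_, fun t ht x hx => hF.norm_le_of_le ha hC hx (S := ‖u‖ + R * ‖v‖) ?_⟩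
      refine (norm_add_le _ _).trans ?_
      rw [norm_smul]
      gcongr
  bdd R := ⟨_, fun _ hy => norm_partialCoef_le_of_le V hs ha hC hF w hy⟩

theorem norm_mixedCoef_le (V : DualWeights θ₁ X a) (W : DualWeights θ₂ Y a) (hs : SepEntire F)
    (ha : 0 ≤ a) (hC : 0 ≤ C) (hF : SymBound θ₁ θ₂ p a C F) (w : Word × Word) :
    ‖mixedCoef X Y F w‖ ≤ C * (V.ω w.1 * W.ω w.2) := by
  have := V.ω_nonneg w.1
  refine (W.deriv_le (bddEntire_partialCoef V hs ha hC hF w.1) (by positivity)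
    (norm_partialCoef_le V hs ha hC hF w.1) w.2).trans (le_of_eq ?_)
  ring

theorem NuclearExpansion.summable_dual_apply (X : NuclearExpansion N₁ p) (ξ : N₁) :
    Summable fun k => ‖X.dual k (toStep N₁ X.idx ξ)‖ * ‖toStep N₁ p (X.vec k)‖ := by
  refine Summable.of_nonneg_of_le (fun k => by positivity) (fun k => ?_)
    (X.summable.mul_left ‖toStep N₁ X.idx ξ‖)
  calc _ ≤ ‖X.dual k‖ * ‖toStep N₁ X.idx ξ‖ * ‖toStep N₁ p (X.vec k)‖ := by
        gcongr
        exact (X.dual k).le_opNorm _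
    _ = _ := by ring

/-- The Taylor expansion of an entire function on `N_p`, in terms of the coefficients of
exponentials. -/
theorem NuclearExpansion.hasSum_deriv_mul_coeff (X : NuclearExpansion N₁ p) {G : Step N₁ p → ℂ}
    (hG : BddEntire G) (ξ : N₁) :
    HasSum (fun w => iterDeriv (X.vecs w) G 0 * X.coeff w (expVec θ₁ ξ)) (G (toStep N₁ p ξ)) := by
  refine (hG.hasSum_taylor (X.hasSum ξ) (X.summable_dual_apply ξ)).congr_fun fun w => ?_
  rw [coeff_expVec, taylorCoeff, NuclearExpansion.vecs]
  ring

theorem summable_formTerm (V : DualWeights θ₁ X a) (W : DualWeights θ₂ Y a) (hs : SepEntire F)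
    (ha : 0 ≤ a) (hC : 0 ≤ C) (hF : SymBound θ₁ θ₂ p a C F) (f : TestSpace θ₁ N₁)
    (g : TestSpace θ₂ N₂) :
    Summable (fun w : Word × Word =>
      mixedCoef X Y F w * (X.coeff w.1 f * Y.coeff w.2 g)) ∧
    ‖∑' w : Word × Word, mixedCoef X Y F w * (X.coeff w.1 f * Y.coeff w.2 g)‖ ≤
      C * (∑' w : Word × Word, V.σ w.1 * W.σ w.2) * tnorm θ₁ N₁ X.idx V.b_pos f *
        tnorm θ₂ N₂ Y.idx W.b_pos g := by
  have hσ : Summable fun w : Word × Word => V.σ w.1 * W.σ w.2 :=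
    V.summable.mul_of_nonneg W.summable V.σ_nonneg W.σ_nonneg
  have hb : ∀ w : Word × Word, ‖mixedCoef X Y F w * (X.coeff w.1 f * Y.coeff w.2 g)‖ ≤
      C * tnorm θ₁ N₁ X.idx V.b_pos f * tnorm θ₂ N₂ Y.idx W.b_pos g *
        (V.σ w.1 * W.σ w.2) := fun w => by
    rw [norm_mul, norm_mul]
    have h1 := norm_mixedCoef_le V W hs ha hC hF w
    have h2 := V.coeff_le w.1 f
    have h3 := W.coeff_le w.2 g
    have h4 := mul_nonneg (V.σ_nonneg w.1) (apply_nonneg (tnorm θ₁ N₁ X.idx V.b_pos) f)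
    have h5 := mul_nonneg (W.ω_nonneg w.2) (norm_nonneg (Y.coeff w.2 g))
    calc _ ≤ C * (V.ω w.1 * W.ω w.2) * (‖X.coeff w.1 f‖ * ‖Y.coeff w.2 g‖) := by gcongr
      _ = C * ((V.ω w.1 * ‖X.coeff w.1 f‖) * (W.ω w.2 * ‖Y.coeff w.2 g‖)) := by ring
      _ ≤ C * ((V.σ w.1 * tnorm θ₁ N₁ X.idx V.b_pos f) *
          (W.σ w.2 * tnorm θ₂ N₂ Y.idx W.b_pos g)) := by gcongr
      _ = _ := by ring
  have hsum := hσ.mul_left (C * tnorm θ₁ N₁ X.idx V.b_pos f * tnorm θ₂ N₂ Y.idx W.b_pos g)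
  refine ⟨Summable.of_norm_bounded hsum hb, (tsum_of_norm_bounded hsum.hasSum hb).trans
    (le_of_eq ?_)⟩
  rw [tsum_mul_left]
  ring

/-- A separately entire function of the growth `SymBound` is the symbol of an operator, given by
the pairing of mixed derivatives with the coefficients of test functions. -/
theorem exists_op_hasSum (V : DualWeights θ₁ X a) (W : DualWeights θ₂ Y a) (hs : SepEntire F)
    (ha : 0 ≤ a) (hC : 0 ≤ C) (hF : SymBound θ₁ θ₂ p a C F) :
    ∃ Ξ : Op θ₁ θ₂ N₁ N₂, symbol Ξ = F ∧ ∀ f g, HasSum (fun w : Word × Word =>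
      mixedCoef X Y F w * (X.coeff w.1 f * Y.coeff w.2 g)) (Ξ f g) := by
  have hsum := fun f g => (summable_formTerm V W hs ha hC hF f g).1
  let B : TestSpace θ₁ N₁ →ₗ[ℂ] TestSpace θ₂ N₂ →ₗ[ℂ] ℂ := LinearMap.mk₂ ℂ
    (fun f g => ∑' w : Word × Word, mixedCoef X Y F w * (X.coeff w.1 f * Y.coeff w.2 g))
    (fun f f' g => by
      rw [← (hsum f g).tsum_add (hsum f' g)]
      exact tsum_congr fun w => by rw [NuclearExpansion.coeff_add]; ring)
    (fun c f g => by
      rw [smul_eq_mul, ← tsum_mul_left]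
      exact tsum_congr fun w => by rw [NuclearExpansion.coeff_smul]; ring)
    (fun f g g' => by
      rw [← (hsum f g).tsum_add (hsum f g')]
      exact tsum_congr fun w => by rw [NuclearExpansion.coeff_add]; ring)
    (fun c f g => by
      rw [smul_eq_mul, ← tsum_mul_left]
      exact tsum_congr fun w => by rw [NuclearExpansion.coeff_smul]; ring)
  obtain ⟨Ξ, hΞ⟩ := exists_op_of_form B V.b_pos W.b_pos
    fun f g => (summable_formTerm V W hs ha hC hF f g).2
  have hΞsum : ∀ f g, HasSum (fun w : Word × Word =>
      mixedCoef X Y F w * (X.coeff w.1 f * Y.coeff w.2 g)) (Ξ f g) := fun f g => by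
    rw [hΞ]
    exact (hsum f g).hasSum
  refine ⟨Ξ, ?_, hΞsum⟩
  funext ξ η
  have h1 := (hΞsum (expVec θ₁ ξ) (expVec θ₂ η)).prod_fiberwise fun w =>
    (((Y.hasSum_deriv_mul_coeff (θ₁ := θ₂) (bddEntire_partialCoef V hs ha hC hF w) η).mul_left
      (X.coeff w (expVec θ₁ ξ))).congr_fun fun w' => by rw [mixedCoef]; ring)
  have h2 := X.hasSum_deriv_mul_coeff (θ₁ := θ₁)
    (hs.bddEntire_left ha hC hF (toStep N₂ p η)) ξ
  refine h1.unique (h2.congr_fun fun w => ?_)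
  rw [mul_comm]
  rfl

end Coefficients

/-! ### Operators are determined by their symbols -/

section Uniqueness

variable [IsGrowth θ₁] [IsGrowth θ₂]

theorem op_ext {A B : Op θ₁ θ₂ N₁ N₂} (h : ∀ ξ η, symbol A ξ η = symbol B ξ η) : A = B := by
  have h1 : ∀ ξ g, (A - B) (expVec θ₁ ξ) g = 0 := fun ξ g =>
    functional_eq_zero (L := (A - B) (expVec θ₁ ξ)) (fun η => sub_eq_zero.2 (h ξ η)) g
  have h2 : ∀ f g, (A - B) f g = 0 := fun f g =>
    functional_eq_zero (L := (evalAt g).comp (A - B)) (fun ξ => h1 ξ g) f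
  ext f g
  exact sub_eq_zero.1 (h2 f g)

theorem symbol_injective : Function.Injective (symbol : Op θ₁ θ₂ N₁ N₂ → N₁ → N₂ → ℂ) :=
  fun _ _ h => op_ext fun ξ η => congrFun (congrFun h ξ) η

theorem sepEntire_symbol (A : Op θ₁ θ₂ N₁ N₂) : SepEntire (symbol A) where
  left η := differentiable_expVec ((evalAt (expVec θ₂ η)).comp A)
  right ξ := differentiable_expVec (A (expVec θ₁ ξ))

/-- The characterization of symbols: sufficiency. -/
theorem isSymbol_of_bound [StarShaped θ₁] [StarShaped θ₂] {F : N₁ → N₂ → ℂ} {p : ℕ} {a C : ℝ}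
    (hs : SepEntire F) (ha : 0 < a) (hC : 0 ≤ C) (hF : SymBound θ₁ θ₂ p a C F) :
    IsSymbol θ₁ θ₂ F := by
  obtain ⟨X⟩ := nonempty_nuclearExpansion N₁ p
  obtain ⟨Y⟩ := nonempty_nuclearExpansion N₂ p
  obtain ⟨V⟩ := X.nonempty_dualWeights (θ := θ₁) ha
  obtain ⟨W⟩ := Y.nonempty_dualWeights (θ := θ₂) ha
  obtain ⟨Ξ, hΞ, -⟩ := exists_op_hasSum V W hs ha.le hC hF
  exact ⟨Ξ, hΞ, fun Ξ' h => symbol_injective (h.trans hΞ.symm)⟩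

theorem IsSymbol.symbol_ofSymbol {F : N₁ → N₂ → ℂ} (h : IsSymbol θ₁ θ₂ F) :
    symbol (ofSymbol θ₁ θ₂ F) = F := by
  rw [ofSymbol, dif_pos h.exists]
  exact h.exists.choose_spec

end Uniqueness

/-! ### Convergence of operators in terms of symbols -/

section Convergence

variable [IsGrowth θ₁] [IsGrowth θ₂]

theorem tendsto_mixedCoef {ι : Type*} {l : Filter ι} [l.IsCountablyGenerated] {p : ℕ} {a C : ℝ}
    {X : NuclearExpansion N₁ p} {Y : NuclearExpansion N₂ p} (V : DualWeights θ₁ X a)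
    {F : ι → N₁ → N₂ → ℂ} (hs : ∀ i, SepEntire (F i)) (ha : 0 ≤ a) (hC : 0 ≤ C)
    (hF : ∀ᶠ i in l, SymBound θ₁ θ₂ p a C (F i))
    (hlim : ∀ ξ η, Tendsto (fun i => F i ξ η) l (𝓝 0)) (w : Word × Word) :
    Tendsto (fun i => mixedCoef X Y (F i) w) l (𝓝 0) := by
  have h1 : ∀ w y, Tendsto (fun i => partialCoef X (F i) w y) l (𝓝 0) := fun w y => by
    have := tendsto_iterDeriv (G := fun i x => F i (ofStep N₁ p x) (ofStep N₂ p y))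
      (hF.mono fun i hi => (hs i).bddEntire_left ha hC hi y) (bddEntire_const 0)
      (fun R => ⟨_, hF.mono fun i hi x hx => hi.norm_le_of_le ha hC hx le_rfl⟩)
      (fun x => hlim _ _) (X.vecs w) 0
    rwa [iterDeriv_zero] at this
  have := tendsto_iterDeriv (G := fun i => partialCoef X (F i) w.1)
    (hF.mono fun i hi => bddEntire_partialCoef V (hs i) ha hC hi w.1) (bddEntire_const 0)
    (fun R => ⟨_, hF.mono fun i hi y hy => norm_partialCoef_le_of_le V (hs i) ha hC hi w.1 hy⟩)
    (fun y => h1 w.1 y) (Y.vecs w.2) 0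
  rwa [iterDeriv_zero] at this

/-- Operators whose symbols converge to `0` pointwise, with a common bound, converge to `0` in the
topology of bounded convergence: the mixed derivatives of the symbols at `0` converge, and their
pairing with test functions from bounded sets is uniformly dominated. -/
theorem tendsto_zero_of_symbol [StarShaped θ₁] [StarShaped θ₂] {ι : Type*} {l : Filter ι}
    [l.IsCountablyGenerated] {Ξ : ι → Op θ₁ θ₂ N₁ N₂} {p : ℕ} {a C : ℝ} (ha : 0 < a) (hC : 0 ≤ C)
    (hF : ∀ᶠ i in l, SymBound θ₁ θ₂ p a C (symbol (Ξ i)))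
    (hlim : ∀ ξ η, Tendsto (fun i => symbol (Ξ i) ξ η) l (𝓝 0)) :
    Tendsto Ξ l (𝓝 0) := by
  obtain ⟨X⟩ := nonempty_nuclearExpansion N₁ p
  obtain ⟨Y⟩ := nonempty_nuclearExpansion N₂ p
  obtain ⟨V⟩ := X.nonempty_dualWeights (θ := θ₁) ha
  obtain ⟨W⟩ := Y.nonempty_dualWeights (θ := θ₂) ha
  refine tendsto_op_zero fun S₁ h₁ S₂ h₂ ε hε => ?_
  obtain ⟨r₁, hr₁, hS₁⟩ := (testSpace_withSeminorms θ₁ N₁).isVonNBounded_iff_seminorm_bounded.1 h₁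
    (X.idx, ⟨V.b, V.b_pos⟩)
  obtain ⟨r₂, hr₂, hS₂⟩ := (testSpace_withSeminorms θ₂ N₂).isVonNBounded_iff_seminorm_bounded.1 h₂
    (Y.idx, ⟨W.b, W.b_pos⟩)
  -- the normalized coefficients; where a weight vanishes, so does the coefficient
  set d : ι → Word × Word → ℝ := fun i w =>
    ‖mixedCoef X Y (symbol (Ξ i)) w‖ / (V.ω w.1 * W.ω w.2) with hd
  have hω : ∀ w : Word × Word, 0 ≤ V.ω w.1 * W.ω w.2 := fun w =>
    mul_nonneg (V.ω_nonneg _) (W.ω_nonneg _)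
  have hσ : ∀ w : Word × Word, 0 ≤ V.σ w.1 * W.σ w.2 := fun w =>
    mul_nonneg (V.σ_nonneg _) (W.σ_nonneg _)
  have hσs : Summable fun w : Word × Word => C * (V.σ w.1 * W.σ w.2) * (r₁ * r₂) :=
    ((V.summable.mul_of_nonneg W.summable V.σ_nonneg W.σ_nonneg).mul_left C).mul_right (r₁ * r₂)
  have hd0 : ∀ i w, 0 ≤ d i w := fun i w => div_nonneg (norm_nonneg _) (hω w)
  have hdC : ∀ i, SymBound θ₁ θ₂ p a C (symbol (Ξ i)) → ∀ w, d i w ≤ C ∧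
      ‖mixedCoef X Y (symbol (Ξ i)) w‖ = d i w * (V.ω w.1 * W.ω w.2) := fun i hi w => by
    have h := norm_mixedCoef_le V W (sepEntire_symbol (Ξ i)) ha.le hC hi w
    rcases (hω w).eq_or_lt with h0 | h0
    · rw [← h0, mul_zero] at h
      simp only [hd, ← h0, div_zero, mul_zero]
      exact ⟨hC, le_antisymm h (norm_nonneg _)⟩
    · exact ⟨(div_le_iff₀ h0).2 h, (div_mul_cancel₀ _ h0.ne').symm⟩
  have hbd : ∀ i, SymBound θ₁ θ₂ p a C (symbol (Ξ i)) → ∀ w,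
      ‖d i w * (V.σ w.1 * W.σ w.2) * (r₁ * r₂)‖ ≤ C * (V.σ w.1 * W.σ w.2) * (r₁ * r₂) :=
    fun i hi w => by
      have := hd0 i w
      have := hσ w
      rw [Real.norm_of_nonneg (by positivity)]
      have := (hdC i hi w).1
      gcongr
  have key : Tendsto (fun i => ∑' w : Word × Word, d i w * (V.σ w.1 * W.σ w.2) * (r₁ * r₂)) l
      (𝓝 (∑' _ : Word × Word, 0)) := by
    refine tendsto_tsum_of_dominated_convergence hσs (fun w => ?_) (hF.mono hbd)
    have h := (tendsto_mixedCoef (X := X) (Y := Y) V (fun i => sepEntire_symbol (Ξ i)) ha.le hC hF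
      hlim w).norm
    have := ((h.div_const (V.ω w.1 * W.ω w.2)).mul_const (V.σ w.1 * W.σ w.2)).mul_const (r₁ * r₂)
    simpa using this
  rw [tsum_zero] at key
  filter_upwards [key.eventually_le_const hε, hF] with i hi hb f hf g hg
  refine le_trans ?_ hi
  obtain ⟨Ξ', hΞ', hsum⟩ := exists_op_hasSum V W (sepEntire_symbol (Ξ i)) ha.le hC hb
  rw [symbol_injective hΞ'] at hsum
  refine (hsum f g).norm_le_of_bounded (Summable.of_norm_bounded hσs (hbd i hb)).hasSum fun w => ?_
  rw [norm_mul, norm_mul, (hdC i hb w).2]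
  have h2 := V.coeff_le w.1 f
  have h3 := W.coeff_le w.2 g
  have h4 : tnorm θ₁ N₁ X.idx V.b_pos f ≤ r₁ := (hS₁ f hf).le
  have h5 : tnorm θ₂ N₂ Y.idx W.b_pos g ≤ r₂ := (hS₂ g hg).le
  have h6 := V.σ_nonneg w.1
  have h7 := W.σ_nonneg w.2
  have h8 := mul_nonneg (W.ω_nonneg w.2) (norm_nonneg (Y.coeff w.2 g))
  have h9 := hd0 i w
  calc _ = d i w * ((V.ω w.1 * ‖X.coeff w.1 f‖) * (W.ω w.2 * ‖Y.coeff w.2 g‖)) := by ring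
    _ ≤ d i w * ((V.σ w.1 * r₁) * (W.σ w.2 * r₂)) := by
        refine mul_le_mul_of_nonneg_left (mul_le_mul (h2.trans ?_) (h3.trans ?_) h8 ?_) h9
        · gcongr
        · gcongr
        · positivity
    _ = _ := by ring

end Convergence

end Kernel

/-! ### Bounds for symbols -/

section SepEntire

variable {N₁ N₂ : Type*} [AddCommGroup N₁] [Module ℂ N₁] [AddCommGroup N₂] [Module ℂ N₂]
  {F G : N₁ → N₂ → ℂ}

theorem SepEntire.mul (hF : SepEntire F) (hG : SepEntire G) :
    SepEntire fun ξ η => F ξ η * G ξ η where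
  left η u v := (hF.left η u v).mul (hG.left η u v)
  right ξ u v := (hF.right ξ u v).mul (hG.right ξ u v)

theorem SepEntire.cexp (hF : SepEntire F) : SepEntire fun ξ η => Complex.exp (F ξ η) where
  left η u v := (hF.left η u v).cexp
  right ξ u v := (hF.right ξ u v).cexp

end SepEntire

section Bounds

variable {θ₁ θ₂ : ℝ → ℝ} {N N₁ N₂ : Type*} [AddCommGroup N] [Module ℂ N] [UniformSpace N]
  [NuclearHilbertian N] [AddCommGroup N₁] [Module ℂ N₁] [UniformSpace N₁]
  [NuclearHilbertian N₁] [AddCommGroup N₂] [Module ℂ N₂] [UniformSpace N₂] [NuclearHilbertian N₂]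

/-- Exponentials normalized by a growth that exhausts all the norms form a bounded sequence. -/
theorem isVonNBounded_normalized (θ : ℝ → ℝ) [IsGrowth θ] (ξ : ℕ → N) :
    Bornology.IsVonNBounded ℂ (range fun k : ℕ =>
      ((Real.exp (-conj θ ((k + 1 : ℝ) * ‖toStep N k (ξ k)‖)) : ℝ) : ℂ) • expVec θ (ξ k)) := by
  rw [(testSpace_withSeminorms θ N).isVonNBounded_iff_seminorm_bounded]
  rintro ⟨p, a, ha⟩
  have hbd : ∀ᶠ k : ℕ in atTop, tnorm θ N p ha
      (((Real.exp (-conj θ ((k + 1 : ℝ) * ‖toStep N k (ξ k)‖)) : ℝ) : ℂ) • expVec θ (ξ k)) ≤ 1 := by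
    filter_upwards [eventually_ge_atTop p, eventually_ge_atTop ⌈1 / a⌉₊] with k hp hk
    rw [map_smul_eq_mul, Complex.norm_real, Real.norm_of_nonneg (Real.exp_pos _).le]
    have h1 := tnorm_expVec_le (θ := θ) (ξ k) p ha
    have h2 : conj θ (‖toStep N p (ξ k)‖ / a) ≤ conj θ ((k + 1 : ℝ) * ‖toStep N k (ξ k)‖) := by
      have ha' : 0 < a := ha
      refine conj_mono (by positivity) ?_
      have h3 : 1 / a ≤ k + 1 := (Nat.ceil_le.1 hk).trans (by linarith)
      have h4 := norm_toStep_mono N hp (ξ k)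
      rw [div_eq_mul_one_div, mul_comm]
      exact mul_le_mul h3 h4 (norm_nonneg _) (by positivity)
    calc _ ≤ Real.exp (-conj θ ((k + 1 : ℝ) * ‖toStep N k (ξ k)‖)) *
          Real.exp (conj θ ((k + 1 : ℝ) * ‖toStep N k (ξ k)‖)) := by
          refine mul_le_mul_of_nonneg_left (h1.trans ?_) (Real.exp_pos _).le
          exact Real.exp_le_exp.2 h2
      _ = 1 := by rw [← Real.exp_add, neg_add_cancel, Real.exp_zero]
  obtain ⟨r, hr⟩ := (isBoundedUnder_of_eventually_le hbd).bddAbove_range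
  refine ⟨max r 0 + 1, by positivity, ?_⟩
  rintro _ ⟨k, rfl⟩
  exact ((hr ⟨k, rfl⟩).trans (le_max_left _ _)).trans_lt (lt_add_one _)

/-- The characterization of symbols: necessity, uniformly on compact sets of operators.  If no bound
held, exponentials at the points of violation, normalized to form bounded sequences, would be
mapped to unbounded values. -/
theorem exists_symBound_of_isCompact [IsGrowth θ₁] [IsGrowth θ₂] {K : Set (Op θ₁ θ₂ N₁ N₂)}
    (hK : IsCompact K) :
    ∃ (p : ℕ) (a C : ℝ), 0 < a ∧ 0 ≤ C ∧ ∀ Ξ ∈ K, SymBound θ₁ θ₂ p a C (symbol Ξ) := by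
  by_contra! hcon
  have h : ∀ k : ℕ, ∃ Ξ ∈ K, ∃ ξ η, (k : ℝ) * Real.exp (conj θ₁ ((k + 1 : ℝ) * ‖toStep N₁ k ξ‖) +
      conj θ₂ ((k + 1 : ℝ) * ‖toStep N₂ k η‖)) < ‖symbol Ξ ξ η‖ := fun k => by
    obtain ⟨Ξ, hΞ, h⟩ := hcon k (k + 1) k (by positivity) (by positivity)
    rw [SymBound] at h
    push Not at h
    exact ⟨Ξ, hΞ, h⟩
  choose Ξ hΞ ξ η hlt using h
  obtain ⟨R, hR⟩ := exists_bound_of_isCompact hK (isVonNBounded_normalized θ₁ ξ)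
    (isVonNBounded_normalized θ₂ η)
  obtain ⟨k, hk⟩ := exists_nat_ge R
  have h1 := hR (Ξ k) (hΞ k) _ ⟨k, rfl⟩ _ ⟨k, rfl⟩
  have h2 := hlt k
  simp only [map_smul, smul_apply, smul_eq_mul, norm_mul, Complex.norm_real,
    Real.norm_of_nonneg (Real.exp_pos _).le] at h1
  change Real.exp _ * (Real.exp _ * ‖symbol (Ξ k) (ξ k) (η k)‖) ≤ R at h1
  rw [Real.exp_add] at h2
  rw [Real.exp_neg, Real.exp_neg, inv_mul_le_iff₀ (Real.exp_pos _),
    inv_mul_le_iff₀ (Real.exp_pos _)] at h1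
  have h3 := h2.trans_le h1
  have h4 : (k : ℝ) * (Real.exp (conj θ₁ ((k + 1 : ℝ) * ‖toStep N₁ k (ξ k)‖)) *
      Real.exp (conj θ₂ ((k + 1 : ℝ) * ‖toStep N₂ k (η k)‖))) <
      R * (Real.exp (conj θ₁ ((k + 1 : ℝ) * ‖toStep N₁ k (ξ k)‖)) *
      Real.exp (conj θ₂ ((k + 1 : ℝ) * ‖toStep N₂ k (η k)‖))) := h3.trans_le (le_of_eq (by ring))
  exact absurd (lt_of_mul_lt_mul_right h4 (by positivity)) (not_lt.2 hk)

section Closure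

variable {p : ℕ} {a b C D : ℝ} {F G : N₁ → N₂ → ℂ}

theorem SymBound.mono [IsGrowth θ₁] [IsGrowth θ₂] (hF : SymBound θ₁ θ₂ p a C F) (ha : 0 ≤ a)
    (hab : a ≤ b) (hC : C ≤ D) (hC0 : 0 ≤ D) : SymBound θ₁ θ₂ p b D F := fun ξ η => by
  have h1 : conj θ₁ (a * ‖toStep N₁ p ξ‖) ≤ conj θ₁ (b * ‖toStep N₁ p ξ‖) :=
    conj_mono (by positivity) (by gcongr)
  have h2 : conj θ₂ (a * ‖toStep N₂ p η‖) ≤ conj θ₂ (b * ‖toStep N₂ p η‖) :=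
    conj_mono (by positivity) (by gcongr)
  refine (hF ξ η).trans ?_
  gcongr

theorem SymBound.add (hF : SymBound θ₁ θ₂ p a C F) (hG : SymBound θ₁ θ₂ p a D G) :
    SymBound θ₁ θ₂ p a (C + D) fun ξ η => F ξ η + G ξ η := fun ξ η => by
  rw [add_mul]
  exact (norm_add_le _ _).trans (add_le_add (hF ξ η) (hG ξ η))

theorem SymBound.mul [IsGrowth θ₁] [IsGrowth θ₂] (hC : 0 ≤ C) (hF : SymBound θ₁ θ₂ p a C F)
    (hG : SymBound θ₁ θ₂ p a D G) :
    SymBound θ₁ θ₂ p (2 * a) (C * D * Real.exp (-θ₁ 0 - θ₂ 0)) fun ξ η => F ξ η * G ξ η :=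
  fun ξ η => by
  have h1 := two_mul_conj_le (θ := θ₁) (a * ‖toStep N₁ p ξ‖)
  have h2 := two_mul_conj_le (θ := θ₂) (a * ‖toStep N₂ p η‖)
  rw [← mul_assoc] at h1 h2
  have hD : 0 ≤ D := by
    have := (norm_nonneg _).trans (hG ξ η)
    exact nonneg_of_mul_nonneg_left this (Real.exp_pos _)
  rw [norm_mul]
  refine (mul_le_mul (hF ξ η) (hG ξ η) (norm_nonneg _) (by positivity)).trans ?_
  rw [mul_mul_mul_comm, ← Real.exp_add, mul_assoc (C * D), ← Real.exp_add]
  refine mul_le_mul_of_nonneg_left (Real.exp_le_exp.2 ?_) (by positivity)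
  linarith

theorem SymBound.incl [h₁ : IsGrowth θ₁] [h₂ : IsGrowth θ₂] (hC : 0 ≤ C)
    (hF : SymBound θ₁ θ₂ p a C F) : SymBound (expConj θ₁) (expConj θ₂) p a C F := fun ξ η => by
  have h : ∀ (θ : ℝ → ℝ) [h : IsGrowth θ] (x : ℝ), conj θ x ≤ conj (expConj θ) x :=
    fun θ h x => conj_le fun t ht =>
      (sub_le_sub_left (expConj_le h ht) _).trans ((IsGrowth.expConj (θ := θ)).le_conj x ht)
  refine (hF ξ η).trans (mul_le_mul_of_nonneg_left (Real.exp_le_exp.2 ?_) hC)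
  exact add_le_add (h _ _) (h _ _)

/-- The exponential of a symbol has the growth of symbols for the functions `(e^{θ*})*`, because
`e^{θ*}` is dominated by `((e^{θ*})*)*` up to a dilation; products and constants are absorbed by
further dilations. -/
theorem SymBound.exp [h₁ : IsYoung θ₁] [h₂ : IsYoung θ₂] (ha : 0 ≤ a) (hC : 0 ≤ C)
    (hF : SymBound θ₁ θ₂ p a C F) :
    SymBound (expConj θ₁) (expConj θ₂) p (8 * a) (Real.exp (C ^ 2 + 4))
      fun ξ η => Complex.exp (F ξ η) := fun ξ η => by
  have key : ∀ (θ : ℝ → ℝ) [IsYoung θ] (r : ℝ), 0 ≤ r →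
      Real.exp (conj θ (a * r)) ^ 4 ≤ conj (expConj θ) (8 * a * r) + 2 := fun θ h r hr => by
    have h1 := two_mul_conj_le (θ := θ) (a * r)
    have h2 := two_mul_conj_le (θ := θ) (2 * (a * r))
    rw [h.zero] at h1 h2
    have h3 := exp_conj_le (θ := θ) (x := 2 * (2 * (a * r))) (by positivity)
    rw [show 2 * (2 * (2 * (a * r))) = 8 * a * r by ring] at h3
    rw [← Real.exp_nat_mul]
    refine (Real.exp_le_exp.2 ?_).trans h3
    push_cast
    linarith
  have k1 := key θ₁ ‖toStep N₁ p ξ‖ (norm_nonneg _)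
  have k2 := key θ₂ ‖toStep N₂ p η‖ (norm_nonneg _)
  have hb := hF ξ η
  rw [Real.exp_add] at hb
  rw [Complex.norm_exp, ← Real.exp_add]
  refine Real.exp_le_exp.2 ((Complex.re_le_norm _).trans (hb.trans ?_))
  generalize Real.exp (conj θ₁ (a * ‖toStep N₁ p ξ‖)) = u at *
  generalize Real.exp (conj θ₂ (a * ‖toStep N₂ p η‖)) = v at *
  have h3 : C * (u * v) ≤ C * (u ^ 2 + v ^ 2) / 2 := by
    nlinarith [mul_nonneg hC (sq_nonneg (u - v))]
  nlinarith [sq_nonneg (C - u ^ 2), sq_nonneg (C - v ^ 2)]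

end Closure

section Operations

theorem exists_symBound [IsGrowth θ₁] [IsGrowth θ₂] (A : Op θ₁ θ₂ N₁ N₂) :
    ∃ (p : ℕ) (a C : ℝ), 0 < a ∧ 0 ≤ C ∧ SymBound θ₁ θ₂ p a C (symbol A) := by
  obtain ⟨p, a, C, ha, hC, h⟩ := exists_symBound_of_isCompact (isCompact_singleton (x := A))
  exact ⟨p, a, C, ha, hC, h A rfl⟩

theorem isSymbol_mul [IsGrowth θ₁] [IsGrowth θ₂] [StarShaped θ₁] [StarShaped θ₂]
    (A B : Op θ₁ θ₂ N₁ N₂) : IsSymbol θ₁ θ₂ fun ξ η => symbol A ξ η * symbol B ξ η := by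
  obtain ⟨p, a, C, ha, hC, h⟩ := exists_symBound_of_isCompact
    ((isCompact_singleton (x := A)).insert B)
  exact isSymbol_of_bound ((sepEntire_symbol A).mul (sepEntire_symbol B)) (by positivity)
    (by positivity) ((h A (by simp)).mul hC (h B (by simp)))

theorem symbol_conv [IsGrowth θ₁] [IsGrowth θ₂] [StarShaped θ₁] [StarShaped θ₂]
    (A B : Op θ₁ θ₂ N₁ N₂) (ξ : N₁) (η : N₂) :
    symbol (conv A B) ξ η = symbol A ξ η * symbol B ξ η :=
  congrFun (congrFun (isSymbol_mul A B).symbol_ofSymbol ξ) η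

theorem isSymbol_exp [IsYoung θ₁] [IsYoung θ₂] (A : Op θ₁ θ₂ N₁ N₂) :
    IsSymbol (expConj θ₁) (expConj θ₂) fun ξ η => Complex.exp (symbol A ξ η) := by
  obtain ⟨p, a, C, ha, hC, h⟩ := exists_symBound A
  exact isSymbol_of_bound (sepEntire_symbol A).cexp (by positivity) (by positivity)
    (h.exp ha.le hC)

theorem symbol_convExp [IsYoung θ₁] [IsYoung θ₂] (A : Op θ₁ θ₂ N₁ N₂) (ξ : N₁) (η : N₂) :
    symbol (convExp A) ξ η = Complex.exp (symbol A ξ η) :=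
  congrFun (congrFun (isSymbol_exp A).symbol_ofSymbol ξ) η

theorem symbol_opIncl [IsGrowth θ₁] [IsGrowth θ₂] (A : Op θ₁ θ₂ N₁ N₂) (ξ : N₁) (η : N₂) :
    symbol (opIncl A) ξ η = symbol A ξ η := rfl

theorem symbol_add [IsGrowth θ₁] [IsGrowth θ₂] (A B : Op θ₁ θ₂ N₁ N₂) (ξ : N₁) (η : N₂) :
    symbol (A + B) ξ η = symbol A ξ η + symbol B ξ η := rfl

/-- The symbol at a point, as a continuous linear functional. -/
def symbolAt [IsGrowth θ₁] [IsGrowth θ₂] (ξ : N₁) (η : N₂) : Op θ₁ θ₂ N₁ N₂ →L[ℂ] ℂ :=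
  (evalAt (expVec θ₂ η)).comp (evalAt (expVec θ₁ ξ))

end Operations

section Integrals

theorem norm_toStep_line_le (p : ℕ) (u v : N) {R : ℝ} {w : ℂ} (hw : ‖w‖ ≤ R) :
    ‖toStep N p (u + w • v)‖ ≤ ‖toStep N p u‖ + R * ‖toStep N p v‖ := by
  rw [map_add, map_smul]
  refine (norm_add_le _ _).trans ?_
  rw [norm_smul]
  gcongr

theorem SymBound.integral {F : ℝ → N₁ → N₂ → ℂ} {s t : ℝ} {p : ℕ} {a C : ℝ}
    (hF : ∀ r ∈ uIcc s t, SymBound θ₁ θ₂ p a C (F r)) :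
    SymBound θ₁ θ₂ p a (C * |t - s|) fun ξ η => ∫ r in s..t, F r ξ η := fun ξ η => by
  refine (intervalIntegral.norm_integral_le_of_norm_le_const
    fun r hr => hF r (uIoc_subset_uIcc hr) ξ η).trans (le_of_eq ?_)
  ring

variable [IsGrowth θ₁] [IsGrowth θ₂] {X : ℝ → Op θ₁ θ₂ N₁ N₂} {s t : ℝ} {p : ℕ} {a C : ℝ}

theorem sepEntire_symbolIntegral (ha : 0 ≤ a) (hC : 0 ≤ C)
    (hX : ∀ r ∈ uIcc s t, SymBound θ₁ θ₂ p a C (symbol (X r)))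
    (hc : ∀ ξ η, ContinuousOn (fun r => symbol (X r) ξ η) (uIcc s t)) :
    SepEntire (symbolIntegral X s t) := by
  have hm : ∀ ξ η, MeasureTheory.AEStronglyMeasurable (fun r => symbol (X r) ξ η)
      (MeasureTheory.volume.restrict (uIoc s t)) := fun ξ η =>
    ((hc ξ η).mono uIoc_subset_uIcc).aestronglyMeasurable measurableSet_uIoc
  have hae : ∀ {P : ℝ → Prop}, (∀ r ∈ uIcc s t, P r) →
      ∀ᵐ r ∂MeasureTheory.volume.restrict (uIoc s t), P r := fun h =>
    (MeasureTheory.ae_restrict_mem measurableSet_uIoc).mono fun r hr => h r (uIoc_subset_uIcc hr)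
  have hint : ∀ c : ℝ, MeasureTheory.Integrable (fun _ => c)
      (MeasureTheory.volume.restrict (uIoc s t)) := fun c => by
    have : MeasureTheory.IsFiniteMeasure (MeasureTheory.volume.restrict (uIoc s t)) :=
      ⟨by simp [uIoc]⟩
    exact MeasureTheory.integrable_const c
  constructor
  · intro η u v
    simp_rw [QWN.symbolIntegral, intervalIntegral.intervalIntegral_eq_integral_uIoc]
    refine Differentiable.const_smul (differentiable_integral_of_dominated
      (Eventually.of_forall fun r => (sepEntire_symbol (X r)).left η u v) (fun w => hm _ _)
      fun R => ⟨fun _ => C * Real.exp (conj θ₂ (a * ‖toStep N₂ p η‖)) *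
        Real.exp (conj θ₁ (a * (‖toStep N₁ p u‖ + R * ‖toStep N₁ p v‖))), hint _,
        hae fun r hr w hw => ?_⟩) _
    exact (hX r hr).norm_le_of_le ha hC (norm_toStep_line_le p u v hw) 
      (y := toStep N₂ p η) le_rfl
  · intro ξ u v
    simp_rw [QWN.symbolIntegral, intervalIntegral.intervalIntegral_eq_integral_uIoc]
    refine Differentiable.const_smul (differentiable_integral_of_dominated
      (Eventually.of_forall fun r => (sepEntire_symbol (X r)).right ξ u v) (fun w => hm _ _)
      fun R => ⟨fun _ => C *
        Real.exp (conj θ₂ (a * (‖toStep N₂ p u‖ + R * ‖toStep N₂ p v‖))) *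
        Real.exp (conj θ₁ (a * ‖toStep N₁ p ξ‖)), hint _, hae fun r hr w hw => ?_⟩) _
    exact (hX r hr).norm_le_of_le ha hC (x := toStep N₁ p ξ) le_rfl (norm_toStep_line_le p u v hw)

theorem opIntegrable_of_bound [StarShaped θ₁] [StarShaped θ₂] (ha : 0 < a) (hC : 0 ≤ C)
    (hX : ∀ r ∈ uIcc s t, SymBound θ₁ θ₂ p a C (symbol (X r)))
    (hc : ∀ ξ η, ContinuousOn (fun r => symbol (X r) ξ η) (uIcc s t)) : OpIntegrable X s t :=
  ⟨fun ξ η => (hc ξ η).intervalIntegrable,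
    isSymbol_of_bound (sepEntire_symbolIntegral ha.le hC hX hc) ha
      (mul_nonneg hC (abs_nonneg _)) (SymBound.integral hX)⟩

theorem OpIntegrable.symbol_opIntegral (h : OpIntegrable X s t) (ξ : N₁) (η : N₂) :
    symbol (opIntegral X s t) ξ η = ∫ r in s..t, symbol (X r) ξ η :=
  congrFun (congrFun h.2.symbol_ofSymbol ξ) η

end Integrals

end Bounds

/-! ### Linear differential equations -/

section Scalar

/-- The variation of constants formula for `x' = z x + h`, `x 0 = σ`. -/
def variation (σ : ℂ) (z h : ℝ → ℂ) (t : ℝ) : ℂ :=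
  σ * Complex.exp (∫ s in 0..t, z s) + ∫ s in 0..t, Complex.exp (∫ u in s..t, z u) * h s

theorem hasDerivAt_variation (σ : ℂ) {z h : ℝ → ℂ} (hz : Continuous z) (hh : Continuous h)
    (t : ℝ) : HasDerivAt (variation σ z h) (z t * variation σ z h t + h t) t := by
  set P : ℝ → ℂ := fun t => ∫ s in 0..t, z s with hP
  have hPd : ∀ t, HasDerivAt P (z t) t := fun t =>
    intervalIntegral.integral_hasDerivAt_right (hz.intervalIntegrable _ _)
      (hz.stronglyMeasurableAtFilter _ _) hz.continuousAt
  have hPc : Continuous P := continuous_iff_continuousAt.2 fun t => (hPd t).continuousAt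
  have hk : Continuous fun s => Complex.exp (-P s) * h s := by fun_prop
  have hQd : HasDerivAt (fun t => ∫ s in 0..t, Complex.exp (-P s) * h s)
      (Complex.exp (-P t) * h t) t :=
    intervalIntegral.integral_hasDerivAt_right (hk.intervalIntegrable _ _)
      (hk.stronglyMeasurableAtFilter _ _) hk.continuousAt
  have heq : variation σ z h =
      fun t => Complex.exp (P t) * (σ + ∫ s in 0..t, Complex.exp (-P s) * h s) := by
    funext t
    rw [variation, mul_add, mul_comm σ, ← intervalIntegral.integral_const_mul]
    congr 1
    refine intervalIntegral.integral_congr fun s _ => ?_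
    have : ∫ u in s..t, z u = P t + -P s := by
      rw [← sub_eq_add_neg, hP]
      exact (intervalIntegral.integral_interval_sub_left (hz.intervalIntegrable _ _)
        (hz.intervalIntegrable _ _)).symm
    simp only [this, Complex.exp_add, mul_assoc]
  have hd := (hPd t).cexp.mul (hQd.const_add σ)
  rw [heq]
  refine hd.congr_deriv ?_
  have h1 : Complex.exp (P t) * Complex.exp (-P t) = 1 := by
    rw [← Complex.exp_add, add_neg_cancel, Complex.exp_zero]
  linear_combination h t * h1

variable {α β : ℝ} {z h : ℝ → ℂ}

theorem uIcc_subset_of_mem {s t : ℝ} (hs : s ∈ Icc α β) (ht : t ∈ Icc α β) :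
    uIcc s t ⊆ Icc α β := ordConnected_Icc.uIcc_subset hs ht

theorem variation_congr {σ : ℂ} {z' h' : ℝ → ℂ} (h0 : (0 : ℝ) ∈ Icc α β)
    (hz : EqOn z z' (Icc α β)) (hh : EqOn h h' (Icc α β)) :
    EqOn (variation σ z h) (variation σ z' h') (Icc α β) := fun t ht => by
  have h1 : ∀ s ∈ Icc α β, ∫ u in s..t, z u = ∫ u in s..t, z' u := fun s hs =>
    intervalIntegral.integral_congr fun u hu => hz (uIcc_subset_of_mem hs ht hu)
  rw [variation, variation, h1 0 h0]
  congr 1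
  refine intervalIntegral.integral_congr fun s hs => ?_
  have hs' := uIcc_subset_of_mem h0 ht hs
  simp only [h1 s hs', hh hs']

theorem continuous_IccExtend (h0 : (0 : ℝ) ∈ Icc α β) (hz : ContinuousOn z (Icc α β)) :
    Continuous (IccExtend (h0.1.trans h0.2) ((Icc α β).domRestrict z)) :=
  (continuousOn_iff_continuous_domRestrict.1 hz).Icc_extend'

theorem eqOn_IccExtend (h0 : (0 : ℝ) ∈ Icc α β) (z : ℝ → ℂ) :
    EqOn z (IccExtend (h0.1.trans h0.2) ((Icc α β).domRestrict z)) (Icc α β) := fun t ht => by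
  rw [IccExtend_of_mem _ _ ht]
  rfl

/-- The derivative on a compact interval, for coefficients that are continuous there only: they are
extended by constants. -/
theorem hasDerivWithinAt_variation (σ : ℂ) (h0 : (0 : ℝ) ∈ Icc α β)
    (hz : ContinuousOn z (Icc α β)) (hh : ContinuousOn h (Icc α β)) {t : ℝ} (ht : t ∈ Icc α β) :
    HasDerivWithinAt (variation σ z h) (z t * variation σ z h t + h t) (Icc α β) t := by
  have hcongr := variation_congr (σ := σ) h0 (eqOn_IccExtend h0 z) (eqOn_IccExtend h0 h)
  have hd := hasDerivAt_variation σ (continuous_IccExtend h0 hz) (continuous_IccExtend h0 hh) t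
  rw [← hcongr ht, ← eqOn_IccExtend h0 z ht, ← eqOn_IccExtend h0 h ht] at hd
  exact hd.hasDerivWithinAt.congr hcongr (hcongr ht)

/-- The kernel of the variation of constants formula is continuous. -/
theorem continuousOn_variation_kernel (h0 : (0 : ℝ) ∈ Icc α β)
    (hz : ContinuousOn z (Icc α β)) (hh : ContinuousOn h (Icc α β)) {t : ℝ} (ht : t ∈ Icc α β) :
    ContinuousOn (fun s => Complex.exp (∫ u in s..t, z u) * h s) (Icc α β) := by
  set z' := IccExtend (h0.1.trans h0.2) ((Icc α β).domRestrict z)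
  have hz' : Continuous z' := continuous_IccExtend h0 hz
  have h1 : Continuous fun s => ∫ u in s..t, z' u :=
    (intervalIntegral.continuous_primitive (fun a b => hz'.intervalIntegrable a b) t).neg.congr
      fun s => (intervalIntegral.integral_symm t s).symm
  refine ContinuousOn.mul ?_ hh
  refine h1.cexp.continuousOn.congr fun s hs => ?_
  congr 1
  exact intervalIntegral.integral_congr fun u hu =>
    eqOn_IccExtend h0 z (uIcc_subset_of_mem hs ht hu)

/-- Uniqueness of the solution of a linear equation. -/
theorem eqOn_variation (σ : ℂ) (h0 : (0 : ℝ) ∈ Icc α β)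
    (hz : ContinuousOn z (Icc α β)) (hh : ContinuousOn h (Icc α β)) {y : ℝ → ℂ}
    (hy : ∀ t ∈ Icc α β, HasDerivWithinAt y (z t * y t + h t) (Icc α β) t) (hy0 : y 0 = σ) :
    EqOn y (variation σ z h) (Icc α β) := fun t ht => by
  -- `d` solves the homogeneous equation, and `e` is constant
  set d : ℝ → ℂ := fun t => y t - variation σ z h t
  set P : ℝ → ℂ := variation 1 (fun s => -z s) (fun _ => 0)
  have hP : ∀ t, P t = Complex.exp (-∫ s in 0..t, z s) := fun t => by simp [P, variation]
  have he : ∀ s ∈ Icc α β, HasDerivWithinAt (fun s => d s * P s) 0 (Icc α β) s := fun s hs => by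
    have h1 := (hy s hs).sub (hasDerivWithinAt_variation σ h0 hz hh hs)
    have h2 := hasDerivWithinAt_variation 1 h0 hz.neg (continuousOn_const (c := (0 : ℂ))) hs
    refine (h1.mul h2).congr_deriv ?_
    simp only [Pi.sub_apply, Pi.neg_apply]
    ring
  have h3 := (convex_Icc α β).norm_image_sub_le_of_norm_hasDerivWithin_le he
    (fun s _ => norm_zero.le) h0 ht
  have hd0 : d 0 = 0 := by simp [d, variation, hy0]
  rw [zero_mul, hd0, zero_mul, sub_zero, hP] at h3
  have h4 := norm_le_zero_iff.1 h3
  exact sub_eq_zero.1 ((mul_eq_zero.1 h4).resolve_right (Complex.exp_ne_zero _))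

end Scalar

section VectorDerivative

variable {E : Type*} [AddCommGroup E] [Module ℝ E] [TopologicalSpace E] [ContinuousSMul ℝ E]

/-- Derivatives in a topological vector space as limits of difference quotients. -/
theorem hasDerivWithinAt_iff_tendsto_inv_smul {f : ℝ → E} {f' : E} {s : Set ℝ} {x : ℝ} :
    HasDerivWithinAt f f' s x ↔
      Tendsto (fun y => (y - x)⁻¹ • (f y - f x - (y - x) • f')) (𝓝[s] x) (𝓝 0) := by
  have h : HasDerivWithinAt f f' s x ↔
      Asymptotics.IsLittleOTVS ℝ (𝓝[s] x ×ˢ pure x)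
        (fun p : ℝ × ℝ => f p.1 - f p.2 - (p.1 - p.2) • f') (fun p => p.1 - p.2) :=
    ⟨fun h => h.isLittleOTVS, fun h => ⟨h⟩⟩
  rw [h, Asymptotics.isLittleOTVS_iff_tendsto_inv_smul, prod_pure, tendsto_map'_iff]
  · rfl
  · refine Eventually.of_forall fun p hp => ?_
    rw [sub_eq_zero.1 hp]
    simp

theorem hasDerivWithinAt_of_nhdsWithin_le {f : ℝ → E} {f' : E} {s u : Set ℝ} {x : ℝ}
    (hf : HasDerivWithinAt f f' u x) (h : 𝓝[s] x ≤ 𝓝[u] x) : HasDerivWithinAt f f' s x :=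
  hasDerivWithinAt_iff_tendsto_inv_smul.2 ((hasDerivWithinAt_iff_tendsto_inv_smul.1 hf).mono_left h)

/-- A continuous linear functional may be applied to a derivative. -/
theorem hasDerivWithinAt_functional {f : ℝ → E} {f' : E} {s : Set ℝ} {x : ℝ}
    (hf : HasDerivWithinAt f f' s x) (L : E →L[ℝ] ℂ) :
    HasDerivWithinAt (fun t => L (f t)) (L f') s x := by
  rw [hasDerivWithinAt_iff_tendsto_inv_smul] at hf ⊢
  have := (L.continuous.tendsto 0).comp hf
  rw [map_zero] at this
  refine this.congr fun y => ?_
  simp only [Function.comp, map_smul, map_sub]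

end VectorDerivative

/-! ### The initial value problem -/

section InitialValueProblem

variable {θ₁ θ₂ : ℝ → ℝ} {N₁ N₂ : Type*} [AddCommGroup N₁] [Module ℂ N₁] [UniformSpace N₁]
  [NuclearHilbertian N₁] [AddCommGroup N₂] [Module ℂ N₂] [UniformSpace N₂] [NuclearHilbertian N₂]

theorem opIntegrable_of_continuousOn [IsYoung θ₁] [IsYoung θ₂] {Z : ℝ → Op θ₁ θ₂ N₁ N₂} {s t : ℝ}
    (hZ : ContinuousOn Z (uIcc s t)) : OpIntegrable Z s t := by
  obtain ⟨p, a, C, ha, hC, h⟩ :=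
    exists_symBound_of_isCompact (isCompact_uIcc.image_of_continuousOn hZ)
  exact opIntegrable_of_bound ha hC (fun r hr => h _ (mem_image_of_mem Z hr))
    fun ξ η => (symbolAt ξ η).continuous.comp_continuousOn hZ

/-- The solution given by the variation of constants formula. -/
def solution [IsGrowth θ₁] [IsGrowth θ₂] (Z Θ : ℝ → Op θ₁ θ₂ N₁ N₂) (Ξ₀ : Op θ₁ θ₂ N₁ N₂) (t : ℝ) :
    Op (expConj θ₁) (expConj θ₂) N₁ N₂ :=
  conv (opIncl Ξ₀) (convExp (opIntegral Z 0 t)) +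
    opIntegral (fun s => conv (convExp (opIntegral Z s t)) (opIncl (Θ s))) 0 t

/-- The variation of constants formula for the symbols. -/
def symbolSolution [IsGrowth θ₁] [IsGrowth θ₂] (Z Θ : ℝ → Op θ₁ θ₂ N₁ N₂) (Ξ₀ : Op θ₁ θ₂ N₁ N₂)
    (t : ℝ) (ξ : N₁) (η : N₂) : ℂ :=
  variation (symbol Ξ₀ ξ η) (fun s => symbol (Z s) ξ η) (fun s => symbol (Θ s) ξ η) t

variable [IsYoung θ₁] [IsYoung θ₂] {Z Θ : ℝ → Op θ₁ θ₂ N₁ N₂} {α β : ℝ}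

theorem symbol_kernel {s t : ℝ} (hZ : ContinuousOn Z (uIcc s t)) (ξ : N₁) (η : N₂) :
    symbol (conv (convExp (opIntegral Z s t)) (opIncl (Θ s))) ξ η =
      Complex.exp (∫ u in s..t, symbol (Z u) ξ η) * symbol (Θ s) ξ η := by
  rw [symbol_conv, symbol_convExp, (opIntegrable_of_continuousOn hZ).symbol_opIntegral,
    symbol_opIncl]

/-- On a compact interval, the symbols of the kernel of the variation of constants formula, and of
the right hand side of the differential equation, are bounded uniformly. -/
theorem exists_uniform_symBound (h0 : (0 : ℝ) ∈ Icc α β) (hZ : ContinuousOn Z (Icc α β))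
    (hΘ : ContinuousOn Θ (Icc α β)) (Ξ₀ : Op θ₁ θ₂ N₁ N₂) :
    ∃ (p : ℕ) (a C : ℝ), 0 < a ∧ 0 ≤ C ∧
      (∀ s ∈ Icc α β, ∀ t ∈ Icc α β, SymBound (expConj θ₁) (expConj θ₂) p a C fun ξ η =>
        Complex.exp (∫ u in s..t, symbol (Z u) ξ η) * symbol (Θ s) ξ η) ∧
      ∀ t ∈ Icc α β, SymBound (expConj θ₁) (expConj θ₂) p a C fun ξ η =>
        symbol (Z t) ξ η * symbolSolution Z Θ Ξ₀ t ξ η + symbol (Θ t) ξ η := by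
  obtain ⟨p, a, C, ha, hC, h⟩ := exists_symBound_of_isCompact
    (((isCompact_Icc.image_of_continuousOn hZ).union
      (isCompact_Icc.image_of_continuousOn hΘ)).insert Ξ₀)
  have hZb : ∀ t ∈ Icc α β, SymBound θ₁ θ₂ p a C (symbol (Z t)) := fun t ht =>
    h _ (mem_insert_of_mem _ (mem_union_left _ (mem_image_of_mem Z ht)))
  have hΘb : ∀ t ∈ Icc α β, SymBound θ₁ θ₂ p a C (symbol (Θ t)) := fun t ht =>
    h _ (mem_insert_of_mem _ (mem_union_right _ (mem_image_of_mem Θ ht)))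
  have hΞb : SymBound θ₁ θ₂ p a C (symbol Ξ₀) := h _ (mem_insert _ _)
  have hlen : ∀ s ∈ Icc α β, ∀ t ∈ Icc α β, |t - s| ≤ β - α := fun s hs t ht =>
    abs_sub_le_iff.2 ⟨by linarith [hs.1, ht.2], by linarith [hs.2, ht.1]⟩
  have hL : 0 ≤ β - α := sub_nonneg.2 (h0.1.trans h0.2)
  have hE : ∀ s ∈ Icc α β, ∀ t ∈ Icc α β, SymBound (expConj θ₁) (expConj θ₂) p (8 * a)
      (Real.exp ((C * (β - α)) ^ 2 + 4)) fun ξ η =>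
        Complex.exp (∫ u in s..t, symbol (Z u) ξ η) := fun s hs t ht =>
    ((SymBound.integral fun u hu => hZb u (uIcc_subset_of_mem hs ht hu)).mono ha.le le_rfl
      (mul_le_mul_of_nonneg_left (hlen s hs t ht) hC) (mul_nonneg hC hL)).exp ha.le
        (mul_nonneg hC hL)
  set E := Real.exp ((C * (β - α)) ^ 2 + 4) with hEdef
  have hE0 : 0 ≤ E := (Real.exp_pos _).le
  have hincl : ∀ {F : N₁ → N₂ → ℂ} (m : ℝ), 1 ≤ m → SymBound θ₁ θ₂ p a C F →
      SymBound (expConj θ₁) (expConj θ₂) p (m * a) C F := fun m hm hF =>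
    (hF.incl hC).mono ha.le (le_mul_of_one_le_left ha.le hm) le_rfl hC
  set κ := Real.exp (-expConj θ₁ 0 - expConj θ₂ 0) with hκ
  have hκ0 : 0 ≤ κ := (Real.exp_pos _).le
  have hK : ∀ s ∈ Icc α β, ∀ t ∈ Icc α β, SymBound (expConj θ₁) (expConj θ₂) p (2 * (8 * a))
      (E * C * κ) fun ξ η => Complex.exp (∫ u in s..t, symbol (Z u) ξ η) * symbol (Θ s) ξ η :=
    fun s hs t ht => (hE s hs t ht).mul hE0 (hincl 8 (by norm_num) (hΘb s hs))
  have hD0 : 0 ≤ E * C * κ * (β - α) := by positivity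
  have hX : ∀ t ∈ Icc α β, SymBound (expConj θ₁) (expConj θ₂) p (2 * (8 * a))
      (C * E * κ + E * C * κ * (β - α)) (symbolSolution Z Θ Ξ₀ t) := fun t ht =>
    ((hincl 8 (by norm_num) hΞb).mul hC (hE 0 h0 t ht)).add
      ((SymBound.integral fun s hs => hK s (uIcc_subset_of_mem h0 ht hs) t ht).mono
        (by positivity) le_rfl (mul_le_mul_of_nonneg_left (hlen 0 h0 t ht) (by positivity)) hD0)
  have hR : ∀ t ∈ Icc α β, SymBound (expConj θ₁) (expConj θ₂) p (2 * (2 * (8 * a)))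
      (C * (C * E * κ + E * C * κ * (β - α)) * κ + C) fun ξ η =>
        symbol (Z t) ξ η * symbolSolution Z Θ Ξ₀ t ξ η + symbol (Θ t) ξ η := fun t ht => by
    refine SymBound.add (SymBound.mul hC ?_ (hX t ht)) ?_
    · have := hincl 16 (by norm_num) (hZb t ht)
      rwa [show 16 * a = 2 * (8 * a) by ring] at this
    · have := hincl 32 (by norm_num) (hΘb t ht)
      rwa [show 32 * a = 2 * (2 * (8 * a)) by ring] at this
  refine ⟨p, 2 * (2 * (8 * a)), max (E * C * κ)
    (C * (C * E * κ + E * C * κ * (β - α)) * κ + C), by positivity, by positivity,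
    fun s hs t ht => ?_, fun t ht => ?_⟩
  · exact (hK s hs t ht).mono (by positivity) (by linarith) (le_max_left _ _) (by positivity)
  · exact (hR t ht).mono (by positivity) le_rfl (le_max_right _ _) (by positivity)

theorem continuousOn_symbol {s : Set ℝ} (hZ : ContinuousOn Z s) (ξ : N₁) (η : N₂) :
    ContinuousOn (fun t => symbol (Z t) ξ η) s :=
  (symbolAt ξ η).continuous.comp_continuousOn hZ

theorem opIntegrable_kernel (h0 : (0 : ℝ) ∈ Icc α β) (hZ : ContinuousOn Z (Icc α β))
    (hΘ : ContinuousOn Θ (Icc α β)) {t : ℝ} (ht : t ∈ Icc α β) :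
    OpIntegrable (fun s => conv (convExp (opIntegral Z s t)) (opIncl (Θ s))) 0 t := by
  obtain ⟨p, a, C, ha, hC, hK, -⟩ := exists_uniform_symBound h0 hZ hΘ 0
  have hsub := uIcc_subset_of_mem h0 ht
  have hsym : ∀ s ∈ uIcc 0 t, ∀ ξ η,
      symbol (conv (convExp (opIntegral Z s t)) (opIncl (Θ s))) ξ η =
        Complex.exp (∫ u in s..t, symbol (Z u) ξ η) * symbol (Θ s) ξ η := fun s hs ξ η =>
    symbol_kernel (hZ.mono (uIcc_subset_of_mem (hsub hs) ht)) ξ η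
  refine opIntegrable_of_bound (p := p) ha hC (fun s hs ξ η => ?_) fun ξ η => ?_
  · rw [hsym s hs]
    exact hK s (hsub hs) t ht ξ η
  · exact ((continuousOn_variation_kernel h0 (continuousOn_symbol hZ ξ η)
      (continuousOn_symbol hΘ ξ η) ht).mono hsub).congr fun s hs => hsym s hs ξ η

theorem symbol_solution (h0 : (0 : ℝ) ∈ Icc α β) (hZ : ContinuousOn Z (Icc α β))
    (hΘ : ContinuousOn Θ (Icc α β)) (Ξ₀ : Op θ₁ θ₂ N₁ N₂) {t : ℝ} (ht : t ∈ Icc α β) (ξ : N₁)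
    (η : N₂) : symbol (solution Z Θ Ξ₀ t) ξ η = symbolSolution Z Θ Ξ₀ t ξ η := by
  have hsub := uIcc_subset_of_mem h0 ht
  rw [solution, symbol_add, symbol_conv, symbol_opIncl, symbol_convExp,
    (opIntegrable_of_continuousOn (hZ.mono hsub)).symbol_opIntegral,
    (opIntegrable_kernel h0 hZ hΘ ht).symbol_opIntegral, symbolSolution, variation]
  congr 1
  exact intervalIntegral.integral_congr fun s hs =>
    symbol_kernel (hZ.mono (uIcc_subset_of_mem (hsub hs) ht)) ξ η

/-- The formula solves the equation on compact intervals: the difference quotients of the symbols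
converge pointwise and, by the mean value inequality, they are uniformly bounded. -/
theorem hasDerivWithinAt_solution (h0 : (0 : ℝ) ∈ Icc α β) (hZ : ContinuousOn Z (Icc α β))
    (hΘ : ContinuousOn Θ (Icc α β)) (Ξ₀ : Op θ₁ θ₂ N₁ N₂) {t : ℝ} (ht : t ∈ Icc α β) :
    HasDerivWithinAt (solution Z Θ Ξ₀) (conv (opIncl (Z t)) (solution Z Θ Ξ₀ t) + opIncl (Θ t))
      (Icc α β) t := by
  obtain ⟨p, a, C, ha, hC, -, hR⟩ := exists_uniform_symBound h0 hZ hΘ Ξ₀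
  have hd : ∀ ξ η, ∀ s ∈ Icc α β, HasDerivWithinAt (fun s => symbolSolution Z Θ Ξ₀ s ξ η)
      (symbol (Z s) ξ η * symbolSolution Z Θ Ξ₀ s ξ η + symbol (Θ s) ξ η) (Icc α β) s :=
    fun ξ η s hs => hasDerivWithinAt_variation _ h0 (continuousOn_symbol hZ ξ η)
      (continuousOn_symbol hΘ ξ η) hs
  have hsym : ∀ s ∈ Icc α β, ∀ ξ η, symbol ((s - t)⁻¹ • (solution Z Θ Ξ₀ s - solution Z Θ Ξ₀ t -
      (s - t) • (conv (opIncl (Z t)) (solution Z Θ Ξ₀ t) + opIncl (Θ t)))) ξ η =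
      (s - t)⁻¹ • (symbolSolution Z Θ Ξ₀ s ξ η - symbolSolution Z Θ Ξ₀ t ξ η -
        (s - t) • (symbol (Z t) ξ η * symbolSolution Z Θ Ξ₀ t ξ η + symbol (Θ t) ξ η)) :=
    fun s hs ξ η => by
      rw [← symbol_solution h0 hZ hΘ Ξ₀ hs, ← symbol_solution h0 hZ hΘ Ξ₀ ht,
        ← symbol_opIncl (Z t), ← symbol_conv]
      rfl
  rw [hasDerivWithinAt_iff_tendsto_inv_smul]
  refine tendsto_zero_of_symbol (p := p) (C := 2 * C) ha (by positivity) ?_ fun ξ η => ?_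
  · filter_upwards [self_mem_nhdsWithin] with s hs ξ η
    rw [hsym s hs]
    have h1 := (convex_Icc α β).norm_image_sub_le_of_norm_hasDerivWithin_le (hd ξ η)
      (fun u hu => hR u hu ξ η) ht hs
    have h2 := hR t ht ξ η
    set B := C * Real.exp (conj (expConj θ₁) (a * ‖toStep N₁ p ξ‖) +
      conj (expConj θ₂) (a * ‖toStep N₂ p η‖)) with hB
    have hB0 : 0 ≤ B := by positivity
    rw [mul_assoc, ← hB, norm_smul, norm_inv]
    refine (mul_le_mul_of_nonneg_left ((norm_sub_le _ _).trans (add_le_add h1 ?_))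
      (inv_nonneg.2 (norm_nonneg _))).trans (b := ‖s - t‖⁻¹ * (B * ‖s - t‖ + ‖s - t‖ * B)) ?_
    · rw [norm_smul]
      gcongr
    · rcases eq_or_ne (s - t) 0 with h | h
      · rw [h]; simp; positivity
      · have := norm_ne_zero_iff.2 h
        refine le_of_eq ?_
        field_simp
        ring
  · have h1 := hasDerivWithinAt_iff_tendsto_inv_smul.1 (hd ξ η t ht)
    exact h1.congr' (eventually_nhdsWithin_of_forall fun s hs => (hsym s hs ξ η).symm)

/-- A solution is determined by its symbols, which solve scalar linear equations. -/
theorem IsSolution.symbol_eq {I : Set ℝ} {Ξ₀ : Op θ₁ θ₂ N₁ N₂}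
    {Ξ : ℝ → Op (expConj θ₁) (expConj θ₂) N₁ N₂} (h : IsSolution I Z Θ Ξ₀ Ξ)
    (h0 : (0 : ℝ) ∈ Icc α β) (hI : Icc α β ⊆ I) (hZ : ContinuousOn Z (Icc α β))
    (hΘ : ContinuousOn Θ (Icc α β)) {t : ℝ} (ht : t ∈ Icc α β) (ξ : N₁) (η : N₂) :
    symbol (Ξ t) ξ η = symbolSolution Z Θ Ξ₀ t ξ η := by
  refine eqOn_variation (symbol Ξ₀ ξ η) h0 (continuousOn_symbol hZ ξ η)
    (continuousOn_symbol hΘ ξ η) (y := fun t => symbol (Ξ t) ξ η) (fun s hs => ?_) ?_ ht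
  · have h1 := hasDerivWithinAt_functional 
      (hasDerivWithinAt_of_nhdsWithin_le (h.deriv s (hI hs)) (nhdsWithin_mono s hI))
      ((symbolAt ξ η).restrictScalars ℝ)
    refine h1.congr_deriv ?_
    change symbol (conv (opIncl (Z s)) (Ξ s) + opIncl (Θ s)) ξ η = _
    rw [symbol_add, symbol_conv, symbol_opIncl, symbol_opIncl]
  · rw [h.init, symbol_opIncl]

/-- In an interval, two points lie in a compact subinterval that is a relative neighbourhood of the
second. -/
theorem exists_Icc_mem_nhdsWithin {I : Set ℝ} (hI : I.OrdConnected) {s t : ℝ} (hs : s ∈ I)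
    (ht : t ∈ I) : ∃ α β, s ∈ Icc α β ∧ t ∈ Icc α β ∧ Icc α β ⊆ I ∧ Icc α β ∈ 𝓝[I] t := by
  have hβ : ∃ β ∈ I, t ≤ β ∧ Iic β ∈ 𝓝[I] t := by
    by_cases h : ∃ b ∈ I, t < b
    · obtain ⟨b, hb, htb⟩ := h
      exact ⟨b, hb, htb.le, mem_nhdsWithin_of_mem_nhds (Iic_mem_nhds htb)⟩
    · push Not at h
      exact ⟨t, ht, le_rfl, mem_of_superset self_mem_nhdsWithin h⟩
  have hα : ∃ α ∈ I, α ≤ t ∧ Ici α ∈ 𝓝[I] t := by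
    by_cases h : ∃ b ∈ I, b < t
    · obtain ⟨b, hb, htb⟩ := h
      exact ⟨b, hb, htb.le, mem_nhdsWithin_of_mem_nhds (Ici_mem_nhds htb)⟩
    · push Not at h
      exact ⟨t, ht, le_rfl, mem_of_superset self_mem_nhdsWithin h⟩
  obtain ⟨β, hβI, htβ, hβn⟩ := hβ
  obtain ⟨α, hαI, hαt, hαn⟩ := hα
  refine ⟨min α s, max β s, ⟨min_le_right _ _, le_max_right _ _⟩,
    ⟨min_le_of_left_le hαt, le_max_of_le_left htβ⟩, hI.out ?_ ?_, ?_⟩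
  · rcases min_choice α s with h | h <;> rwa [h]
  · rcases max_choice β s with h | h <;> rwa [h]
  · filter_upwards [hαn, hβn] with x hx hx'
    exact ⟨min_le_of_left_le hx, le_max_of_le_left hx'⟩

end InitialValueProblem

end QWN

end

theorem theorem6p2 {N₁ N₂ : Type*}
    [AddCommGroup N₁] [Module ℂ N₁] [UniformSpace N₁] [IsUniformAddGroup N₁] [CompleteSpace N₁]
    [QWN.NuclearHilbertian N₁]
    [AddCommGroup N₂] [Module ℂ N₂] [UniformSpace N₂] [IsUniformAddGroup N₂] [CompleteSpace N₂]
    [QWN.NuclearHilbertian N₂]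
    (θ₁ θ₂ : ℝ → ℝ) [QWN.IsYoung θ₁] [QWN.IsYoung θ₂]
    (I : Set ℝ) (hI : I.OrdConnected) (h0 : (0 : ℝ) ∈ I)
    (Z Θ : ℝ → QWN.Op θ₁ θ₂ N₁ N₂) (hZ : ContinuousOn Z I) (hΘ : ContinuousOn Θ I)
    (Ξ₀ : QWN.Op θ₁ θ₂ N₁ N₂) :
    -- the operations in the equation and in the formula are well defined
    (∀ A B : QWN.Op (QWN.expConj θ₁) (QWN.expConj θ₂) N₁ N₂,
      QWN.IsSymbol (QWN.expConj θ₁) (QWN.expConj θ₂)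
        fun ξ η => QWN.symbol A ξ η * QWN.symbol B ξ η) ∧
    (∀ A : QWN.Op θ₁ θ₂ N₁ N₂,
      QWN.IsSymbol (QWN.expConj θ₁) (QWN.expConj θ₂)
        fun ξ η => Complex.exp (QWN.symbol A ξ η)) ∧
    (∀ s ∈ I, ∀ t ∈ I, QWN.OpIntegrable Z s t) ∧
    (∀ t ∈ I, QWN.OpIntegrable
      (fun s => QWN.conv (QWN.convExp (QWN.opIntegral Z s t)) (QWN.opIncl (Θ s))) 0 t) ∧
    -- existence, uniqueness and the formula for the solution
    ∃ Ξ : ℝ → QWN.Op (QWN.expConj θ₁) (QWN.expConj θ₂) N₁ N₂,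
      QWN.IsSolution I Z Θ Ξ₀ Ξ ∧
      (∀ Ξ', QWN.IsSolution I Z Θ Ξ₀ Ξ' → Set.EqOn Ξ' Ξ I) ∧
      ∀ t ∈ I, Ξ t =
        QWN.conv (QWN.opIncl Ξ₀) (QWN.convExp (QWN.opIntegral Z 0 t)) +
          QWN.opIntegral
            (fun s => QWN.conv (QWN.convExp (QWN.opIntegral Z s t)) (QWN.opIncl (Θ s))) 0 t := by
  refine ⟨QWN.isSymbol_mul, QWN.isSymbol_exp, fun s hs t ht =>
    QWN.opIntegrable_of_continuousOn (hZ.mono (hI.uIcc_subset hs ht)), fun t ht => ?_,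
    QWN.solution Z Θ Ξ₀, ⟨fun t ht => ?_, ?_⟩, fun Ξ' h t ht => ?_, fun t _ => rfl⟩
  · obtain ⟨α, β, h0', ht', hsub, -⟩ := QWN.exists_Icc_mem_nhdsWithin hI h0 ht
    exact QWN.opIntegrable_kernel h0' (hZ.mono hsub) (hΘ.mono hsub) ht'
  · obtain ⟨α, β, h0', ht', hsub, hmem⟩ := QWN.exists_Icc_mem_nhdsWithin hI h0 ht
    exact QWN.hasDerivWithinAt_of_nhdsWithin_le (QWN.hasDerivWithinAt_solution h0' (hZ.mono hsub)
      (hΘ.mono hsub) Ξ₀ ht') (nhdsWithin_le_of_mem hmem)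
  · refine QWN.op_ext fun ξ η => ?_
    have h00 : (0 : ℝ) ∈ Set.Icc (0 : ℝ) 0 := ⟨le_rfl, le_rfl⟩
    have hsub : Set.Icc (0 : ℝ) 0 ⊆ I := by simpa using h0
    rw [QWN.symbol_solution h00 (hZ.mono hsub) (hΘ.mono hsub) Ξ₀ h00, QWN.symbol_opIncl]
    simp [QWN.symbolSolution, QWN.variation]
  · obtain ⟨α, β, h0', ht', hsub, -⟩ := QWN.exists_Icc_mem_nhdsWithin hI h0 ht
    refine QWN.op_ext fun ξ η => ?_
    rw [h.symbol_eq h0' hsub (hZ.mono hsub) (hΘ.mono hsub) ht',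
      QWN.symbol_solution h0' (hZ.mono hsub) (hΘ.mono hsub) Ξ₀ ht']
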